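/- **Setting.** Let $H'=\mathbb{C}((t))/\mathbb{C}$ with the symplectic form $\langle f,g\rangle=-\mathrm{Res}_{t=0}\,f\,dg$ and the $t$-adic topology, let $b_n$ be the class of $t^n$, and let $H'_+=t\mathbb{C}[[t]]$. Let $\Gamma$ be a positive-definite even lattice of finite rank $d$, $\mathfrak{h}_\Gamma=\Gamma\otimes_{\mathbb Z}\mathbb{C}$ with orthonormal basis $H^1,\dots,H^d$, and let $V$ be the Heisenberg vertex algebra $\pi_\Gamma$ (level $\ell=1$) or $\pi^0_\Gamma$ (level $\ell=0$): the space $\mathrm{Sym}(\mathfrak{h}_\Gamma\otimes t^{-1}\mathbb{C}[t^{-1}])$ on which $A\otimes t^n$ acts by multiplication for $n<0$, by $0$ for $n=0$, and, for $n>0$, by the derivation $B\otimes t^{-m}\mapsto \ell\, n\,(A,B)\,\delta_{m,n}$. An extended PPAV of dimension $g$ is a triple $(Z,F,L)$, where $Z\subset H'$ is Lagrangian, $F\subset Z$ has codimension $g$, and $L\subset F^\perp/F$ is a lattice of rank $2g$, such that $Z\cap H'_+=0$, $L_{\mathbb R}\cap (F^\perp\cap H'_+)=0$, $\frac1{2\pi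 i}\langle\,,\rangle$ is unimodular on $L$, and $B(u,v)=\frac1\pi\langle\bar u,v\rangle$ is positive definite on $Z/F$ (conjugation with respect to $L_{\mathbb R}$). Its underlying PPAV is $Z/F$ modulo the image of $L$, polarized by $B$. For a PPAV $(X,\Theta)$ of dimension $g$, let $\mathrm{Sp}(X,\Theta)$ be the set of all extended PPAVs with underlying PPAV $(X,\Theta)$; it is a complex manifold through the parametrization $(\varphi,h,\Omega)\mapsto(Z,F,L)$, where $\varphi: t^{-1}\mathbb{C}[t^{-1}]\to H'_+$ is linear and symmetric, $h=(h_1,\dots,h_g)$ is a linearly independent family in $H'_+$, $\Omega$ is a period matrix of $(X,\Theta)$, $Z$ is the graph of $\varphi$, $F=\{z\in Z:\langle h_i,z\rangle=0\ \forall i\}$, and $L$ is the lattice of the classes of $z+\pi\,\bar x(\mathrm{Im}\,\Omega)^{-1}h$ with $z\in Z$ and $x=(\langle h_i,z\rangle)_i\in\mathbb{Z}^g\Omega+\mathbb{Z}^g$. Holomorphic functions of infinitely many coordinates locally depend on finitely many of them. Let $\mathbb{F}$ be the tautological sheaf on $\mathrm{Sp}(X,\Theta)$ with fiber $F$ at $(Z,F,L)$,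 let $\mathfrak{h}^{\mathrm{out}}_\Gamma=\mathfrak{h}_\Gamma\otimes\mathbb{F}$, and let $$\widehat{\mathbb V}(X,\Theta,V)=V\otimes\mathscr{O}\,/\,\mathfrak{h}^{\mathrm{out}}_\Gamma(V\otimes\mathscr{O}),$$ with fiber $\widehat{\mathbb V}(a,V)=V/(\mathfrak{h}_\Gamma\otimes F)V$ at $a=(Z,F,L)$. Let $\mathbb{S}\mathrm{p}^+(H')$ be the identity component of the group of continuous symplectic automorphisms of $H'$ preserving $H'_+$; it acts on $\mathrm{Sp}(X,\Theta)$. Let $\mathbb{S}\mathrm{p}^+_F(H')$ be the subgroup of those $\rho$ with $\rho(F^\perp)=F^\perp$, $\rho(F)=F$ and $\rho=\mathrm{id}$ on $F^\perp/F$. Let $\mathfrak{sp}^+(H')$ be the Lie algebra of continuous endomorphisms $S$ of $H'$ with $\langle Sf,g\rangle+\langle f,Sg\rangle=0$ and $S(H'_+)\subseteq H'_+$. The algebra $\mathfrak{sp}^+(H')$ acts on $V$ as follows. For $\ell=1$, the element $b_ib_j$ ($i,j$ not both negative), i.e. the endomorphism $y\mapsto\langle b_j,y\rangle b_i+\langle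 b_i,y\rangle b_j$, acts as $\sum_k{:}H^k_iH^k_j{:}$. For $\ell=0$, it acts by the derivations of the algebra $\mathrm{Sym}(\mathfrak{h}_\Gamma\otimes t^{-1}\mathbb{C}[t^{-1}])$ induced by its action on $H'/H'_+\cong t^{-1}\mathbb{C}[t^{-1}]$. It acts on $V\otimes\mathscr{O}$ by $S(A\otimes f)=S(A)\otimes f+A\otimes S(f)$, where $S(f)(a)=\frac{d}{d\varepsilon}f((1-\varepsilon S)a)|_{\varepsilon=0}$. **Theorem 5.2.** The action of $\mathfrak{sp}^+(H')$ on $V\otimes\mathscr{O}$ preserves $\mathfrak{h}^{\mathrm{out}}_\Gamma(V\otimes\mathscr{O})$, hence induces an action on $\widehat{\mathbb V}(X,\Theta,V)$, and there is an $\mathbb{S}\mathrm{p}^+(H')$-equivariant structure on $\widehat{\mathbb V}(X,\Theta,V)$, that is, isomorphisms $x^*\widehat{\mathbb V}(X,\Theta,V)\cong(\rho x)^*\widehat{\mathbb V}(X,\Theta,V)$ of $\mathscr{O}_T$-modules for all holomorphic $\rho:T\to\mathbb{S}\mathrm{p}^+(H')$ and $x:T\to\mathrm{Sp}(X,\Theta)$,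 natural in $T$ (an open subset of some $\mathbb{C}^I$) and satisfying the cocycle condition, with the following two properties. (i) It exponentiates the action of $\mathfrak{sp}^+(H')$: if $\eta$ is a holomorphic curve in $\mathbb{S}\mathrm{p}^+(H')$ with $\eta(0)=1$ and $\eta'(0)=S\in\mathfrak{sp}^+(H')$, then $\frac{d}{d\varepsilon}\,\eta(\varepsilon)\cdot s\,|_{\varepsilon=0}=S\cdot s$ for every local section $s$. (ii) For each $a=(Z,F,L)$ in $\mathrm{Sp}(X,\Theta)$, it induces the trivial action of $\mathbb{S}\mathrm{p}^+_F(H')$ on the fiber $\widehat{\mathbb V}(a,V)$. -/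

import Mathlib

open Filter Topology
open scoped TensorProduct

namespace HeisCoinv

noncomputable section

/-! ## The symplectic space `H' = ℂ((t)) / ℂ` -/

/-- The line of constants `ℂ b₀` in `ℂ((t))`. -/
abbrev constLine : Submodule ℂ (LaurentSeries ℂ) := Submodule.span ℂ {1}

/-- `H' = ℂ((t)) / ℂ b₀`. -/
abbrev HPrime : Type := LaurentSeries ℂ ⧸ constLine

/-- The form `⟨f, g⟩ = - Res_{t=0} f dg` on `ℂ((t))`. -/
def laurentSymp : LaurentSeries ℂ →ₗ[ℂ] LaurentSeries ℂ →ₗ[ℂ] ℂ :=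
  LinearMap.mk₂ ℂ (fun f g => -(f * LaurentSeries.derivative ℂ g).coeff (-1))
    (by intro a b c; simp [add_mul]; ring)
    (by intro r a b; rw [← HahnSeries.C_mul_eq_smul, mul_assoc, HahnSeries.C_mul_eq_smul]; simp)
    (by intro a b c; simp [mul_add]; ring)
    (by intro r a b; rw [map_smul, ← HahnSeries.C_mul_eq_smul, mul_left_comm,
      HahnSeries.C_mul_eq_smul]; simp)

theorem constLine_le_ker : constLine ≤ LinearMap.ker laurentSymp := by
  rw [Submodule.span_le, Set.singleton_subset_iff, SetLike.mem_coe, LinearMap.mem_ker]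
  ext g
  simp [laurentSymp, LaurentSeries.derivative_apply, LaurentSeries.hasseDeriv_coeff]

theorem constLine_le_ker_flip :
    constLine ≤ LinearMap.ker (constLine.liftQ laurentSymp constLine_le_ker).flip := by
  rw [Submodule.span_le, Set.singleton_subset_iff, SetLike.mem_coe, LinearMap.mem_ker]
  have h : LaurentSeries.derivative ℂ (1 : LaurentSeries ℂ) = 0 := by
    ext n
    rw [LaurentSeries.derivative_apply, LaurentSeries.hasseDeriv_coeff]
    by_cases hn : n + 1 = 0
    · simp [hn]
    · simp [HahnSeries.coeff_one, hn]
  ext g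
  have h' : laurentSymp g 1 = 0 := by
    simp only [laurentSymp, LinearMap.mk₂_apply, h, mul_zero, HahnSeries.coeff_zero, neg_zero]
  simpa using h'

/-- The symplectic form `⟨ , ⟩` on `H'` induced by `- Res f dg`. -/
def symp : HPrime →ₗ[ℂ] HPrime →ₗ[ℂ] ℂ :=
  (constLine.liftQ (constLine.liftQ laurentSymp constLine_le_ker).flip
    constLine_le_ker_flip).flip

/-- The coefficient of `tⁿ`, `n ≠ 0`, as a function on `H'` (and `0` for `n = 0`). -/
def hcoeff (n : ℤ) : HPrime →ₗ[ℂ] ℂ :=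
  constLine.liftQ
    { toFun := fun f => if n = 0 then 0 else f.coeff n
      map_add' := by intro a b; split_ifs <;> simp
      map_smul' := by intro r a; split_ifs <;> simp }
    (by
      rw [Submodule.span_le, Set.singleton_subset_iff, SetLike.mem_coe, LinearMap.mem_ker]
      by_cases hn : n = 0
      · simp [hn]
      · simp [HahnSeries.coeff_one, hn])

/-- The class `b_n` of `tⁿ` in `H'`. -/
def bvec (n : ℤ) : HPrime := constLine.mkQ (HahnSeries.single n (1 : ℂ))

/-- The class of the power series `∑_{n ≥ 0} a_n t^{n+1}` in `H'`. -/
def hplus (a : ℕ → ℂ) : HPrime :=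
  constLine.mkQ (HahnSeries.ofPowerSeries ℤ ℂ (PowerSeries.X * PowerSeries.mk a))

/-- The image of `t^N ℂ⟦t⟧` in `H'`; these are the basic neighbourhoods of `0` of the
`t`-adic topology. -/
def hfil (N : ℤ) : Submodule ℂ HPrime := ⨅ n : {n : ℤ // n < N}, LinearMap.ker (hcoeff n)

/-- `H'_+ = t ℂ⟦t⟧`. -/
abbrev HPlus : Submodule ℂ HPrime := hfil 1

/-- `F^⊥`, the orthogonal of a subspace of `H'`. -/
def perp (F : Submodule ℂ HPrime) : Submodule ℂ HPrime := F.orthogonalBilin symp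

/-- Continuity of a linear endomorphism of `H'` for the `t`-adic topology. -/
def TadicContinuous (S : HPrime →ₗ[ℂ] HPrime) : Prop :=
  ∀ N : ℤ, ∃ M : ℤ, ∀ f ∈ hfil M, S f ∈ hfil N

/-! ## Principally polarized abelian varieties and extended ones -/

/-- A principally polarized abelian variety of dimension `g` over `ℂ`, presented as a complex
torus `ℂ^g / Λ` together with its Riemann form `E` (the imaginary part of the positive definite
Hermitian form of the polarization), which is unimodular on `Λ`. -/
structure PPAV (g : ℕ) where
  Λ : AddSubgroup (Fin g → ℂ)
  E : (Fin g → ℂ) →ₗ[ℝ] (Fin g → ℂ) →ₗ[ℝ] ℝ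
  alternating : ∀ x, E x x = 0
  compatible : ∀ x y, E (Complex.I • x) (Complex.I • y) = E x y
  positive : ∀ x, x ≠ 0 → 0 < E x (Complex.I • x)
  lattice : ∃ b : Module.Basis (Fin (2 * g)) ℝ (Fin g → ℂ),
    Λ = AddSubgroup.closure (Set.range b) ∧
    ∃ M : Matrix (Fin (2 * g)) (Fin (2 * g)) ℤ, IsUnit M.det ∧ ∀ i j, E (b i) (b j) = M i j

/-- A triple `(Z, F, L)`: the lattice `L` in `F^⊥ / F` is recorded by its preimage `K` in
`F^⊥`. -/
@[ext] structure Triple where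
  Z : Submodule ℂ HPrime
  F : Submodule ℂ HPrime
  K : AddSubgroup HPrime

/-- The action of the linear automorphisms of `H'` on triples. -/
def Triple.move (ρ : HPrime ≃ₗ[ℂ] HPrime) (a : Triple) : Triple where
  Z := a.Z.map ρ.toLinearMap
  F := a.F.map ρ.toLinearMap
  K := a.K.map ρ.toLinearMap.toAddMonoidHom

/-- The real span of `K`; its image in `F^⊥ / F` is `L_ℝ`. -/
def Triple.realSpan (a : Triple) : Submodule ℝ HPrime := Submodule.span ℝ (a.K : Set HPrime)

/-- The form `B(u, v) = (1/π) ⟨ū, v⟩`. For `u` the class of `z` in `Z / F`, where `z + h` lies over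
`L_ℝ` and `h ∈ F^⊥ ∩ H'_+`, the conjugate `ū` of `u` with respect to `L_ℝ` is the class of `h`;
so `hermB h v` is `B(u, v)`. -/
def hermB (h v : HPrime) : ℂ := (1 / (Real.pi : ℂ)) * symp h v

/-- `(Z, F, L)` is an extended principally polarized abelian variety of dimension `g`. -/
structure IsExtPPAV (g : ℕ) (a : Triple) : Prop where
  lagrangian : perp a.Z = a.Z
  F_le_Z : a.F ≤ a.Z
  codim : Module.rank ℂ (a.Z ⧸ a.F.submoduleOf a.Z) = g
  /-- `L` is a lattice of rank `2g` in `F^⊥ / F` on which `(1/2πi) ⟨ , ⟩` is unimodular -/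
  lattice : ∃ l : Fin (2 * g) → HPrime, (∀ i, l i ∈ perp a.F) ∧
    a.K = a.F.toAddSubgroup ⊔ AddSubgroup.closure (Set.range l) ∧
    LinearIndependent ℝ (fun i => a.F.mkQ (l i)) ∧
    ∃ M : Matrix (Fin (2 * g)) (Fin (2 * g)) ℤ, IsUnit M.det ∧
      ∀ i j, (1 / (2 * (Real.pi : ℂ) * Complex.I)) * symp (l i) (l j) = M i j
  transverse : a.Z ⊓ HPlus = ⊥
  /-- `L_ℝ ∩ F^⊥_+ = 0` in `F^⊥ / F`, where `F^⊥_+ = F^⊥ ∩ H'_+` -/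
  real_transverse : ∀ h ∈ perp a.F ⊓ HPlus, ∀ f ∈ a.F, h + f ∈ a.realSpan → h ∈ a.F
  /-- `B` is positive definite on `Z / F` -/
  positive : ∀ z ∈ a.Z, ∀ h ∈ HPlus, z + h ∈ a.realSpan → z ∉ a.F →
    (hermB h z).im = 0 ∧ 0 < (hermB h z).re

/-- The principally polarized abelian variety underlying the extended one `(Z, F, L)` is
isomorphic to `P`: there is an isomorphism of `Z / F` (given by a surjection `Z → ℂ^g` with kernel
`F`) with `ℂ^g` which takes the image of `L` under the projection `F^⊥ / F → Z / F` (with kernel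
`F^⊥_+`) to the lattice of `P`, and the imaginary part of `B` to the Riemann form of `P`. -/
def Underlies {g : ℕ} (P : PPAV g) (a : Triple) : Prop :=
  ∃ T : a.Z →ₗ[ℂ] (Fin g → ℂ), Function.Surjective T ∧ LinearMap.ker T = a.F.submoduleOf a.Z ∧
    (∀ v, v ∈ P.Λ ↔ ∃ z : a.Z, ∃ h ∈ HPlus, (z : HPrime) + h ∈ a.K ∧ T z = v) ∧
    ∀ z z' : a.Z, ∀ h ∈ HPlus, (z : HPrime) + h ∈ a.realSpan →
      P.E (T z) (T z') = (hermB h z').im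

/-- The set `Sp(X, Θ)` of all extended principally polarized abelian varieties whose underlying
principally polarized abelian variety is `P = (X, Θ)`. -/
def SpSpace {g : ℕ} (P : PPAV g) : Set Triple := {a | IsExtPPAV g a ∧ Underlies P a}

/-! ## Holomorphic functions of possibly infinitely many variables -/

/-- `f` is holomorphic at `t`: near `t` it is a holomorphic function of finitely many of the
coordinates. -/
def HolAt {ι : Type} (f : (ι → ℂ) → ℂ) (t : ι → ℂ) : Prop :=
  ∃ (s : Finset ι) (F : (s → ℂ) → ℂ), AnalyticAt ℂ F (s.restrict t) ∧
    ∀ᶠ u in 𝓝 t, f u = F (s.restrict u)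

/-- An `H'`-valued function is holomorphic at `t`, i.e. a local section of `H' ⊗̂ 𝒪`: its
coefficients are holomorphic, and its pole orders are locally bounded. -/
def HolHAt {ι : Type} (f : (ι → ℂ) → HPrime) (t : ι → ℂ) : Prop :=
  (∀ n : ℤ, HolAt (fun u => hcoeff n (f u)) t) ∧ ∃ N : ℤ, ∀ᶠ u in 𝓝 t, f u ∈ hfil N

theorem HolAt.map₂ {ι : Type} {f g : (ι → ℂ) → ℂ} {t : ι → ℂ} (hf : HolAt f t) (hg : HolAt g t)
    (φ : ℂ × ℂ → ℂ) (hφ : ∀ z, AnalyticAt ℂ φ z) : HolAt (fun u => φ (f u, g u)) t := by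
  classical
  obtain ⟨s, F, hF, hfF⟩ := hf
  obtain ⟨s', G, hG, hgG⟩ := hg
  let p : (↥(s ∪ s') → ℂ) →L[ℂ] (↥s → ℂ) :=
    ContinuousLinearMap.pi fun i =>
      ContinuousLinearMap.proj (⟨i, Finset.mem_union_left _ i.2⟩ : ↥(s ∪ s'))
  let p' : (↥(s ∪ s') → ℂ) →L[ℂ] (↥s' → ℂ) :=
    ContinuousLinearMap.pi fun i =>
      ContinuousLinearMap.proj (⟨i, Finset.mem_union_right _ i.2⟩ : ↥(s ∪ s'))
  refine ⟨s ∪ s', fun u => φ (F (p u), G (p' u)), ?_, ?_⟩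
  · have h1 : AnalyticAt ℂ (fun u => F (p u)) ((s ∪ s').restrict t) :=
      AnalyticAt.comp (g := F) (f := p) hF (p.analyticAt _)
    have h2 : AnalyticAt ℂ (fun u => G (p' u)) ((s ∪ s').restrict t) :=
      AnalyticAt.comp (g := G) (f := p') hG (p'.analyticAt _)
    exact AnalyticAt.comp (g := φ) (hφ _) (h1.prod h2)
  · filter_upwards [hfF, hgG] with u h1 h2
    rw [h1, h2]
    rfl

theorem HolAt.const {ι : Type} (c : ℂ) (t : ι → ℂ) : HolAt (fun _ => c) t :=
  ⟨∅, fun _ => c, analyticAt_const, Eventually.of_forall fun _ => rfl⟩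

/-- The stalk `𝒪_t` of the sheaf of holomorphic functions on `ℂ^ι`. -/
def holGerms {ι : Type} (t : ι → ℂ) : Subring (Germ (𝓝 t) ℂ) where
  carrier := {φ | ∃ f : (ι → ℂ) → ℂ, HolAt f t ∧ (f : Germ (𝓝 t) ℂ) = φ}
  mul_mem' := by
    rintro _ _ ⟨f, hf, rfl⟩ ⟨g, hg, rfl⟩
    exact ⟨_, hf.map₂ hg (fun z => z.1 * z.2) fun z => analyticAt_fst.mul analyticAt_snd, rfl⟩
  one_mem' := ⟨_, HolAt.const 1 t, rfl⟩
  add_mem' := by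
    rintro _ _ ⟨f, hf, rfl⟩ ⟨g, hg, rfl⟩
    exact ⟨_, hf.map₂ hg (fun z => z.1 + z.2) fun z => analyticAt_fst.add analyticAt_snd, rfl⟩
  zero_mem' := ⟨_, HolAt.const 0 t, rfl⟩
  neg_mem' := by
    rintro _ ⟨f, hf, rfl⟩
    exact ⟨_, hf.map₂ hf (fun z => -z.1) fun z => analyticAt_fst.neg, rfl⟩

/-! ## The complex manifold `Sp(X, Θ)` -/

/-- `Ω` is a period matrix of `P`: it lies in the Siegel upper half-space, and `P` is isomorphic
to `ℂ^g / (ℤ^g + ℤ^g Ω)` with its standard principal polarization. -/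
def IsPeriod {g : ℕ} (P : PPAV g) (Ω : Matrix (Fin g) (Fin g) ℂ) : Prop :=
  Ω.transpose = Ω ∧ (Ω.map Complex.im).PosDef ∧
  ∃ T : (Fin g → ℂ) ≃ₗ[ℂ] (Fin g → ℂ),
    (∀ v, v ∈ P.Λ ↔ ∃ m n : Fin g → ℤ,
      v = T (Matrix.vecMul (fun i => (m i : ℂ)) Ω + fun i => (n i : ℂ))) ∧
    ∀ m n m' n' : Fin g → ℤ,
      P.E (T (Matrix.vecMul (fun i => (m i : ℂ)) Ω + fun i => (n i : ℂ)))
        (T (Matrix.vecMul (fun i => (m' i : ℂ)) Ω + fun i => (n' i : ℂ))) =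
      ∑ i, ((n i : ℝ) * (m' i : ℝ) - (m i : ℝ) * (n' i : ℝ))

/-- Index set of the coordinates on `S̃²(H'_+) × (H'_+)^g`. A point `c` of `ℂ^(ChartIdx g)`
consists of the symmetric map `φ : H_- → H'_+`, `φ(y) = ∑_{m, n ≥ 1} σ_{m,n} ⟨b_n, y⟩ b_m` with
`σ_{m+1,n+1} = c (inl s(m, n))`, and of `h_1, …, h_g ∈ H'_+`, `h_i = ∑_n c (inr (i, n)) b_{n+1}`. -/
abbrev ChartIdx (g : ℕ) : Type := Sym2 ℕ ⊕ (Fin g × ℕ)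

/-- The vector `h_i`. -/
def frameVec {g : ℕ} (c : ChartIdx g → ℂ) (i : Fin g) : HPrime :=
  hplus fun n => c (Sum.inr (i, n))

/-- The locus where `h_1, …, h_g` are linearly independent. -/
def frames (g : ℕ) : Set (ChartIdx g → ℂ) := {c | LinearIndependent ℂ (frameVec c)}

/-- The element `b_{-n-1} + φ(b_{-n-1})` of the graph of `φ`. -/
def graphVec {g : ℕ} (c : ChartIdx g → ℂ) (n : ℕ) : HPrime :=
  bvec (-(n + 1 : ℤ)) + hplus fun m => c (Sum.inl s(m, n)) * (n + 1)

/-- For `x ∈ ℂ^g`, the vector `π x̄ (Im Ω)⁻¹ · (h_1, …, h_g)` of `H'_+`. -/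
def conjVec {g : ℕ} (Ω : Matrix (Fin g) (Fin g) ℂ) (c : ChartIdx g → ℂ) (x : Fin g → ℂ) : HPrime :=
  ∑ j, ((Real.pi : ℂ) * Matrix.vecMul (star x) ((Ω.map Complex.im)⁻¹.map Complex.ofReal) j) •
    frameVec c j

theorem conjVec_add {g : ℕ} (Ω : Matrix (Fin g) (Fin g) ℂ) (c : ChartIdx g → ℂ)
    (x y : Fin g → ℂ) : conjVec Ω c (x + y) = conjVec Ω c x + conjVec Ω c y := by
  simp only [conjVec, star_add, Matrix.add_vecMul, Pi.add_apply, mul_add, add_smul,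
    Finset.sum_add_distrib]

theorem conjVec_neg {g : ℕ} (Ω : Matrix (Fin g) (Fin g) ℂ) (c : ChartIdx g → ℂ)
    (x : Fin g → ℂ) : conjVec Ω c (-x) = -conjVec Ω c x := by
  simp only [conjVec, star_neg, Matrix.neg_vecMul, Pi.neg_apply, mul_neg, neg_smul,
    Finset.sum_neg_distrib]

/-- The graph of `φ`. -/
def chartZ {g : ℕ} (c : ChartIdx g → ℂ) : Submodule ℂ HPrime :=
  Submodule.span ℂ (Set.range (graphVec c))

/-- The map `(φ, h, Ω) ↦ (Z, F, L)`: `Z` is the graph of `φ`, `F ⊆ Z` is the zero locus of the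
linear forms `⟨h_i, ·⟩`, and `L` consists of the classes of `z + π x̄ (Im Ω)⁻¹ · h`, where `z ∈ Z`
is such that the vector `x` of the `⟨h_i, z⟩` lies in `ℤ^g Ω + ℤ^g`. -/
def chart {g : ℕ} (Ω : Matrix (Fin g) (Fin g) ℂ) (c : ChartIdx g → ℂ) : Triple where
  Z := chartZ c
  F := chartZ c ⊓ ⨅ i, LinearMap.ker (symp (frameVec c i))
  K :=
    { carrier := {y | ∃ z ∈ chartZ c, ∃ m n : Fin g → ℤ,
        (fun i => symp (frameVec c i) z) =
          Matrix.vecMul (fun i => (m i : ℂ)) Ω + (fun i => (n i : ℂ)) ∧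
        y = z + conjVec Ω c (fun i => symp (frameVec c i) z)}
      add_mem' := by
        rintro _ _ ⟨z, hz, m, n, h, rfl⟩ ⟨z', hz', m', n', h', rfl⟩
        refine ⟨z + z', add_mem hz hz', m + m', n + n', ?_, ?_⟩
        · have e1 : (fun i => symp (frameVec c i) (z + z')) =
              (fun i => symp (frameVec c i) z) + fun i => symp (frameVec c i) z' := by
            ext i; simp
          have e2 : (fun i => (((m + m') i : ℤ) : ℂ)) =
              (fun i => (m i : ℂ)) + fun i => (m' i : ℂ) := by
            ext i; simp
          have e3 : (fun i => (((n + n') i : ℤ) : ℂ)) =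
              (fun i => (n i : ℂ)) + fun i => (n' i : ℂ) := by
            ext i; simp
          rw [e1, e2, e3, h, h', Matrix.add_vecMul]
          abel
        · have e1 : (fun i => symp (frameVec c i) (z + z')) =
              (fun i => symp (frameVec c i) z) + fun i => symp (frameVec c i) z' := by
            ext i; simp
          rw [e1, conjVec_add]
          abel
      zero_mem' := by
        refine ⟨0, zero_mem _, 0, 0, ?_, ?_⟩
        · ext i
          simp [Matrix.vecMul, dotProduct]
        · simp [conjVec, Matrix.vecMul, dotProduct]
      neg_mem' := by
        rintro _ ⟨z, hz, m, n, h, rfl⟩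
        have e1 : (fun i => symp (frameVec c i) (-z)) =
            -(fun i => symp (frameVec c i) z) := by
          ext i; simp
        refine ⟨-z, neg_mem hz, -m, -n, ?_, ?_⟩
        · have e2 : (fun i => (((-m) i : ℤ) : ℂ)) = -(fun i => (m i : ℂ)) := by
            ext i; simp
          have e3 : (fun i => (((-n) i : ℤ) : ℂ)) = -(fun i => (n i : ℂ)) := by
            ext i; simp
          rw [e1, e2, e3, h, Matrix.neg_vecMul]
          abel
        · rw [e1, conjVec_neg]
          abel }

/-- The open subsets of `Sp(X, Θ)`, for the quotient topology of
`S̃²(H'_+) × ℬ_g(H'_+) × {period matrices}` (a set `U` of triples stands for its trace on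
`Sp(X, Θ)`). -/
def IsOpenSp {g : ℕ} (P : PPAV g) (U : Set Triple) : Prop :=
  ∀ Ω, IsPeriod P Ω → IsOpen {c ∈ frames g | chart Ω c ∈ U}

/-- A holomorphic map `x` from an open subset `T` of `ℂ^ι` to `Sp(X, Θ)`: near every point it is a
holomorphic map to `S̃²(H'_+) × ℬ_g(H'_+) × {Ω}` followed by `(φ, h, Ω) ↦ (Z, F, L)`. -/
def IsSpFamily {g : ℕ} (P : PPAV g) {ι : Type} (T : Set (ι → ℂ)) (x : (ι → ℂ) → Triple) : Prop :=
  ∀ t ∈ T, x t ∈ SpSpace P ∧ ∃ Ω, IsPeriod P Ω ∧ ∃ c : (ι → ℂ) → ChartIdx g → ℂ,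
    ∀ᶠ u in 𝓝 t, c u ∈ frames g ∧ x u = chart Ω (c u) ∧ ∀ i, HolAt (fun v => c v i) u

/-- The holomorphic sections over `U` of the tautological sheaf `𝔽 ⊆ H' ⊗̂ 𝒪` on `Sp(X, Θ)`, whose
fibre at `(Z, F, L)` is `F`. -/
def IsTautSection {g : ℕ} (P : PPAV g) (U : Set Triple) (f : Triple → HPrime) : Prop :=
  ∀ Ω, IsPeriod P Ω → ∀ c ∈ frames g, chart Ω c ∈ U →
    HolHAt (fun c' => f (chart Ω c')) c ∧ f (chart Ω c) ∈ (chart Ω c).F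

/-! ## The groups `𝕊p⁺(H')`, `𝕊p⁺_F(H')` and the Lie algebra `𝔰𝔭⁺(H')` -/

/-- Continuous symplectic automorphisms of `H'` preserving `H'_+`. -/
structure IsSympPlus (ρ : HPrime ≃ₗ[ℂ] HPrime) : Prop where
  continuous : TadicContinuous ρ.toLinearMap
  continuous_symm : TadicContinuous ρ.symm.toLinearMap
  symplectic : ∀ f g, symp (ρ f) (ρ g) = symp f g
  plus : HPlus.map ρ.toLinearMap = HPlus

/-- A continuous path in `H'` for its topology as an infinite-dimensional complex vector space,
the inductive limit of the spaces `t^N ℂ⟦t⟧` with the topology of coefficientwise convergence. -/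
def IsHPath (γ : ℝ → HPrime) : Prop :=
  (∀ n, ContinuousOn (fun s => hcoeff n (γ s)) (Set.Icc 0 1)) ∧
    ∃ N : ℤ, ∀ s ∈ Set.Icc (0 : ℝ) 1, γ s ∈ hfil N

/-- `𝕊p⁺(H')`: the (path) component of the identity in the group of continuous symplectic
automorphisms of `H'` preserving `H'_+`. -/
def SpPlus : Set (HPrime ≃ₗ[ℂ] HPrime) :=
  {ρ | ∃ γ : ℝ → (HPrime ≃ₗ[ℂ] HPrime), γ 0 = 1 ∧ γ 1 = ρ ∧
    (∀ s ∈ Set.Icc (0 : ℝ) 1, IsSympPlus (γ s)) ∧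
    ∀ f, IsHPath (fun s => γ s f) ∧ IsHPath (fun s => (γ s).symm f)}

/-- `𝕊p⁺_F(H')`. -/
def SpPlusF (F : Submodule ℂ HPrime) : Set (HPrime ≃ₗ[ℂ] HPrime) :=
  {ρ ∈ SpPlus | (perp F).map ρ.toLinearMap = perp F ∧ F.map ρ.toLinearMap = F ∧
    ∀ y ∈ perp F, ρ y - y ∈ F}

/-- A holomorphic map from an open subset `T` of `ℂ^ι` to `𝕊p⁺(H')`, i.e. a continuous automorphism
of `H' ⊗̂ 𝒪_T` with values in `𝕊p⁺(H')`. -/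
def IsGroupFamily {ι : Type} (T : Set (ι → ℂ)) (ρ : (ι → ℂ) → (HPrime ≃ₗ[ℂ] HPrime)) : Prop :=
  ∀ t ∈ T, ρ t ∈ SpPlus ∧
    ∀ f, HolHAt (fun u => ρ u f) t ∧ HolHAt (fun u => (ρ u).symm f) t

/-- `𝔰𝔭⁺(H')`. -/
structure IsSpAlg (S : HPrime →ₗ[ℂ] HPrime) : Prop where
  continuous : TadicContinuous S
  skew : ∀ f g, symp (S f) g + symp f (S g) = 0
  plus : HPlus.map S ≤ HPlus

/-! ## Heisenberg vertex algebras -/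

/-- The space of the Heisenberg vertex algebra of rank `d`,
`Sym(𝔥_Γ ⊗ t⁻¹ℂ[t⁻¹]) = ℂ[H^k_{-n-1}]`, where the variable `(k, n)` is `H^k_{-n-1} = H^k ⊗ t^{-n-1}`
for an orthonormal basis `H^1, …, H^d` of `𝔥_Γ`. -/
abbrev Fock (d : ℕ) : Type := MvPolynomial (Fin d × ℕ) ℂ

/-- Multiplication by `H^k ⊗ y_-`, where `y_-` is the polar part of `y`. -/
def create {d : ℕ} (k : Fin d) (y : HPrime) : Fock d →ₗ[ℂ] Fock d :=
  LinearMap.mulLeft ℂ (∑ᶠ n : ℕ, hcoeff (-(n + 1 : ℤ)) y • MvPolynomial.X (k, n))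

/-- The derivation `∑_{n ≥ 1} y_n · n ∂/∂H^k_{-n}` for `y = ∑ y_n b_n`. -/
def annihilate {d : ℕ} (k : Fin d) (y : HPrime) : Fock d →ₗ[ℂ] Fock d :=
  (MvPolynomial.mkDerivation ℂ fun p : Fin d × ℕ =>
    if p.1 = k then (MvPolynomial.C (((p.2 : ℂ) + 1) * hcoeff (p.2 + 1 : ℤ) y) : Fock d)
    else 0).toLinearMap

/-- The action of `H^k ⊗ y` on the Heisenberg vertex algebra of level `ℓ`:
`[H^k_m, H^l_n] = ℓ m δ_{k,l} δ_{m,-n}`, and `H^k_n` kills the vacuum `1` for `n ≥ 0`. -/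
def mode {d : ℕ} (ℓ : ℂ) (k : Fin d) (y : HPrime) : Fock d →ₗ[ℂ] Fock d :=
  create k y + ℓ • annihilate k y

/-- The action of `A ⊗ y` for `A ∈ 𝔥_Γ = ℂ ⊗ Γ`. -/
def heis {Γ : Type*} [AddCommGroup Γ] {d : ℕ} (H : Module.Basis (Fin d) ℂ (ℂ ⊗[ℤ] Γ)) (ℓ : ℂ)
    (A : ℂ ⊗[ℤ] Γ) (y : HPrime) : Fock d →ₗ[ℂ] Fock d :=
  ∑ k, H.repr A k • mode ℓ k y

/-- The action of `S ∈ 𝔰𝔭⁺(H')` on the Heisenberg vertex algebra of level `ℓ`.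
At level `1` it is the action of the metaplectic algebra by normally ordered quadratic operators,
`b_i b_j ↦ ∑_k :H^k_i H^k_j:`, where `b_i b_j` stands for the endomorphism
`y ↦ ⟨b_j, y⟩ b_i + ⟨b_i, y⟩ b_j` of `H'`. Indeed `S` is
`∑_{n ≥ 1} (1/n) ((S b_{-n})_- + (1/2) (S b_{-n})_+) b_n`, and `H^k_n` acts as `n ∂/∂H^k_{-n}`.
At level `0` it is the action by derivations of the commutative algebra induced by the action of
`S` on `H' / H'_+`, the limit for `ℓ → 0` of the action
`b_i b_j ↦ (1/ℓ) ∑_k :H^k_i H^k_j:` at level `ℓ`. -/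
def spAct {d : ℕ} (ℓ : ℂ) (S : HPrime →ₗ[ℂ] HPrime) (v : Fock d) : Fock d :=
  ∑ᶠ p : Fin d × ℕ,
    (create p.1 (S (bvec (-(p.2 + 1 : ℤ)))) +
      (ℓ / 2) • annihilate p.1 (S (bvec (-(p.2 + 1 : ℤ))))) (MvPolynomial.pderiv p v)

section Coinvariants

variable {Γ : Type*} [AddCommGroup Γ] {d : ℕ} (H : Module.Basis (Fin d) ℂ (ℂ ⊗[ℤ] Γ)) (ℓ : ℂ)

/-- The subspace `(𝔥_Γ ⊗ F)(V)` of `V`. -/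
def outImage (F : Submodule ℂ HPrime) : Submodule ℂ (Fock d) :=
  Submodule.span ℂ {v | ∃ A, ∃ f ∈ F, ∃ w, v = heis H ℓ A f w}

/-- The space of coinvariants `V̂(a, V) = V / (𝔥_Γ ⊗ F)(V)` at `a = (Z, F, L)`. -/
abbrev Coinv (a : Triple) : Type := Fock d ⧸ outImage H ℓ a.F

/-! ## The sheaf of coinvariants -/

/-- The stalk at `t` of `V ⊗ 𝒪`, a module over `𝒪_t`. -/
def secGerms (d : ℕ) {ι : Type} (t : ι → ℂ) : Submodule (holGerms t) (Germ (𝓝 t) (Fock d)) :=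
  Submodule.span (holGerms t) (Set.range fun v : Fock d => ((fun _ => v : (ι → ℂ) → Fock d) :
    Germ (𝓝 t) (Fock d)))

variable {g : ℕ} (P : PPAV g)

/-- For a holomorphic map `x` to `Sp(X, Θ)`, the stalk at `t` of the image of
`x^*(𝔥_Γ^out(X, Θ)(V ⊗ 𝒪))` in `V ⊗ 𝒪 = x^*(V ⊗ 𝒪)`; here `𝔥_Γ^out(X, Θ) = 𝔥_Γ ⊗ 𝔽`. -/
def outGerms {ι : Type} (x : (ι → ℂ) → Triple) (t : ι → ℂ) :
    Submodule (holGerms t) (Germ (𝓝 t) (Fock d)) :=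
  Submodule.span (holGerms t) {φ | ∃ U f A, ∃ s : (ι → ℂ) → Fock d,
    IsOpenSp P U ∧ x t ∈ U ∧ IsTautSection P U f ∧ (s : Germ (𝓝 t) (Fock d)) ∈ secGerms d t ∧
    φ = ((fun u => heis H ℓ A (f (x u)) (s u) : (ι → ℂ) → Fock d) : Germ (𝓝 t) (Fock d))}

/-- The stalk at `t` of the pull-back `x^* V̂(X, Θ, V)` of the sheaf of coinvariants
`V̂(X, Θ, V) = V ⊗ 𝒪 / 𝔥_Γ^out(X, Θ)(V ⊗ 𝒪)` on `Sp(X, Θ)` along a holomorphic map `x`. For `x` the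
local parametrizations `chart Ω` of `Sp(X, Θ)` these are the stalks of the sheaf itself. -/
abbrev Stalk {ι : Type} (x : (ι → ℂ) → Triple) (t : ι → ℂ) : Type :=
  ↥(secGerms d t) ⧸ (outGerms H ℓ P x t).submoduleOf (secGerms d t)

/-- The class in the stalk of the sheaf of coinvariants of a local section `s` of `V ⊗ 𝒪`. -/
def Stalk.cls {ι : Type} (x : (ι → ℂ) → Triple) (t : ι → ℂ) (s : (ι → ℂ) → Fock d)
    (hs : (s : Germ (𝓝 t) (Fock d)) ∈ secGerms d t) : Stalk H ℓ P x t :=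
  Submodule.Quotient.mk ⟨(s : Germ (𝓝 t) (Fock d)), hs⟩

/-- The linear map `e` between stalks takes the class of `s` to the class of `s'`. -/
def Represents {ι : Type} {x y : (ι → ℂ) → Triple} {t : ι → ℂ}
    (e : Stalk H ℓ P x t →ₗ[holGerms t] Stalk H ℓ P y t) (s s' : (ι → ℂ) → Fock d) : Prop :=
  ∃ hs hs', e (Stalk.cls H ℓ P x t s hs) = Stalk.cls H ℓ P y t s' hs'

/-- An `𝕊p⁺(H')`-equivariant structure on `V̂(X, Θ, V)`: for holomorphic maps `ρ : T → 𝕊p⁺(H')` and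
`x : T → Sp(X, Θ)` on an open subset `T` of some `ℂ^ι`, an isomorphism of sheaves of `𝒪_T`-modules
`x^* V̂(X, Θ, V) ≅ (ρ x)^* V̂(X, Θ, V)`, given on stalks, compatible with pull-backs along
holomorphic maps, and satisfying the cocycle condition. -/
structure EquivariantStructure where
  map : ∀ {ι : Type} (ρ : (ι → ℂ) → (HPrime ≃ₗ[ℂ] HPrime)) (x : (ι → ℂ) → Triple) (t : ι → ℂ),
    Stalk H ℓ P x t →ₗ[holGerms t] Stalk H ℓ P (fun u => (x u).move (ρ u)) t
  /-- the maps on stalks are bijective -/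
  bijective : ∀ {ι : Type} (T : Set (ι → ℂ)) (ρ) (x), IsOpen T → IsGroupFamily T ρ →
    IsSpFamily P T x → ∀ t ∈ T, Function.Bijective (map ρ x t)
  /-- the maps on stalks come from a morphism of sheaves on `T` -/
  isLocal : ∀ {ι : Type} (T : Set (ι → ℂ)) (ρ) (x), IsOpen T → IsGroupFamily T ρ →
    IsSpFamily P T x → ∀ s : (ι → ℂ) → Fock d,
    (∀ t ∈ T, (s : Germ (𝓝 t) (Fock d)) ∈ secGerms d t) →
    ∀ t ∈ T, ∃ s' : (ι → ℂ) → Fock d, ∀ᶠ u in 𝓝 t, Represents H ℓ P (map ρ x u) s s'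
  /-- compatibility with pull-back along a holomorphic map `q : T' → T` -/
  pullback : ∀ {ι ι' : Type} (T : Set (ι → ℂ)) (T' : Set (ι' → ℂ)) (ρ) (x) (ρ') (x')
    (q : (ι' → ℂ) → (ι → ℂ)), IsOpen T → IsOpen T' → IsGroupFamily T ρ → IsSpFamily P T x →
    (∀ t ∈ T', q t ∈ T ∧ ∀ i, HolAt (fun u => q u i) t) →
    (∀ t ∈ T', ρ' t = ρ (q t) ∧ x' t = x (q t)) →
    ∀ t ∈ T', ∀ s s', Represents H ℓ P (map ρ x (q t)) s s' →
      Represents H ℓ P (map ρ' x' t) (s ∘ q) (s' ∘ q)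
  /-- the identity acts as the identity -/
  unit : ∀ {ι : Type} (T : Set (ι → ℂ)) (x), IsOpen T → IsSpFamily P T x →
    ∀ t ∈ T, ∀ s : (ι → ℂ) → Fock d, (s : Germ (𝓝 t) (Fock d)) ∈ secGerms d t →
    Represents H ℓ P (map (fun _ => 1) x t) s s
  /-- the cocycle condition -/
  cocycle : ∀ {ι : Type} (T : Set (ι → ℂ)) (ρ) (σ) (x), IsOpen T → IsGroupFamily T ρ →
    IsGroupFamily T σ → IsSpFamily P T x → ∀ t ∈ T, ∀ s s' s'',
    Represents H ℓ P (map σ x t) s s' →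
    Represents H ℓ P (map ρ (fun u => (x u).move (σ u)) t) s' s'' →
    Represents H ℓ P (map (fun u => ρ u * σ u) x t) s s''

/-! ## The action of `𝔰𝔭⁺(H')` on the sheaf of coinvariants -/

/-- The holomorphic sections over `U` of `V ⊗ 𝒪` on `Sp(X, Θ)`. -/
def IsSection (U : Set Triple) (s : Triple → Fock d) : Prop :=
  ∀ Ω, IsPeriod P Ω → ∀ c ∈ frames g, chart Ω c ∈ U →
    ((fun c' => s (chart Ω c') : (ChartIdx g → ℂ) → Fock d) : Germ (𝓝 c) (Fock d)) ∈ secGerms d c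

/-- The holomorphic sections over `U` of the subsheaf `𝔥_Γ^out(X, Θ)(V ⊗ 𝒪)` of `V ⊗ 𝒪`. -/
def IsOutSection (U : Set Triple) (s : Triple → Fock d) : Prop :=
  IsSection P U s ∧ ∀ Ω, IsPeriod P Ω → ∀ c ∈ frames g, chart Ω c ∈ U →
    ((fun c' => s (chart Ω c') : (ChartIdx g → ℂ) → Fock d) : Germ (𝓝 c) (Fock d)) ∈
      outGerms H ℓ P (chart Ω) c

end Coinvariants

/-- The `V`-valued function `γ` has derivative `v` at `ε = 0` (tested on linear forms). -/
def HasDerivV {d : ℕ} (γ : ℂ → Fock d) (v : Fock d) : Prop :=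
  ∀ l : Module.Dual ℂ (Fock d), HasDerivAt (fun ε => l (γ ε)) (l v) 0

/-- The vector field by which `S ∈ 𝔰𝔭⁺(H')` acts on `S̃²(H'_+) × ℬ_g(H'_+)`, the derivative at
`ε = 0` of the action of `1 + ε S`. The `h_i` move by `S h_i`. The graph `Z` of `φ` moves by
`δφ(b_{-n}) = w_+ - φ(w_-)` with `w = S (b_{-n} + φ(b_{-n}))`, so that
`m n δσ_{m,n} = - ⟨b_{-m} + φ(b_{-m}), S (b_{-n} + φ(b_{-n}))⟩`, which is symmetric in `m, n`. -/
def spField {g : ℕ} (S : HPrime →ₗ[ℂ] HPrime) (c : ChartIdx g → ℂ) : ChartIdx g → ℂ :=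
  Sum.elim
    (Sym2.lift ⟨fun m n => -(symp (graphVec c m) (S (graphVec c n)) +
        symp (graphVec c n) (S (graphVec c m))) / (2 * ((m : ℂ) + 1) * ((n : ℂ) + 1)),
      fun m n => by ring⟩)
    (fun p => hcoeff (p.2 + 1 : ℤ) (S (frameVec c p.1)))

/-- `s' = S · s` on `U`, for the action `S (A ⊗ f) = S(A) ⊗ f + A ⊗ S(f)` of `S ∈ 𝔰𝔭⁺(H')` on the
sections of `V ⊗ 𝒪` on `Sp(X, Θ)`. Here `S(f)(a) = d/dε f(exp(-ε S) a)` is the action of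
the Lie algebra on functions induced by the left action of the group on `Sp(X, Θ)`. -/
def IsSpDeriv {d : ℕ} (ℓ : ℂ) {g : ℕ} (P : PPAV g) (S : HPrime →ₗ[ℂ] HPrime) (U : Set Triple)
    (s s' : Triple → Fock d) : Prop :=
  ∀ Ω, IsPeriod P Ω → ∀ c ∈ frames g, chart Ω c ∈ U →
    HasDerivV (fun ε => s (chart Ω (c + ε • spField S c)))
      (spAct ℓ S (s (chart Ω c)) - s' (chart Ω c))

/-- The point `(ε, c)` of `ℂ × ℂ^(ChartIdx g)`. -/
def withParam {g : ℕ} (ε : ℂ) (c : ChartIdx g → ℂ) : Option (ChartIdx g) → ℂ :=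
  fun o => o.elim ε c

section Results

variable {Γ : Type*} [AddCommGroup Γ] {d : ℕ} (H : Module.Basis (Fin d) ℂ (ℂ ⊗[ℤ] Γ)) (ℓ : ℂ)
  {g : ℕ} (P : PPAV g)

/-- The action of `𝔰𝔭⁺(H')` on `V ⊗ 𝒪` is defined and preserves `𝔥_Γ^out(X, Θ)(V ⊗ 𝒪)`, and thus
induces an action on `V̂(X, Θ, V)`. -/
def SpAlgebraActs : Prop :=
  ∀ S, IsSpAlg S → ∀ U, IsOpenSp P U → ∀ s : Triple → Fock d, IsSection P U s →
    (∃ s', IsSection P U s' ∧ IsSpDeriv ℓ P S U s s') ∧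
    ∀ s', IsSpDeriv ℓ P S U s s' → IsOutSection H ℓ P U s → IsOutSection H ℓ P U s'

variable {H ℓ P}

/-- The equivariant structure exponentiates the action of `𝔰𝔭⁺(H')`. Let `η` be a holomorphic
curve in `𝕊p⁺(H')` with `η(0) = 1` and `η'(0) = S ∈ 𝔰𝔭⁺(H')`, and let `s` be a section of `V ⊗ 𝒪`
near a point of `Sp(X, Θ)`. Then the derivative at `ε = 0` of the section `η(ε) · s` of
`V̂(X, Θ, V)`, with value `η(ε) (s (η(ε)⁻¹ a))` at `a`, is the class of `S · s`. -/
def EquivariantStructure.Exponentiates (E : EquivariantStructure H ℓ P) : Prop :=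
  ∀ S, IsSpAlg S → ∀ (D : Set (Unit → ℂ)) (η : ℂ → (HPrime ≃ₗ[ℂ] HPrime)), IsOpen D →
    (fun _ => 0) ∈ D → IsGroupFamily D (fun w => η (w ())) → η 0 = 1 →
    (∀ f n, HasDerivAt (fun ε => hcoeff n (η ε f)) (hcoeff n (S f)) 0) →
    ∀ U, IsOpenSp P U → ∀ s s₁ : Triple → Fock d, IsSection P U s → IsSpDeriv ℓ P S U s s₁ →
    ∀ Ω, IsPeriod P Ω → ∀ c ∈ frames g, chart Ω c ∈ U →
    ∀ (s' : (Option (ChartIdx g) → ℂ) → Fock d) (r : (ChartIdx g → ℂ) → Fock d),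
      Represents H ℓ P
        (E.map (fun u => η (u none))
          (fun u => (chart Ω fun i => u (some i)).move (η (u none))⁻¹) (withParam 0 c))
        (fun u => s ((chart Ω fun i => u (some i)).move (η (u none))⁻¹)) s' →
      (∀ᶠ c' in 𝓝 c, HasDerivV (fun ε => s' (withParam ε c')) (r c')) →
      ((fun c' => r c' - s₁ (chart Ω c') : (ChartIdx g → ℂ) → Fock d) : Germ (𝓝 c) (Fock d)) ∈
        outGerms H ℓ P (chart Ω) c

/-- For `a = (Z, F, L)`, the equivariant structure induces the trivial action of `𝕊p⁺_F(H')` on the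
fibre `V̂(a, V)`. (The fibre at `t` of `x^* V̂(X, Θ, V)` is `V̂(x(t), V)`, with the class of a
section `s` going to the class of `s(t)`.) -/
def EquivariantStructure.TrivialOnFibres (E : EquivariantStructure H ℓ P) : Prop :=
  ∀ {ι : Type} (T : Set (ι → ℂ)) (ρ) (x), IsOpen T → IsGroupFamily T ρ → IsSpFamily P T x →
    ∀ t ∈ T, ρ t ∈ SpPlusF (x t).F → ∀ s s', Represents H ℓ P (E.map ρ x t) s s' →
    (Submodule.Quotient.mk (s' t) : Coinv H ℓ (x t)) = Submodule.Quotient.mk (s t)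

end Results

end

end HeisCoinv

open HeisCoinv

namespace HeisCoinv

noncomputable section

/-! The group acts on V itself, before any passage to coinvariants. V is the space of polynomials in
the commuting modes of b_{-1}, b_{-2}, …, applied to the vacuum. If ρ is symplectic, the modes of ρ
b_{-1}, ρ b_{-2}, … commute as well, so substituting them in a polynomial and applying the result to
1 defines an operator T_ρ (`fockAct`). Modes of H'_+ kill the constants and ρ preserves H'_+; hence
T_ρ (A ⊗ y) = (A ⊗ ρ y) T_ρ for every y in H' (`fockAct_mode`). Since T_ρ fixes the vacuum, it is
multiplicative in ρ without any scalar cocycle (`fockAct_mul`). Its derivative at the identity is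
the normally ordered quadratic operator `spAct` (`hasDerivF_fockAct`), which satisfies [S, A ⊗ y] =
A ⊗ S y (`spAct_mode`). Only the Heisenberg relation for arbitrary ℓ enters, so both levels are
handled at once.

T_ρ maps (𝔥 ⊗ F)V into (𝔥 ⊗ ρF)V, which gives the maps on coinvariants. For triviality on the
fibres, V is generated from the vacuum by the modes of Z, and Z ⊆ F^⊥. For z in Z, T_ρ(z v) - z v =
ρz (T_ρ v - v) + (ρz - z) v. The second term lies in (𝔥 ⊗ F)V since ρz - z ∈ F; the first does by
induction, because modes of F^⊥ commute with modes of F (`fockAct_sub_mem_outImage`).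

For sheaves, the tautological sheaf has local holomorphic frames, by Cramer's rule on a nonvanishing
minor of the h_i. So every holomorphic family of vectors of F yields sections of the image of 𝔥^out
(`OutAt.of_mem`). This applies to ρ f, and to S f - f', where f' is the derivative of f along the
flow; the latter lies in F by differentiating the equations of F (`sub_deriv_mem_F`). The flow is
well defined on Sp(X, Θ) because two presentations of one point have the same φ and frames h related
by a matrix that stays valid along the flow (`exists_transition`, `chart_add_smul_spField`).
Exponentiation is then the product rule for T_{η(ε)} s(η(ε)⁻¹ a); the choice of representative is
harmless because the ε-derivative of a section of the image stays in the image
(`OutAt.exists_paramDeriv`). -/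

/-! ### Coefficients and the symplectic form on H' -/

theorem hcoeff_mkQ (n : ℤ) (f : LaurentSeries ℂ) :
    hcoeff n (constLine.mkQ f) = if n = 0 then 0 else f.coeff n := rfl

theorem symp_mkQ (f g : LaurentSeries ℂ) :
    symp (constLine.mkQ f) (constLine.mkQ g) =
      -(f * LaurentSeries.derivative ℂ g).coeff (-1) := rfl

@[simp] theorem hcoeff_zero_index (f : HPrime) : hcoeff 0 f = 0 := by
  obtain ⟨f, rfl⟩ := constLine.mkQ_surjective f
  rw [hcoeff_mkQ, if_pos rfl]

/-- The quotient by constants loses exactly the coefficient of t⁰, where `hcoeff` is 0 by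
convention. -/
theorem hprime_ext {f g : HPrime} (h : ∀ n, hcoeff n f = hcoeff n g) : f = g := by
  rw [← sub_eq_zero]
  have h' : ∀ n, hcoeff n (f - g) = 0 := fun n => by rw [map_sub, h, sub_self]
  generalize f - g = y at h'
  obtain ⟨y, rfl⟩ := constLine.mkQ_surjective y
  rw [Submodule.mkQ_apply, Submodule.Quotient.mk_eq_zero, Submodule.mem_span_singleton]
  refine ⟨y.coeff 0, ?_⟩
  ext n
  have := h' n
  rw [hcoeff_mkQ] at this
  by_cases hn : n = 0
  · subst hn; simp
  · rw [if_neg hn] at this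
    simp [this, HahnSeries.coeff_one, hn]

theorem mem_hfil {N : ℤ} {f : HPrime} : f ∈ hfil N ↔ ∀ n < N, hcoeff n f = 0 := by
  simp [hfil, Submodule.mem_iInf]

theorem hfil_anti {M N : ℤ} (h : M ≤ N) : hfil N ≤ hfil M := fun _ hf =>
  mem_hfil.2 fun n hn => mem_hfil.1 hf n (hn.trans_le h)

/-- The class of the Laurent series with coefficients `a n` for `n ≥ -N`. -/
def ofCoeffs (N : ℕ) (a : ℤ → ℂ) : HPrime :=
  constLine.mkQ (HahnSeries.ofSuppBddBelow (fun n => if -(N : ℤ) ≤ n then a n else 0)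
    ⟨-(N : ℤ), fun n hn => by
      by_contra h
      exact hn (if_neg h)⟩)

theorem hcoeff_ofCoeffs (N : ℕ) (a : ℤ → ℂ) (n : ℤ) :
    hcoeff n (ofCoeffs N a) = if n = 0 then 0 else if -(N : ℤ) ≤ n then a n else 0 := rfl

theorem exists_mem_hfil (f : HPrime) : ∃ N : ℕ, f ∈ hfil (-(N : ℤ)) := by
  obtain ⟨f, rfl⟩ := constLine.mkQ_surjective f
  refine ⟨(f.order).natAbs, mem_hfil.2 fun n hn => ?_⟩
  rw [hcoeff_mkQ]
  split_ifs
  · rfl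
  · exact HahnSeries.coeff_eq_zero_of_lt_order (by omega)

theorem hcoeff_bvec (n m : ℤ) : hcoeff n (bvec m) = if n = m ∧ n ≠ 0 then 1 else 0 := by
  rw [bvec, hcoeff_mkQ, HahnSeries.coeff_single]
  split_ifs <;> simp_all

theorem hcoeff_hplus_nat (n : ℕ) (a : ℕ → ℂ) : hcoeff (n + 1 : ℤ) (hplus a) = a n := by
  rw [hplus, hcoeff_mkQ, if_neg (by omega)]
  have := HahnSeries.ofPowerSeries_apply_coeff (Γ := ℤ) (PowerSeries.X * PowerSeries.mk a) (n + 1)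
  rw [Nat.cast_add, Nat.cast_one] at this
  rw [this, mul_comm, PowerSeries.coeff_succ_mul_X, PowerSeries.coeff_mk]

theorem hplus_mem (a : ℕ → ℂ) : hplus a ∈ HPlus := by
  refine mem_hfil.2 fun n hn => ?_
  rw [hplus, hcoeff_mkQ]
  split_ifs with h
  · rfl
  · rw [HahnSeries.ofPowerSeries_apply, HahnSeries.embDomain_of_notMem_range]
    rintro ⟨k, hk⟩
    simp at hk
    omega

theorem hplus_hcoeff {y : HPrime} (hy : y ∈ HPlus) :
    hplus (fun n => hcoeff (n + 1 : ℤ) y) = y := by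
  refine hprime_ext fun n => ?_
  by_cases hn : n < 1
  · rw [mem_hfil.1 hy n hn, mem_hfil.1 (hplus_mem _) n hn]
  · obtain ⟨k, rfl⟩ : ∃ k : ℕ, n = k + 1 := ⟨(n - 1).toNat, by omega⟩
    rw [hcoeff_hplus_nat]

/-- A common bound on the pole orders puts the residue on a fixed finite range of indices. This is
what makes pairings of holomorphic or differentiable families holomorphic or differentiable. The
sign disappears because the coefficient of dg paired with t^k is -k times the coefficient of t^{-k}
in g. -/
theorem symp_eq_sum {N : ℕ} {f g : HPrime} (hf : f ∈ hfil (-(N : ℤ))) (hg : g ∈ hfil (-(N : ℤ))) :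
    symp f g = ∑ k ∈ Finset.Icc (-(N : ℤ)) N, (k : ℂ) * hcoeff k f * hcoeff (-k) g := by
  obtain ⟨f, rfl⟩ := constLine.mkQ_surjective f
  obtain ⟨g, rfl⟩ := constLine.mkQ_surjective g
  have hf' : ∀ n < -(N : ℤ), f.coeff n = 0 := fun n hn => by
    have := mem_hfil.1 hf n hn
    rwa [hcoeff_mkQ, if_neg (by omega)] at this
  have hg' : ∀ n < -(N : ℤ), g.coeff n = 0 := fun n hn => by
    have := mem_hfil.1 hg n hn
    rwa [hcoeff_mkQ, if_neg (by omega)] at this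
  have hd : ∀ n, (LaurentSeries.derivative ℂ g).coeff n = ((n : ℂ) + 1) * g.coeff (n + 1) := by
    intro n
    rw [LaurentSeries.derivative_apply, LaurentSeries.hasseDeriv_coeff]
    simp
  rw [symp_mkQ, HahnSeries.coeff_mul, ← Finset.sum_neg_distrib]
  -- A pair (i, j) with i + j = -1 is determined by i; indices of the range not reached this way
  -- contribute 0.
  refine Finset.sum_of_injOn Prod.fst ?_ ?_ ?_ ?_
  · rintro ⟨i, j⟩ h ⟨i', j'⟩ h' e
    simp only [Finset.mem_coe, Finset.mem_antidiagonal] at h h' e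
    ext <;> simp <;> omega
  · rintro ⟨i, j⟩ h
    simp only [Finset.mem_coe, Finset.mem_antidiagonal, HahnSeries.mem_support, hd] at h
    obtain ⟨h1, h2, h3⟩ := h
    simp only [Finset.coe_Icc, Set.mem_Icc]
    constructor
    · by_contra h
      exact h1 (hf' _ (by omega))
    · by_contra h
      exact h2 (by rw [hg' _ (by omega), mul_zero])
  · intro k _ hk
    rw [hcoeff_mkQ, hcoeff_mkQ]
    by_cases h0 : k = 0
    · simp [h0]
    rw [if_neg h0, if_neg (by omega)]
    by_contra hne
    apply hk
    refine ⟨(k, -1 - k), ?_, rfl⟩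
    simp only [Finset.mem_coe, Finset.mem_antidiagonal, HahnSeries.mem_support, hd]
    refine ⟨fun h => hne (by simp [h]), ?_, by ring⟩
    have e : -1 - k + 1 = -k := by ring
    rw [e]
    push_cast
    intro h
    rcases mul_eq_zero.1 h with h | h
    · apply h0
      have : (k : ℂ) = 0 := by linear_combination -h
      exact_mod_cast this
    · exact hne (by simp [h])
  · rintro ⟨i, j⟩ h
    simp only [Finset.mem_antidiagonal] at h
    obtain rfl : j = -1 - i := by omega
    simp only [hd, hcoeff_mkQ]
    have e : -1 - i + 1 = -i := by ring
    rw [e]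
    push_cast
    by_cases h0 : i = 0
    · simp [h0]
    · simp only [h0, neg_eq_zero, if_false]
      ring

theorem exists_common_hfil (f g : HPrime) :
    ∃ N : ℕ, f ∈ hfil (-(N : ℤ)) ∧ g ∈ hfil (-(N : ℤ)) := by
  obtain ⟨M, hM⟩ := exists_mem_hfil f
  obtain ⟨N, hN⟩ := exists_mem_hfil g
  exact ⟨max M N, hfil_anti (by simp) hM, hfil_anti (by simp) hN⟩

theorem symp_antisymm (f g : HPrime) : symp f g = -symp g f := by
  obtain ⟨N, hf, hg⟩ := exists_common_hfil f g
  rw [symp_eq_sum hf hg, symp_eq_sum hg hf, ← Finset.sum_neg_distrib]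
  refine Finset.sum_bij' (fun k _ => -k) (fun k _ => -k) ?_ ?_ ?_ ?_ ?_
  · intro k hk; simp at hk ⊢; omega
  · intro k hk; simp at hk ⊢; omega
  · simp
  · simp
  · intro k _; push_cast; rw [neg_neg]; ring

theorem symp_bvec_left (n : ℤ) (g : HPrime) : symp (bvec n) g = n * hcoeff (-n) g := by
  obtain ⟨N, hf, hg⟩ := exists_common_hfil (bvec n) g
  obtain ⟨N', hN', hn⟩ : ∃ N' : ℕ, N ≤ N' ∧ n.natAbs ≤ N' :=
    ⟨max N n.natAbs, le_max_left _ _, le_max_right _ _⟩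
  rw [symp_eq_sum (hfil_anti (by omega) hf : _ ∈ hfil (-(N' : ℤ))) (hfil_anti (by omega) hg),
    Finset.sum_eq_single n]
  · by_cases h : n = 0
    · simp [h]
    · simp [hcoeff_bvec, h]
  · intro k _ hk
    simp [hcoeff_bvec, hk]
  · intro h
    simp at h
    omega

theorem symp_bvec_right (n : ℤ) (g : HPrime) : symp g (bvec n) = -(n * hcoeff (-n) g) := by
  rw [symp_antisymm, symp_bvec_left]

/-- Reading positive coefficients as pairings lets the invariance of the form compute coordinates of
transformed vectors. -/
theorem hcoeff_eq_symp (n : ℕ) (g : HPrime) :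
    hcoeff (n + 1 : ℤ) g = -symp (bvec (-(n + 1 : ℤ))) g / (n + 1) := by
  rw [symp_bvec_left, neg_neg]
  have : (n : ℂ) + 1 ≠ 0 := Nat.cast_add_one_ne_zero n
  field_simp
  push_cast
  ring

theorem symp_plus {f g : HPrime} (hf : f ∈ HPlus) (hg : g ∈ HPlus) : symp f g = 0 := by
  rw [symp_eq_sum (N := 0) (hfil_anti (by simp) hf) (hfil_anti (by simp) hg)]
  simp

/-! ### Polar parts and the splitting of H' along H'_+ -/

/-- The coefficients of the polar part. -/
def polar : HPrime →ₗ[ℂ] (ℕ →₀ ℂ) where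
  toFun y := Finsupp.ofSupportFinite (fun n => hcoeff (-(n + 1 : ℤ)) y) (by
    obtain ⟨N, hN⟩ := exists_mem_hfil y
    refine (Finset.range N).finite_toSet.subset fun n hn => ?_
    simp only [Finset.coe_range, Set.mem_Iio]
    by_contra h
    exact hn (mem_hfil.1 hN _ (by omega)))
  map_add' y z := by ext n; simp [Finsupp.ofSupportFinite_coe]
  map_smul' r y := by ext n; simp [Finsupp.ofSupportFinite_coe]

@[simp] theorem polar_apply (y : HPrime) (n : ℕ) : polar y n = hcoeff (-(n + 1 : ℤ)) y := rfl

theorem polar_support_subset {N : ℕ} {y : HPrime} (hy : y ∈ hfil (-(N : ℤ))) :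
    (polar y).support ⊆ Finset.range N := by
  intro n hn
  rw [Finsupp.mem_support_iff, polar_apply] at hn
  rw [Finset.mem_range]
  by_contra h
  exact hn (mem_hfil.1 hy _ (by omega))

theorem mem_plus_iff_polar {y : HPrime} : y ∈ HPlus ↔ polar y = 0 := by
  rw [mem_hfil]
  constructor
  · intro h
    ext n
    exact h _ (by omega)
  · intro h n hn
    by_cases h0 : n = 0
    · rw [h0, hcoeff_zero_index]
    · have := DFunLike.congr_fun h (-n - 1).toNat
      rw [polar_apply] at this
      have e : (-(((-n - 1).toNat : ℤ) + 1)) = n := by omega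
      rwa [e] at this

theorem polar_bvec (n : ℕ) : polar (bvec (-(n + 1 : ℤ))) = Finsupp.single n 1 := by
  ext m
  rw [polar_apply, hcoeff_bvec, Finsupp.single_apply]
  by_cases h : n = m
  · rw [if_pos, if_pos h]; omega
  · rw [if_neg, if_neg h]; omega

theorem polar_plus {y : HPrime} (hy : y ∈ HPlus) : polar y = 0 := mem_plus_iff_polar.1 hy

/-- The polar part. -/
def polarPart : HPrime →ₗ[ℂ] HPrime :=
  Finsupp.linearCombination ℂ (fun n : ℕ => bvec (-(n + 1 : ℤ))) ∘ₗ polar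

theorem polar_linearCombination {v : ℕ → HPrime} (hv : ∀ n, polar (v n) = Finsupp.single n 1)
    (a : ℕ →₀ ℂ) : polar (Finsupp.linearCombination ℂ v a) = a := by
  rw [Finsupp.linearCombination_apply, Finsupp.sum, map_sum]
  simp only [map_smul, hv, Finsupp.smul_single, smul_eq_mul, mul_one]
  exact Finsupp.sum_single a

theorem sub_polarPart_mem (y : HPrime) : y - polarPart y ∈ HPlus := by
  rw [mem_plus_iff_polar, map_sub, polarPart, LinearMap.comp_apply,
    polar_linearCombination polar_bvec, sub_self]

theorem linearCombination_polar_eq_sum {M : Type*} [AddCommGroup M] [Module ℂ M] {N : ℕ}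
    {y : HPrime} (hy : y ∈ hfil (-(N : ℤ))) (v : ℕ → M) :
    Finsupp.linearCombination ℂ v (polar y) =
      ∑ n ∈ Finset.range N, hcoeff (-(n + 1 : ℤ)) y • v n := by
  rw [Finsupp.linearCombination_apply]
  exact Finsupp.sum_of_support_subset _ (polar_support_subset hy) _ (by simp)

theorem linearCombination_polar_eq_finsum {M : Type*} [AddCommGroup M] [Module ℂ M]
    (y : HPrime) (v : ℕ → M) :
    Finsupp.linearCombination ℂ v (polar y) = ∑ᶠ n : ℕ, hcoeff (-(n + 1 : ℤ)) y • v n := by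
  obtain ⟨N, hN⟩ := exists_mem_hfil y
  rw [linearCombination_polar_eq_sum hN, finsum_eq_sum_of_support_subset]
  intro n hn
  rw [Finset.coe_range, Set.mem_Iio]
  by_contra h
  apply hn
  have := mem_hfil.1 hN (-(n + 1 : ℤ)) (by omega)
  simp only [this, zero_smul]

/-- The pairing of H'_+ with the negative powers is nondegenerate on the H'_+ side, since ⟨h,
b_{-n}⟩ is n times the n-th coefficient of h. -/
theorem symp_plus_left_ext {h : HPrime} (hh : h ∈ HPlus)
    (h0 : ∀ n : ℕ, symp h (bvec (-(n + 1 : ℤ))) = 0) : h = 0 := by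
  refine hprime_ext fun n => ?_
  rw [map_zero]
  by_cases hn : n < 1
  · exact mem_hfil.1 hh n hn
  · obtain ⟨k, rfl⟩ : ∃ k : ℕ, n = k + 1 := ⟨(n - 1).toNat, by omega⟩
    rw [hcoeff_eq_symp, symp_antisymm, h0]
    simp

/-! ### Holomorphic functions of infinitely many variables -/

section HolAt

variable {ι κ : Type} {f g : (ι → ℂ) → ℂ} {t : ι → ℂ}

theorem HolAt.congr (hf : HolAt f t) (h : ∀ᶠ u in 𝓝 t, f u = g u) : HolAt g t := by
  obtain ⟨s, F, hF, e⟩ := hf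
  exact ⟨s, F, hF, by filter_upwards [e, h] with u h1 h2; rw [← h2, h1]⟩

theorem HolAt.add (hf : HolAt f t) (hg : HolAt g t) : HolAt (fun u => f u + g u) t :=
  hf.map₂ hg (fun z => z.1 + z.2) fun _ => analyticAt_fst.add analyticAt_snd

theorem HolAt.mul (hf : HolAt f t) (hg : HolAt g t) : HolAt (fun u => f u * g u) t :=
  hf.map₂ hg (fun z => z.1 * z.2) fun _ => analyticAt_fst.mul analyticAt_snd

theorem HolAt.neg (hf : HolAt f t) : HolAt (fun u => -f u) t :=
  hf.map₂ hf (fun z => -z.1) fun _ => analyticAt_fst.neg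

theorem HolAt.const_mul (c : ℂ) (hf : HolAt f t) : HolAt (fun u => c * f u) t :=
  (HolAt.const c t).mul hf

theorem HolAt.sum {α : Type*} {s : Finset α} {F : α → (ι → ℂ) → ℂ}
    (h : ∀ i ∈ s, HolAt (F i) t) : HolAt (fun u => ∑ i ∈ s, F i u) t := by
  classical
  induction s using Finset.induction_on with
  | empty => simpa using HolAt.const 0 t
  | insert a s ha ih =>
    simp only [Finset.sum_insert ha]
    exact (h a (Finset.mem_insert_self a s)).add
      (ih fun i hi => h i (Finset.mem_insert_of_mem hi))

theorem HolAt.prod {α : Type*} {s : Finset α} {F : α → (ι → ℂ) → ℂ}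
    (h : ∀ i ∈ s, HolAt (F i) t) : HolAt (fun u => ∏ i ∈ s, F i u) t := by
  classical
  induction s using Finset.induction_on with
  | empty => simpa using HolAt.const 1 t
  | insert a s ha ih =>
    simp only [Finset.prod_insert ha]
    exact (h a (Finset.mem_insert_self a s)).mul
      (ih fun i hi => h i (Finset.mem_insert_of_mem hi))

theorem continuous_finset_restrict (s : Finset ι) :
    Continuous (s.restrict : (ι → ℂ) → (s → ℂ)) :=
  continuous_pi fun i => continuous_apply (i : ι)

theorem HolAt.continuousAt (hf : HolAt f t) : ContinuousAt f t := by
  obtain ⟨s, F, hF, e⟩ := hf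
  have h : ContinuousAt (fun u => F (s.restrict u)) t :=
    ContinuousAt.comp (f := fun u : ι → ℂ => (s.restrict u : s → ℂ)) hF.continuousAt
      (continuous_finset_restrict s).continuousAt
  exact h.congr (e.mono fun u hu => hu.symm)

theorem HolAt.inv (hf : HolAt f t) (h0 : f t ≠ 0) : HolAt (fun u => (f u)⁻¹) t := by
  obtain ⟨s, F, hF, e⟩ := hf
  refine ⟨s, fun z => (F z)⁻¹, hF.inv ?_, e.mono fun u hu => by simp only [hu]⟩
  rwa [← e.self_of_nhds]

theorem HolAt.coord (i : ι) (t : ι → ℂ) : HolAt (fun u => u i) t := by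
  refine ⟨{i}, fun z => z ⟨i, by simp⟩, ?_, Eventually.of_forall fun u => rfl⟩
  exact (ContinuousLinearMap.proj (R := ℂ) (φ := fun _ : ({i} : Finset ι) => ℂ)
    ⟨i, by simp⟩).analyticAt _

/-- The union of the finitely many coordinate sets serves all the functions at once. -/
theorem HolAt.exists_common {s : Finset κ} {q : κ → (ι → ℂ) → ℂ} (h : ∀ i ∈ s, HolAt (q i) t) :
    ∃ (S : Finset ι) (G : κ → (S → ℂ) → ℂ), ∀ i ∈ s, AnalyticAt ℂ (G i) (S.restrict t) ∧
      ∀ᶠ u in 𝓝 t, q i u = G i (S.restrict u) := by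
  classical
  choose S F hF using h
  have hS : ∀ i (hi : i ∈ s), S i hi ⊆ s.attach.biUnion fun i => S i i.2 := fun i hi j hj =>
    Finset.mem_biUnion.2 ⟨⟨i, hi⟩, Finset.mem_attach _ _, hj⟩
  let p : ∀ i (hi : i ∈ s), ((s.attach.biUnion fun i => S i i.2 : Finset ι) → ℂ) →L[ℂ]
      (S i hi → ℂ) := fun i hi =>
    ContinuousLinearMap.pi fun j => ContinuousLinearMap.proj ⟨j, hS i hi j.2⟩
  refine ⟨s.attach.biUnion fun i => S i i.2,
    fun i z => if hi : i ∈ s then F i hi (p i hi z) else 0, fun i hi => ⟨?_, ?_⟩⟩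
  · simp only [hi, dif_pos]
    exact AnalyticAt.comp (g := F i hi) (f := p i hi) (hF i hi).1 ((p i hi).analyticAt _)
  · filter_upwards [(hF i hi).2] with u hu
    simp only [hi, dif_pos, hu]
    rfl

theorem tendsto_of_holAt {q : (ι → ℂ) → κ → ℂ} (hq : ∀ i, HolAt (fun u => q u i) t) :
    Tendsto q (𝓝 t) (𝓝 (q t)) :=
  tendsto_pi_nhds.2 fun i => (hq i).continuousAt

/-- The outer function sees only finitely many components of q, and these jointly depend on finitely
many variables, so the claim reduces to composition of analytic maps in finite dimension. -/
theorem HolAt.comp {f : (κ → ℂ) → ℂ} {q : (ι → ℂ) → κ → ℂ} (hf : HolAt f (q t))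
    (hq : ∀ i, HolAt (fun u => q u i) t) : HolAt (fun u => f (q u)) t := by
  obtain ⟨s, F, hF, e⟩ := hf
  obtain ⟨S, G, hG⟩ := HolAt.exists_common (s := s) (fun i _ => hq i)
  refine ⟨S, fun z => F fun i => G (i : κ) z, ?_, ?_⟩
  · refine AnalyticAt.comp (g := F) (f := fun z (i : s) => G (i : κ) z) ?_
      (analyticAt_pi_iff.2 fun i => (hG i i.2).1)
    have e2 : (fun i : s => G (i : κ) (S.restrict t)) = s.restrict (q t) := by
      ext i
      exact ((hG i i.2).2.self_of_nhds).symm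
    rw [e2]
    exact hF
  · have h := (s.eventually_all).2 fun i hi => (hG i hi).2
    filter_upwards [h, (tendsto_of_holAt hq).eventually e] with u h1 h2
    rw [h2]
    congr 1
    ext i
    exact h1 i i.2

/-- A curve through `u` with velocity `δ`. -/
def CurveAt (γ : ℂ → ι → ℂ) (u δ : ι → ℂ) : Prop :=
  γ 0 = u ∧ ∀ i, HasDerivAt (fun ε => γ ε i) (δ i) 0

theorem CurveAt.line (u δ : ι → ℂ) : CurveAt (fun ε => u + ε • δ) u δ := by
  refine ⟨by simp, fun i => ?_⟩
  simpa using ((hasDerivAt_id (0 : ℂ)).mul_const (δ i)).const_add (u i)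

theorem CurveAt.tendsto {γ : ℂ → ι → ℂ} {u δ : ι → ℂ} (h : CurveAt γ u δ) :
    Tendsto γ (𝓝 0) (𝓝 u) := by
  rw [← h.1]
  exact tendsto_pi_nhds.2 fun i => (h.2 i).continuousAt

/-- One holomorphic function serves as derivative along every curve with the given velocity, not
only along lines. This allows the group orbit and the affine line that defines the Lie algebra
action to be compared, though only their velocities agree. -/
theorem HolAt.exists_deriv (hf : HolAt f t) {δ : (ι → ℂ) → ι → ℂ}
    (hδ : ∀ i, HolAt (fun u => δ u i) t) :
    ∃ f' : (ι → ℂ) → ℂ, HolAt f' t ∧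
      ∀ᶠ u in 𝓝 t, ∀ γ, CurveAt γ u (δ u) → HasDerivAt (fun ε => f (γ ε)) (f' u) 0 := by
  classical
  obtain ⟨s, F, hF, e⟩ := hf
  refine ⟨fun u => ∑ i : s, fderiv ℂ F (s.restrict u) (Pi.single i 1) * δ u i,
    HolAt.sum fun i _ => HolAt.mul ?_ (hδ _), ?_⟩
  · refine ⟨s, fun z => fderiv ℂ F z (Pi.single i 1), ?_, Eventually.of_forall fun _ => rfl⟩
    exact (ContinuousLinearMap.apply ℂ ℂ (Pi.single i (1 : ℂ) : s → ℂ)).analyticAt _ |>.comp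
      hF.fderiv
  · have hd : ∀ᶠ z in 𝓝 (s.restrict t), DifferentiableAt ℂ F z :=
      hF.eventually_analyticAt.mono fun z hz => hz.differentiableAt
    filter_upwards [e.eventually_nhds,
      (continuous_finset_restrict s).continuousAt.eventually hd] with u h1 h2 γ hγ
    have h3 : HasDerivAt (fun ε => (s.restrict (γ ε) : s → ℂ)) (s.restrict (δ u)) 0 :=
      hasDerivAt_pi.2 fun i => hγ.2 i
    have h4 : HasDerivAt (fun ε => F (s.restrict (γ ε)))
        (fderiv ℂ F (s.restrict u) (s.restrict (δ u))) 0 := by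
      refine HasFDerivAt.comp_hasDerivAt (0 : ℂ) ?_ h3
      rw [hγ.1]
      exact h2.hasFDerivAt
    have h5 : fderiv ℂ F (s.restrict u) (s.restrict (δ u)) =
        ∑ i : s, fderiv ℂ F (s.restrict u) (Pi.single i 1) * δ u i := by
      conv_lhs => rw [pi_eq_sum_univ' (s.restrict (δ u) : s → ℂ)]
      rw [map_sum]
      refine Finset.sum_congr rfl fun i _ => ?_
      rw [map_smul, smul_eq_mul, mul_comm]
      congr 2
    rw [h5] at h4
    exact h4.congr_of_eventuallyEq (hγ.tendsto.eventually h1)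

end HolAt

/-! ### Holomorphic functions with values in `H'` -/

section HolHAt

variable {ι κ : Type} {f g : (ι → ℂ) → HPrime} {t : ι → ℂ}

theorem HolHAt.congr (hf : HolHAt f t) (h : ∀ᶠ u in 𝓝 t, f u = g u) : HolHAt g t := by
  refine ⟨fun n => (hf.1 n).congr (h.mono fun u hu => by rw [hu]), ?_⟩
  obtain ⟨N, hN⟩ := hf.2
  exact ⟨N, by filter_upwards [hN, h] with u h1 h2; rwa [← h2]⟩

theorem HolHAt.exists_nat (hf : HolHAt f t) : ∃ N : ℕ, ∀ᶠ u in 𝓝 t, f u ∈ hfil (-(N : ℤ)) := by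
  obtain ⟨N, hN⟩ := hf.2
  exact ⟨N.natAbs, hN.mono fun u hu => hfil_anti (by omega) hu⟩

theorem HolHAt.const (y : HPrime) (t : ι → ℂ) : HolHAt (fun _ => y) t := by
  obtain ⟨N, hN⟩ := exists_mem_hfil y
  exact ⟨fun n => HolAt.const _ _, _, Eventually.of_forall fun _ => hN⟩

theorem HolHAt.exists_common (hf : HolHAt f t) (hg : HolHAt g t) :
    ∃ N : ℕ, ∀ᶠ u in 𝓝 t, f u ∈ hfil (-(N : ℤ)) ∧ g u ∈ hfil (-(N : ℤ)) := by
  obtain ⟨M, hM⟩ := hf.exists_nat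
  obtain ⟨N, hN⟩ := hg.exists_nat
  refine ⟨max M N, ?_⟩
  filter_upwards [hM, hN] with u h1 h2
  exact ⟨hfil_anti (by simp) h1, hfil_anti (by simp) h2⟩

theorem HolHAt.add (hf : HolHAt f t) (hg : HolHAt g t) : HolHAt (fun u => f u + g u) t := by
  refine ⟨fun n => by simpa using (hf.1 n).add (hg.1 n), ?_⟩
  obtain ⟨N, hN⟩ := hf.exists_common hg
  exact ⟨_, hN.mono fun u hu => add_mem hu.1 hu.2⟩

theorem HolHAt.smul {a : (ι → ℂ) → ℂ} (ha : HolAt a t) (hf : HolHAt f t) :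
    HolHAt (fun u => a u • f u) t := by
  refine ⟨fun n => by simpa using ha.mul (hf.1 n), ?_⟩
  obtain ⟨N, hN⟩ := hf.2
  exact ⟨_, hN.mono fun u hu => Submodule.smul_mem _ _ hu⟩

theorem HolHAt.sub (hf : HolHAt f t) (hg : HolHAt g t) : HolHAt (fun u => f u - g u) t := by
  have := hf.add (HolHAt.smul (HolAt.const (-1) t) hg)
  simpa [sub_eq_add_neg] using this

theorem HolHAt.sum {α : Type*} {s : Finset α} {F : α → (ι → ℂ) → HPrime}
    (h : ∀ i ∈ s, HolHAt (F i) t) : HolHAt (fun u => ∑ i ∈ s, F i u) t := by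
  classical
  induction s using Finset.induction_on with
  | empty => simpa using HolHAt.const 0 t
  | insert a s ha ih =>
    simp only [Finset.sum_insert ha]
    exact (h a (Finset.mem_insert_self a s)).add
      (ih fun i hi => h i (Finset.mem_insert_of_mem hi))

theorem HolHAt.comp {f : (κ → ℂ) → HPrime} {q : (ι → ℂ) → κ → ℂ} (hf : HolHAt f (q t))
    (hq : ∀ i, HolAt (fun u => q u i) t) : HolHAt (fun u => f (q u)) t := by
  refine ⟨fun n => HolAt.comp (hf.1 n) hq, ?_⟩
  obtain ⟨N, hN⟩ := hf.2
  exact ⟨N, (tendsto_of_holAt hq).eventually hN⟩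

theorem HolHAt.symp (hf : HolHAt f t) (hg : HolHAt g t) :
    HolAt (fun u => symp (f u) (g u)) t := by
  obtain ⟨N, hN⟩ := hf.exists_common hg
  refine HolAt.congr (f := fun u => ∑ k ∈ Finset.Icc (-(N : ℤ)) N,
    (k : ℂ) * hcoeff k (f u) * hcoeff (-k) (g u)) (HolAt.sum fun k _ =>
      ((hf.1 k).const_mul _).mul (hg.1 _)) ?_
  filter_upwards [hN] with u hu
  rw [symp_eq_sum hu.1 hu.2]

/-- A local bound on the pole order makes the sum over the polar part uniformly finite. -/
theorem HolHAt.linearCombination (hf : HolHAt f t) {v : (ι → ℂ) → ℕ → HPrime}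
    (hv : ∀ n, HolHAt (fun u => v u n) t) :
    HolHAt (fun u => Finsupp.linearCombination ℂ (v u) (polar (f u))) t := by
  obtain ⟨N, hN⟩ := hf.exists_nat
  refine HolHAt.congr (f := fun u => ∑ n ∈ Finset.range N,
    hcoeff (-(n + 1 : ℤ)) (f u) • v u n) (HolHAt.sum fun n _ => HolHAt.smul (hf.1 _) (hv n)) ?_
  filter_upwards [hN] with u hu
  rw [linearCombination_polar_eq_sum hu]

theorem HolHAt.hplus {a : (ι → ℂ) → ℕ → ℂ} (ha : ∀ n, HolAt (fun u => a u n) t) :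
    HolHAt (fun u => hplus (a u)) t := by
  refine ⟨fun n => ?_, 1, Eventually.of_forall fun u => hplus_mem _⟩
  by_cases hn : n < 1
  · refine (HolAt.const 0 t).congr (Eventually.of_forall fun u => ?_)
    rw [mem_hfil.1 (hplus_mem _) n hn]
  · obtain ⟨k, rfl⟩ : ∃ k : ℕ, n = k + 1 := ⟨(n - 1).toNat, by omega⟩
    simpa only [hcoeff_hplus_nat] using ha k

/-- A holomorphic family of endomorphisms of `H'` preserving `H'_+`, with its adjoints. -/
structure IsOpFamily (A B : (ι → ℂ) → HPrime →ₗ[ℂ] HPrime) (t : ι → ℂ) : Prop where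
  adjoint : ∀ᶠ u in 𝓝 t, ∀ f g, symp (A u f) g = symp f (B u g)
  plus : ∀ᶠ u in 𝓝 t, ∀ f ∈ HPlus, A u f ∈ HPlus
  hol : ∀ f, HolHAt (fun u => A u f) t
  hol_adjoint : ∀ f, HolHAt (fun u => B u f) t

theorem hcoeff_eq_symp_adjoint {A B : HPrime →ₗ[ℂ] HPrime}
    (h : ∀ f g, symp (A f) g = symp f (B g)) {n : ℤ} (hn : n ≠ 0) (y : HPrime) :
    hcoeff n (A y) = symp y (B (bvec (-n))) / n := by
  rw [← h, symp_bvec_right, neg_neg]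
  have : (n : ℂ) ≠ 0 := by exact_mod_cast hn
  field_simp
  push_cast
  ring

/-- A coefficient of A f is a priori an infinite sum over the coefficients of f. Moving A to the
other side turns it into a pairing of two holomorphic families, which is locally a finite sum; this
is why `IsOpFamily` records the adjoint. -/
theorem IsOpFamily.apply {A B : (ι → ℂ) → HPrime →ₗ[ℂ] HPrime} (h : IsOpFamily A B t)
    (hf : HolHAt f t) : HolHAt (fun u => A u (f u)) t := by
  constructor
  · intro n
    by_cases hn : n = 0
    · subst hn; simpa using HolAt.const 0 t
    · refine HolAt.congr (((hf.symp (h.hol_adjoint (bvec (-n))))).const_mul ((n : ℂ)⁻¹)) ?_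
      filter_upwards [h.adjoint] with u hu
      rw [hcoeff_eq_symp_adjoint hu hn, div_eq_inv_mul]
  · obtain ⟨N, hN⟩ := (hf.linearCombination
      (v := fun u n => A u (bvec (-(n + 1 : ℤ)))) (fun n => h.hol _)).exists_nat
    refine ⟨-(N : ℤ), ?_⟩
    filter_upwards [hN, h.plus] with u h1 h2
    -- For the pole order: the part in H'_+ stays in H'_+, and the polar part involves finitely many
    -- fixed vectors b_{-n}.
    have e : A u (f u) = A u (f u - polarPart (f u)) +
        Finsupp.linearCombination ℂ (fun n : ℕ => A u (bvec (-(n + 1 : ℤ)))) (polar (f u)) := by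
      rw [map_sub, polarPart, LinearMap.comp_apply, Finsupp.apply_linearCombination]
      exact (sub_add_cancel _ _).symm
    rw [e]
    exact add_mem (hfil_anti (by omega) (h2 _ (sub_polarPart_mem _))) h1

end HolHAt

/-! ### Heisenberg operators -/

theorem symp_polarPart_right (y z : HPrime) :
    symp y (polarPart z) = (polar z).sum fun n a => a * ((n + 1) * hcoeff (n + 1 : ℤ) y) := by
  rw [polarPart, LinearMap.comp_apply, Finsupp.linearCombination_apply, Finsupp.sum, map_sum,
    Finsupp.sum]
  refine Finset.sum_congr rfl fun n _ => ?_
  rw [map_smul, symp_bvec_right, neg_neg, smul_eq_mul]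
  push_cast
  ring

theorem symp_polarPart_polarPart (y z : HPrime) : symp (polarPart y) (polarPart z) = 0 := by
  rw [symp_polarPart_right]
  refine Finset.sum_eq_zero fun n _ => ?_
  have : hcoeff (n + 1 : ℤ) (polarPart y) = 0 := by
    rw [polarPart, LinearMap.comp_apply, Finsupp.linearCombination_apply, Finsupp.sum, map_sum]
    refine Finset.sum_eq_zero fun m _ => ?_
    rw [map_smul, hcoeff_bvec, if_neg (by omega), smul_zero]
  simp only [this, mul_zero]

/-- Both H'_+ and the span of the negative powers are isotropic, so only cross terms survive. The
left side is what arises when the annihilation parts of two modes hit each other's creation parts.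
-/
theorem symp_decomp (y z : HPrime) :
    symp y (polarPart z) - symp z (polarPart y) = symp y z := by
  have h1 := symp_polarPart_polarPart y z
  have h2 := symp_plus (sub_polarPart_mem y) (sub_polarPart_mem z)
  have h3 := symp_antisymm z (polarPart y)
  simp only [map_sub, LinearMap.sub_apply] at h2
  linear_combination -h2 - h3 + h1

variable {d : ℕ} {ℓ : ℂ}

/-- The linear polynomial `H^k ⊗ y_-`. -/
def linPoly (k : Fin d) (y : HPrime) : Fock d :=
  Finsupp.linearCombination ℂ (fun n : ℕ => (MvPolynomial.X (k, n) : Fock d)) (polar y)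

theorem create_apply (k : Fin d) (y : HPrime) (v : Fock d) : create k y v = linPoly k y * v := by
  rw [linPoly, linearCombination_polar_eq_finsum]
  rfl

/-- The derivation underlying `annihilate`. -/
def annihilateDer (k : Fin d) (y : HPrime) : Derivation ℂ (Fock d) (Fock d) :=
  MvPolynomial.mkDerivation ℂ fun p : Fin d × ℕ =>
    if p.1 = k then (MvPolynomial.C (((p.2 : ℂ) + 1) * hcoeff (p.2 + 1 : ℤ) y) : Fock d) else 0

theorem annihilateDer_X (k : Fin d) (y : HPrime) (p : Fin d × ℕ) :
    annihilateDer k y (MvPolynomial.X p) =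
      if p.1 = k then (MvPolynomial.C (symp y (bvec (-(p.2 + 1 : ℤ)))) : Fock d) else 0 := by
  rw [annihilateDer, MvPolynomial.mkDerivation_X, symp_bvec_right, neg_neg]
  push_cast
  rw [neg_mul, neg_neg]

theorem annihilateDer_add (k : Fin d) (y z : HPrime) :
    annihilateDer k (y + z) = annihilateDer k y + annihilateDer k z := by
  refine MvPolynomial.derivation_ext fun p => ?_
  simp only [Derivation.add_apply, annihilateDer_X, map_add, LinearMap.add_apply]
  split_ifs <;> simp

theorem annihilateDer_smul (k : Fin d) (r : ℂ) (y : HPrime) :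
    annihilateDer k (r • y) = r • annihilateDer k y := by
  refine MvPolynomial.derivation_ext fun p => ?_
  simp only [Derivation.smul_apply, annihilateDer_X, map_smul, LinearMap.smul_apply, smul_eq_mul]
  split_ifs
  · rw [MvPolynomial.C_mul, MvPolynomial.smul_eq_C_mul]
  · simp

theorem mode_apply (k : Fin d) (y : HPrime) (v : Fock d) :
    mode ℓ k y v = linPoly k y * v + ℓ • annihilateDer k y v := by
  rw [mode, LinearMap.add_apply, create_apply]
  rfl

/-- `mode` as a linear map in the vector of `H'`. -/
def modeHom (ℓ : ℂ) (k : Fin d) : HPrime →ₗ[ℂ] Fock d →ₗ[ℂ] Fock d where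
  toFun y := mode ℓ k y
  map_add' y z := by
    refine LinearMap.ext fun v => ?_
    simp only [mode_apply, LinearMap.add_apply, linPoly, map_add, annihilateDer_add,
      Derivation.add_apply, smul_add]
    ring
  map_smul' r y := by
    refine LinearMap.ext fun v => ?_
    simp only [mode_apply, LinearMap.smul_apply, linPoly, map_smul, annihilateDer_smul,
      Derivation.smul_apply, smul_add, RingHom.id_apply, smul_mul_assoc, smul_comm r ℓ]

theorem modeHom_apply (k : Fin d) (y : HPrime) : modeHom ℓ k y = mode ℓ k y := rfl

theorem mode_add (k : Fin d) (y z : HPrime) (v : Fock d) :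
    mode ℓ k (y + z) v = mode ℓ k y v + mode ℓ k z v := by
  simp only [← modeHom_apply, map_add, LinearMap.add_apply]

theorem mode_sub (k : Fin d) (y z : HPrime) (v : Fock d) :
    mode ℓ k (y - z) v = mode ℓ k y v - mode ℓ k z v := by
  simp only [← modeHom_apply, map_sub, LinearMap.sub_apply]

theorem linPoly_plus (k : Fin d) {y : HPrime} (hy : y ∈ HPlus) : linPoly k y = 0 := by
  rw [linPoly, polar_plus hy, map_zero]

theorem mode_plus (k : Fin d) {y : HPrime} (hy : y ∈ HPlus) (v : Fock d) :
    mode ℓ k y v = ℓ • annihilateDer k y v := by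
  rw [mode_apply, linPoly_plus k hy, zero_mul, zero_add]

theorem mode_plus_C (k : Fin d) {y : HPrime} (hy : y ∈ HPlus) (a : ℂ) :
    mode ℓ k y (MvPolynomial.C a) = 0 := by
  rw [mode_plus k hy, ← MvPolynomial.algebraMap_eq, Derivation.map_algebraMap, smul_zero]

theorem mode_bvec (k : Fin d) (n : ℕ) (v : Fock d) :
    mode ℓ k (bvec (-(n + 1 : ℤ))) v = MvPolynomial.X (k, n) * v := by
  have h : annihilateDer k (bvec (-(n + 1 : ℤ))) = 0 := by
    refine MvPolynomial.derivation_ext fun p => ?_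
    have h0 : symp (bvec (-(n + 1 : ℤ))) (bvec (-(p.2 + 1 : ℤ))) = 0 := by
      rw [symp_bvec_left, hcoeff_bvec, if_neg (by omega), mul_zero]
    rw [annihilateDer_X, h0]
    simp
  rw [mode_apply, h, linPoly, polar_bvec, Finsupp.linearCombination_single, one_smul]
  simp

theorem annihilateDer_linPoly (k l : Fin d) (y z : HPrime) :
    annihilateDer k y (linPoly l z) =
      if l = k then MvPolynomial.C (symp y (polarPart z)) else 0 := by
  rw [linPoly, Finsupp.linearCombination_apply, Finsupp.sum, map_sum]
  simp only [Derivation.map_smul, annihilateDer_X]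
  split_ifs with h
  · rw [polarPart, LinearMap.comp_apply, Finsupp.linearCombination_apply, Finsupp.sum, map_sum,
      map_sum]
    refine Finset.sum_congr rfl fun n _ => ?_
    rw [map_smul, smul_eq_mul, MvPolynomial.C_mul, MvPolynomial.smul_eq_C_mul]
  · simp

/-- Each derivation sends the variables to constants, so the commutator kills the variables. -/
theorem annihilateDer_comm (k l : Fin d) (y z : HPrime) (v : Fock d) :
    annihilateDer k y (annihilateDer l z v) = annihilateDer l z (annihilateDer k y v) := by
  have h : ⁅annihilateDer k y, annihilateDer l z⁆ = 0 := by
    refine MvPolynomial.derivation_ext fun p => ?_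
    rw [Derivation.commutator_apply, annihilateDer_X, annihilateDer_X]
    split_ifs <;> simp [← MvPolynomial.algebraMap_eq]
  have := DFunLike.congr_fun h v
  rw [Derivation.commutator_apply] at this
  exact sub_eq_zero.1 this

/-- The chain rule, with M allowed to exceed the variables of v so that several such expansions can
share one index set. -/
theorem annihilateDer_eq_sum (k : Fin d) (y : HPrime) (v : Fock d) {M : Finset (Fin d × ℕ)}
    (hM : v.vars ⊆ M) :
    annihilateDer k y v =
      ∑ q ∈ M, annihilateDer k y (MvPolynomial.X q) * MvPolynomial.pderiv q v := by
  have : annihilateDer k y v = (∑ q ∈ M, annihilateDer k y (MvPolynomial.X q) •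
      MvPolynomial.pderiv q : Derivation ℂ (Fock d) (Fock d)) v := by
    refine MvPolynomial.derivation_eq_of_forall_mem_vars fun q hq => ?_
    rw [← Derivation.coeFnAddMonoidHom_apply (∑ _ ∈ M, _), map_sum, Finset.sum_apply,
      Finset.sum_eq_single q]
    · simp only [Derivation.coeFnAddMonoidHom_apply, Derivation.smul_apply,
        MvPolynomial.pderiv_X_self, smul_eq_mul, mul_one]
    · intro r _ hr
      simp only [Derivation.coeFnAddMonoidHom_apply, Derivation.smul_apply,
        MvPolynomial.pderiv_X_of_ne (Ne.symm hr), smul_zero]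
    · intro h
      exact absurd (hM hq) h
  rw [this, ← Derivation.coeFnAddMonoidHom_apply (∑ _ ∈ M, _), map_sum, Finset.sum_apply]
  rfl

/-- The Heisenberg relation. Multiplications commute and derivations commute; the two mixed terms
combine to ⟨y, z⟩ by `symp_decomp`. -/
theorem mode_commutator (k l : Fin d) (y z : HPrime) (v : Fock d) :
    mode ℓ k y (mode ℓ l z v) =
      mode ℓ l z (mode ℓ k y v) + (if l = k then ℓ * symp y z else 0) • v := by
  simp only [mode_apply, map_add, Derivation.leibniz, Derivation.map_smul, annihilateDer_linPoly,
    annihilateDer_comm k l y z, smul_eq_mul]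
  by_cases h : l = k
  · subst h
    simp only [if_true]
    rw [← symp_decomp y z]
    simp only [MvPolynomial.smul_eq_C_mul, MvPolynomial.C_mul, MvPolynomial.C_sub]
    ring
  · rw [if_neg h, if_neg h, if_neg (fun e => h e.symm)]
    simp only [MvPolynomial.smul_eq_C_mul, MvPolynomial.C_0]
    ring

theorem heis_apply {Γ : Type*} [AddCommGroup Γ] (H : Module.Basis (Fin d) ℂ (ℂ ⊗[ℤ] Γ))
    (A : ℂ ⊗[ℤ] Γ) (y : HPrime) (v : Fock d) :
    heis H ℓ A y v = ∑ k, H.repr A k • mode ℓ k y v := by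
  simp [heis]

/-! ### The action of symplectic automorphisms -/

open scoped IsMulCommutative in
-- The universal property of the polynomial ring needs a commutative target; the subalgebra
-- generated by commuting elements is one.
theorem exists_algHom_of_commute {σ E : Type*} [Ring E] [Algebra ℂ E] (f : σ → E)
    (h : ∀ i j, f i * f j = f j * f i) :
    ∃ φ : MvPolynomial σ ℂ →ₐ[ℂ] E, ∀ i, φ (MvPolynomial.X i) = f i := by
  have : IsMulCommutative (Algebra.adjoin ℂ (Set.range f)) := Algebra.isMulCommutative_adjoin ℂ (by
    rintro _ ⟨i, rfl⟩ _ ⟨j, rfl⟩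
    exact h i j)
  refine ⟨(Algebra.adjoin ℂ (Set.range f)).val.comp (MvPolynomial.aeval fun i =>
    (⟨f i, Algebra.subset_adjoin ⟨i, rfl⟩⟩ : Algebra.adjoin ℂ (Set.range f))), fun i => ?_⟩
  rw [AlgHom.comp_apply, MvPolynomial.aeval_X]
  rfl

theorem IsSympPlus.map_plus {ρ : HPrime ≃ₗ[ℂ] HPrime} (h : IsSympPlus ρ) {y : HPrime}
    (hy : y ∈ HPlus) : ρ y ∈ HPlus := by
  rw [← h.plus]
  exact ⟨y, hy, rfl⟩

theorem IsSympPlus.symm {ρ : HPrime ≃ₗ[ℂ] HPrime} (h : IsSympPlus ρ) : IsSympPlus ρ.symm where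
  continuous := h.continuous_symm
  continuous_symm := h.continuous
  symplectic f g := by rw [← h.symplectic]; simp
  plus := by
    conv_lhs => rw [← h.plus]
    rw [← Submodule.map_comp]
    ext y
    simp

theorem IsSympPlus.adjoint {ρ : HPrime ≃ₗ[ℂ] HPrime} (h : IsSympPlus ρ) (f g : HPrime) :
    symp (ρ f) g = symp f (ρ.symm g) := by
  rw [← h.symplectic f, LinearEquiv.apply_symm_apply]

/-- The b_{-n} with n ≥ 1 span an isotropic subspace, and so do their images under ρ; by the
Heisenberg relation the corresponding modes commute. -/
theorem exists_algHom_mode {ρ : HPrime ≃ₗ[ℂ] HPrime} (h : IsSympPlus ρ) (d : ℕ) (ℓ : ℂ) :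
    ∃ φ : Fock d →ₐ[ℂ] Module.End ℂ (Fock d), ∀ p,
      φ (MvPolynomial.X p) = mode ℓ p.1 (ρ (bvec (-(p.2 + 1 : ℤ)))) := by
  refine exists_algHom_of_commute _ fun p q => ?_
  refine LinearMap.ext fun v => ?_
  rw [Module.End.mul_apply, Module.End.mul_apply, mode_commutator, h.symplectic]
  have h0 : symp (bvec (-(p.2 + 1 : ℤ))) (bvec (-(q.2 + 1 : ℤ))) = 0 := by
    rw [symp_bvec_left, hcoeff_bvec, if_neg (by omega), mul_zero]
  rw [h0]
  simp

open Classical in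
/-- The operator on the Fock space by which a symplectic automorphism preserving `H'_+` acts. -/
def fockAct (d : ℕ) (ℓ : ℂ) (ρ : HPrime ≃ₗ[ℂ] HPrime) : Fock d →ₗ[ℂ] Fock d :=
  -- A polynomial goes to the same polynomial in the transformed modes, evaluated on the vacuum 1;
  -- the value is 0 for ρ outside the group.
  if h : IsSympPlus ρ then LinearMap.applyₗ (1 : Fock d) ∘ₗ (exists_algHom_mode h d ℓ).choose.toLinearMap
  else 0

section fockAct

variable {ρ σ : HPrime ≃ₗ[ℂ] HPrime}

/-- The vacuum is fixed exactly. Together with `fockAct_X_mul` this characterizes the operator by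
recursion on polynomials, and it removes the scalar ambiguity of a projective action. -/
theorem fockAct_C (h : IsSympPlus ρ) (a : ℂ) :
    fockAct d ℓ ρ (MvPolynomial.C a) = MvPolynomial.C a := by
  rw [fockAct, dif_pos h, LinearMap.comp_apply, AlgHom.toLinearMap_apply,
    ← MvPolynomial.algebraMap_eq, AlgHom.commutes]
  rw [MvPolynomial.algebraMap_eq, Algebra.algebraMap_eq_smul_one, LinearMap.applyₗ_apply_apply,
    LinearMap.smul_apply, Module.End.one_apply, MvPolynomial.smul_eq_C_mul, mul_one]

theorem fockAct_X_mul (h : IsSympPlus ρ) (p : Fin d × ℕ) (v : Fock d) :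
    fockAct d ℓ ρ (MvPolynomial.X p * v) =
      mode ℓ p.1 (ρ (bvec (-(p.2 + 1 : ℤ)))) (fockAct d ℓ ρ v) := by
  rw [fockAct, dif_pos h, LinearMap.comp_apply, AlgHom.toLinearMap_apply, map_mul,
    (exists_algHom_mode h d ℓ).choose_spec]
  rfl

theorem fock_induction {Q : Fock d → Prop} (hC : ∀ a, Q (MvPolynomial.C a))
    (hadd : ∀ v w, Q v → Q w → Q (v + w)) (hX : ∀ p v, Q v → Q (MvPolynomial.X p * v))
    (v : Fock d) : Q v :=
  MvPolynomial.induction_on v hC hadd fun v p hv => by rw [mul_comm]; exact hX p v hv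

theorem mode_polarPart (k : Fin d) (y : HPrime) (v : Fock d) :
    mode ℓ k (polarPart y) v =
      (polar y).sum fun n a => a • (MvPolynomial.X (k, n) * v) := by
  rw [← modeHom_apply, polarPart, LinearMap.comp_apply, Finsupp.linearCombination_apply,
    Finsupp.sum, map_sum, LinearMap.sum_apply]
  refine Finset.sum_congr rfl fun n _ => ?_
  rw [map_smul, LinearMap.smul_apply, modeHom_apply, mode_bvec]

theorem mode_map_polarPart (k : Fin d) (A : HPrime →ₗ[ℂ] HPrime) (y : HPrime) (v : Fock d) :
    mode ℓ k (A (polarPart y)) v =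
      (polar y).sum fun n a => a • mode ℓ k (A (bvec (-(n + 1 : ℤ)))) v := by
  rw [← modeHom_apply, polarPart, LinearMap.comp_apply, Finsupp.linearCombination_apply,
    Finsupp.sum, map_sum, map_sum, LinearMap.sum_apply]
  refine Finset.sum_congr rfl fun n _ => ?_
  rw [map_smul, map_smul, LinearMap.smul_apply, modeHom_apply]

/-- Here preservation of H'_+ is essential: y and ρ y both kill the constants, which starts the
induction. Moving each past a variable, respectively past its transform, produces the same scalar
because ρ is symplectic. -/
theorem fockAct_mode_plus (h : IsSympPlus ρ) (k : Fin d) {y : HPrime} (hy : y ∈ HPlus)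
    (v : Fock d) : fockAct d ℓ ρ (mode ℓ k y v) = mode ℓ k (ρ y) (fockAct d ℓ ρ v) := by
  induction v using fock_induction with
  | hC a => rw [mode_plus_C k hy, map_zero, fockAct_C h, mode_plus_C k (h.map_plus hy)]
  | hadd v w hv hw => simp only [map_add, hv, hw]
  | hX p v hv =>
    rw [fockAct_X_mul h, mode_commutator, ← hv, ← mode_bvec (ℓ := ℓ), mode_commutator,
      map_add, mode_bvec, fockAct_X_mul h, map_smul, h.symplectic]

/-- The polar part of y acts by multiplication by variables, where the intertwining is the defining
recursion; the rest of y lies in H'_+. -/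
theorem fockAct_mode (h : IsSympPlus ρ) (k : Fin d) (y : HPrime) (v : Fock d) :
    fockAct d ℓ ρ (mode ℓ k y v) = mode ℓ k (ρ y) (fockAct d ℓ ρ v) := by
  have e : y = (y - polarPart y) + polarPart y := (sub_add_cancel _ _).symm
  rw [e, mode_add, map_add, fockAct_mode_plus h k (sub_polarPart_mem y), map_add, mode_add]
  congr 1
  rw [mode_polarPart, Finsupp.sum, map_sum]
  refine Eq.trans ?_ (mode_map_polarPart k ρ.toLinearMap y _).symm
  refine Finset.sum_congr rfl fun n _ => ?_
  rw [map_smul, fockAct_X_mul h]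
  rfl

theorem fockAct_heis {Γ : Type*} [AddCommGroup Γ] (H : Module.Basis (Fin d) ℂ (ℂ ⊗[ℤ] Γ))
    (h : IsSympPlus ρ) (A : ℂ ⊗[ℤ] Γ) (y : HPrime) (v : Fock d) :
    fockAct d ℓ ρ (heis H ℓ A y v) = heis H ℓ A (ρ y) (fockAct d ℓ ρ v) := by
  simp only [heis_apply, map_sum, map_smul, fockAct_mode h]

theorem IsSympPlus.mul (hρ : IsSympPlus ρ) (hσ : IsSympPlus σ) : IsSympPlus (ρ * σ) where
  continuous N := by
    obtain ⟨M, hM⟩ := hρ.continuous N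
    obtain ⟨K, hK⟩ := hσ.continuous M
    exact ⟨K, fun f hf => hM _ (hK f hf)⟩
  continuous_symm N := by
    obtain ⟨M, hM⟩ := hσ.continuous_symm N
    obtain ⟨K, hK⟩ := hρ.continuous_symm M
    exact ⟨K, fun f hf => hM _ (hK f hf)⟩
  symplectic f g := by
    rw [LinearEquiv.mul_apply, LinearEquiv.mul_apply, hρ.symplectic, hσ.symplectic]
  plus := by
    conv_rhs => rw [← hρ.plus, ← hσ.plus, ← Submodule.map_comp]
    rfl

/-- Both sides fix constants and obey the same recursion, thanks to the intertwining property of ρ.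
-/
theorem fockAct_mul (hρ : IsSympPlus ρ) (hσ : IsSympPlus σ) (v : Fock d) :
    fockAct d ℓ (ρ * σ) v = fockAct d ℓ ρ (fockAct d ℓ σ v) := by
  induction v using fock_induction with
  | hC a => rw [fockAct_C (hρ.mul hσ), fockAct_C hσ, fockAct_C hρ]
  | hadd v w hv hw => simp only [map_add, hv, hw]
  | hX p v hv =>
    rw [fockAct_X_mul (hρ.mul hσ), fockAct_X_mul hσ, fockAct_mode hρ, hv, LinearEquiv.mul_apply]

theorem isSympPlus_one : IsSympPlus 1 where
  continuous N := ⟨N, fun _ hf => hf⟩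
  continuous_symm N := ⟨N, fun _ hf => hf⟩
  symplectic _ _ := rfl
  plus := Submodule.map_id _

theorem fockAct_one (v : Fock d) : fockAct d ℓ 1 v = v := by
  induction v using fock_induction with
  | hC a => rw [fockAct_C isSympPlus_one]
  | hadd v w hv hw => simp only [map_add, hv, hw]
  | hX p v hv =>
    rw [fockAct_X_mul isSympPlus_one, hv, ← mode_bvec (ℓ := ℓ)]
    rfl

end fockAct

/-! ### The action of the Lie algebra -/

section spAct

variable {S : HPrime →ₗ[ℂ] HPrime}

/-- Only variables occurring in v contribute; a larger finite index set is convenient for comparing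
different polynomials. -/
theorem spAct_eq_sum (S : HPrime →ₗ[ℂ] HPrime) (v : Fock d) {M : Finset (Fin d × ℕ)}
    (hM : v.vars ⊆ M) :
    spAct ℓ S v = ∑ p ∈ M, (linPoly p.1 (S (bvec (-(p.2 + 1 : ℤ)))) * MvPolynomial.pderiv p v +
      (ℓ / 2) • annihilateDer p.1 (S (bvec (-(p.2 + 1 : ℤ)))) (MvPolynomial.pderiv p v)) := by
  rw [spAct, finsum_eq_sum_of_support_subset (s := M)]
  · refine Finset.sum_congr rfl fun p _ => ?_
    rw [LinearMap.add_apply, create_apply]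
    rfl
  · intro p hp
    by_contra h
    apply hp
    beta_reduce
    rw [MvPolynomial.pderiv_eq_zero_of_notMem_vars (fun h' => h (hM h')), map_zero]

theorem spAct_add (S : HPrime →ₗ[ℂ] HPrime) (v w : Fock d) :
    spAct ℓ S (v + w) = spAct ℓ S v + spAct ℓ S w := by
  classical
  rw [spAct_eq_sum S v (M := v.vars ∪ w.vars) Finset.subset_union_left,
    spAct_eq_sum S w (M := v.vars ∪ w.vars) Finset.subset_union_right,
    spAct_eq_sum S (v + w) (MvPolynomial.vars_add_subset _ _), ← Finset.sum_add_distrib]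
  refine Finset.sum_congr rfl fun p _ => ?_
  simp only [map_add, smul_add]
  ring

theorem spAct_smul (S : HPrime →ₗ[ℂ] HPrime) (r : ℂ) (w : Fock d) :
    spAct ℓ S (r • w) = r • spAct ℓ S w := by
  rw [spAct_eq_sum S w (M := w.vars) le_rfl, spAct_eq_sum S (r • w) (M := w.vars) (by
    rw [MvPolynomial.smul_eq_C_mul]
    refine (MvPolynomial.vars_mul _ _).trans ?_
    simp), Finset.smul_sum]
  refine Finset.sum_congr rfl fun q _ => ?_
  simp only [Derivation.map_smul, smul_add, mul_smul_comm, smul_comm r]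

/-- `spAct` as a linear map. -/
def spActHom (d : ℕ) (ℓ : ℂ) (S : HPrime →ₗ[ℂ] HPrime) : Fock d →ₗ[ℂ] Fock d where
  toFun := spAct ℓ S
  map_add' := spAct_add S
  map_smul' := spAct_smul S

theorem spAct_C (S : HPrime →ₗ[ℂ] HPrime) (a : ℂ) :
    spAct ℓ S (MvPolynomial.C a : Fock d) = 0 := by
  rw [spAct_eq_sum S _ (M := ∅) (by simp), Finset.sum_empty]

/-- The infinitesimal form of the recursion for `fockAct`. The annihilation part carries the factor
ℓ/2 in `spAct`, but its contribution arises twice, once from differentiating X_p first and once from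
annihilating it, and the two are equal because S is skew. -/
theorem spAct_X_mul (hS : ∀ f g, symp (S f) g + symp f (S g) = 0) (p : Fin d × ℕ) (v : Fock d) :
    spAct ℓ S (MvPolynomial.X p * v) =
      mode ℓ p.1 (S (bvec (-(p.2 + 1 : ℤ)))) v + MvPolynomial.X p * spAct ℓ S v := by
  classical
  set M : Finset (Fin d × ℕ) := insert p v.vars with hM
  have hpM : p ∈ M := Finset.mem_insert_self _ _
  have hsub : v.vars ⊆ M := Finset.subset_insert _ _
  have hsub' : (MvPolynomial.X p * v).vars ⊆ M := by
    refine (MvPolynomial.vars_mul _ _).trans ?_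
    rw [MvPolynomial.vars_X, hM, Finset.insert_eq]
  -- Skewness of S makes ⟨S b_{-p}, b_{-q}⟩ symmetric in p and q, so this sum equals the
  -- annihilation operator of S b_{-p}.
  have hD : annihilateDer p.1 (S (bvec (-(p.2 + 1 : ℤ)))) v =
      ∑ q ∈ M, annihilateDer q.1 (S (bvec (-(q.2 + 1 : ℤ)))) (MvPolynomial.X p) *
        MvPolynomial.pderiv q v := by
    rw [annihilateDer_eq_sum _ _ _ hsub]
    refine Finset.sum_congr rfl fun q _ => ?_
    congr 1
    rw [annihilateDer_X, annihilateDer_X]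
    by_cases h : q.1 = p.1
    · rw [if_pos h, if_pos h.symm]
      congr 1
      have h1 := hS (bvec (-(p.2 + 1 : ℤ))) (bvec (-(q.2 + 1 : ℤ)))
      rw [symp_antisymm (bvec _) (S _)] at h1
      linear_combination h1
    · rw [if_neg h, if_neg (fun e => h e.symm)]
  have h1 : ∀ q ∈ M, MvPolynomial.pderiv q (MvPolynomial.X p * v) =
      (if q = p then v else 0) + MvPolynomial.X p * MvPolynomial.pderiv q v := by
    intro q _
    rw [Derivation.leibniz, MvPolynomial.pderiv_X, smul_eq_mul, smul_eq_mul, add_comm]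
    congr 1
    by_cases h : q = p
    · subst h; simp
    · rw [Pi.single_eq_of_ne (Ne.symm h), mul_zero, if_neg h]
  rw [spAct_eq_sum S _ hsub', spAct_eq_sum S v hsub, mode_apply, hD]
  rw [Finset.sum_congr rfl fun q hq => by rw [h1 q hq]]
  simp only [mul_add, map_add, Finset.sum_add_distrib, smul_add, Derivation.leibniz]
  rw [Finset.sum_eq_single p (fun q _ hq => by rw [if_neg hq, mul_zero])
    (fun h => absurd hpM h), if_pos rfl]
  rw [Finset.sum_eq_single (f := fun q => (ℓ / 2) • annihilateDer q.1
    (S (bvec (-(q.2 + 1 : ℤ)))) (if q = p then v else 0)) p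
    (fun q _ hq => by rw [if_neg hq, map_zero, smul_zero]) (fun h => absurd hpM h), if_pos rfl,
    hD]
  simp only [MvPolynomial.smul_eq_C_mul, smul_eq_mul, Finset.mul_sum]
  have h2 : (MvPolynomial.C ℓ : Fock d) = MvPolynomial.C (ℓ / 2) + MvPolynomial.C (ℓ / 2) := by
    rw [← MvPolynomial.C_add, add_halves]
  rw [h2]
  simp only [add_mul, Finset.sum_add_distrib]
  have e1 : ∀ q, linPoly q.1 (S (bvec (-(q.2 + 1 : ℤ)))) *
      (MvPolynomial.X p * MvPolynomial.pderiv q v) =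
      MvPolynomial.X p * (linPoly q.1 (S (bvec (-(q.2 + 1 : ℤ)))) * MvPolynomial.pderiv q v) :=
    fun q => by ring
  have e2 : ∀ q, (MvPolynomial.C (ℓ / 2) : Fock d) * (MvPolynomial.X p *
      annihilateDer q.1 (S (bvec (-(q.2 + 1 : ℤ)))) (MvPolynomial.pderiv q v)) =
      MvPolynomial.X p * (MvPolynomial.C (ℓ / 2) *
        annihilateDer q.1 (S (bvec (-(q.2 + 1 : ℤ)))) (MvPolynomial.pderiv q v)) :=
    fun q => by ring
  have e3 : ∀ q, (MvPolynomial.C (ℓ / 2) : Fock d) * (MvPolynomial.pderiv q v *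
      annihilateDer q.1 (S (bvec (-(q.2 + 1 : ℤ)))) (MvPolynomial.X p)) =
      MvPolynomial.C (ℓ / 2) * (annihilateDer q.1 (S (bvec (-(q.2 + 1 : ℤ))))
        (MvPolynomial.X p) * MvPolynomial.pderiv q v) :=
    fun q => by ring
  simp only [e1, e2, e3]
  abel

/-- Infinitesimal analogue of `fockAct_mode_plus`: y and S y both kill constants, and past a
variable the scalars cancel by skewness. -/
theorem spAct_mode_plus (hS : IsSpAlg S) (k : Fin d) {y : HPrime} (hy : y ∈ HPlus)
    (v : Fock d) :
    spAct ℓ S (mode ℓ k y v) = mode ℓ k (S y) v + mode ℓ k y (spAct ℓ S v) := by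
  have hSy : S y ∈ HPlus := hS.plus ⟨y, hy, rfl⟩
  induction v using fock_induction with
  | hC a =>
    rw [mode_plus_C k hy, mode_plus_C k hSy, spAct_C, map_zero, zero_add,
      ← MvPolynomial.C_0, spAct_C, MvPolynomial.C_0]
  | hadd v w hv hw =>
    simp only [map_add, hv, hw, spAct_add]
    abel
  | hX p v hv =>
    rw [spAct_X_mul hS.skew, ← mode_bvec (ℓ := ℓ), ← mode_bvec (ℓ := ℓ), mode_commutator,
      spAct_add, mode_bvec, spAct_X_mul hS.skew, hv, spAct_smul, map_add, mode_commutator k p.1 y,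
      mode_commutator k p.1 y, mode_commutator k p.1 (S y)]
    simp only [mode_bvec]
    have h1 := hS.skew y (bvec (-(p.2 + 1 : ℤ)))
    by_cases h : p.1 = k
    · simp only [if_pos h, mul_add, MvPolynomial.smul_eq_C_mul]
      have h2 : (MvPolynomial.C (ℓ * symp (S y) (bvec (-(p.2 + 1 : ℤ)))) : Fock d) =
          - MvPolynomial.C (ℓ * symp y (S (bvec (-(p.2 + 1 : ℤ))))) := by
        rw [← MvPolynomial.C_neg]
        congr 1
        linear_combination ℓ * h1
      rw [h2]
      ring
    · simp only [if_neg h, zero_smul, mul_add]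
      ring

/-- The relation [S, H^k ⊗ y] = H^k ⊗ S y, obtained by splitting y into its polar part and its part
in H'_+. -/
theorem spAct_mode (hS : IsSpAlg S) (k : Fin d) (y : HPrime) (v : Fock d) :
    spAct ℓ S (mode ℓ k y v) = mode ℓ k (S y) v + mode ℓ k y (spAct ℓ S v) := by
  have h : spActHom d ℓ S (mode ℓ k (polarPart y) v) =
      mode ℓ k (S (polarPart y)) v + mode ℓ k (polarPart y) (spAct ℓ S v) := by
    rw [mode_map_polarPart, mode_polarPart, mode_polarPart, Finsupp.sum, map_sum, Finsupp.sum,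
      Finsupp.sum, ← Finset.sum_add_distrib]
    refine Finset.sum_congr rfl fun n _ => ?_
    rw [map_smul, ← smul_add]
    congr 1
    exact spAct_X_mul hS.skew (k, n) v
  obtain ⟨z, hz, e⟩ : ∃ z ∈ HPlus, y = z + polarPart y :=
    ⟨_, sub_polarPart_mem y, (sub_add_cancel _ _).symm⟩
  generalize polarPart y = w at e h
  subst e
  rw [mode_add, spAct_add, spAct_mode_plus hS k hz, map_add, mode_add, mode_add]
  change _ + spActHom d ℓ S _ = _
  rw [h]
  abel

theorem spAct_heis {Γ : Type*} [AddCommGroup Γ] (H : Module.Basis (Fin d) ℂ (ℂ ⊗[ℤ] Γ))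
    (hS : IsSpAlg S) (A : ℂ ⊗[ℤ] Γ) (y : HPrime) (v : Fock d) :
    spAct ℓ S (heis H ℓ A y v) = heis H ℓ A (S y) v + heis H ℓ A y (spAct ℓ S v) := by
  simp only [heis_apply]
  change spActHom d ℓ S _ = _
  rw [map_sum, ← Finset.sum_add_distrib]
  refine Finset.sum_congr rfl fun k _ => ?_
  rw [map_smul, ← smul_add]
  congr 1
  exact spAct_mode hS k y v

end spAct

variable {d : ℕ} {ℓ : ℂ}

/-! ### Holomorphic functions with values in the Fock space -/

section HolV

variable {ι κ : Type} {s s' : (ι → ℂ) → Fock d} {t : ι → ℂ}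

/-- A holomorphic function with values in the Fock space, i.e. a local section of `V ⊗ 𝒪`. -/
def HolV (s : (ι → ℂ) → Fock d) (t : ι → ℂ) : Prop :=
  (∃ M : Finset (Fin d × ℕ →₀ ℕ), ∀ᶠ u in 𝓝 t, (s u).support ⊆ M) ∧
    ∀ m, HolAt (fun u => MvPolynomial.coeff m (s u)) t

theorem fock_eq_sum {v : Fock d} {M : Finset (Fin d × ℕ →₀ ℕ)} (h : v.support ⊆ M) :
    v = ∑ m ∈ M, MvPolynomial.coeff m v • MvPolynomial.monomial m 1 := by
  conv_lhs => rw [v.as_sum]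
  simp only [MvPolynomial.smul_monomial, smul_eq_mul, mul_one]
  refine Finset.sum_subset h fun m _ hm => ?_
  rw [MvPolynomial.notMem_support_iff.1 hm, MvPolynomial.monomial_zero]

theorem HolV.congr (hs : HolV s t) (h : ∀ᶠ u in 𝓝 t, s u = s' u) : HolV s' t := by
  obtain ⟨⟨M, hM⟩, hs⟩ := hs
  refine ⟨⟨M, ?_⟩, fun m => (hs m).congr (h.mono fun u hu => by rw [hu])⟩
  filter_upwards [hM, h] with u h1 h2
  rwa [← h2]

theorem HolV.const (v : Fock d) (t : ι → ℂ) : HolV (fun _ => v) t :=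
  ⟨⟨v.support, Eventually.of_forall fun _ => le_rfl⟩, fun _ => HolAt.const _ _⟩

theorem HolV.add (hs : HolV s t) (hs' : HolV s' t) : HolV (fun u => s u + s' u) t := by
  classical
  obtain ⟨⟨M, hM⟩, hs⟩ := hs
  obtain ⟨⟨M', hM'⟩, hs'⟩ := hs'
  refine ⟨⟨M ∪ M', ?_⟩, fun m => by simpa using (hs m).add (hs' m)⟩
  filter_upwards [hM, hM'] with u h1 h2
  exact MvPolynomial.support_add.trans (Finset.union_subset_union h1 h2)

theorem HolV.smul {a : (ι → ℂ) → ℂ} (ha : HolAt a t) (hs : HolV s t) :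
    HolV (fun u => a u • s u) t := by
  obtain ⟨⟨M, hM⟩, hs⟩ := hs
  exact ⟨⟨M, hM.mono fun u hu => MvPolynomial.support_smul.trans hu⟩,
    fun m => by simpa using ha.mul (hs m)⟩

theorem HolV.sub (hs : HolV s t) (hs' : HolV s' t) : HolV (fun u => s u - s' u) t := by
  have := hs.add (HolV.smul (HolAt.const (-1) t) hs')
  simpa [sub_eq_add_neg] using this

theorem HolV.sum {α : Type*} {A : Finset α} {F : α → (ι → ℂ) → Fock d}
    (h : ∀ i ∈ A, HolV (F i) t) : HolV (fun u => ∑ i ∈ A, F i u) t := by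
  classical
  induction A using Finset.induction_on with
  | empty => simpa using HolV.const 0 t
  | insert a A ha ih =>
    simp only [Finset.sum_insert ha]
    exact (h a (Finset.mem_insert_self a A)).add
      (ih fun i hi => h i (Finset.mem_insert_of_mem hi))

/-- Locally s is a combination of a fixed finite set of monomials with holomorphic coefficients, so
testing L on constant vectors suffices. -/
theorem HolV.apply {L : (ι → ℂ) → Fock d →ₗ[ℂ] Fock d} (hL : ∀ v, HolV (fun u => L u v) t)
    (hs : HolV s t) : HolV (fun u => L u (s u)) t := by
  obtain ⟨⟨M, hM⟩, hs⟩ := hs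
  refine HolV.congr (HolV.sum (A := M) fun m _ =>
    HolV.smul (hs m) (hL (MvPolynomial.monomial m 1))) ?_
  filter_upwards [hM] with u hu
  conv_rhs => rw [fock_eq_sum hu, map_sum]
  simp only [map_smul]

theorem HolV.comp {s : (κ → ℂ) → Fock d} {q : (ι → ℂ) → κ → ℂ} (hs : HolV s (q t))
    (hq : ∀ i, HolAt (fun u => q u i) t) : HolV (fun u => s (q u)) t := by
  obtain ⟨⟨M, hM⟩, hs⟩ := hs
  exact ⟨⟨M, (tendsto_of_holAt hq).eventually hM⟩, fun m => HolAt.comp (hs m) hq⟩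

theorem linPoly_eq_sum {N : ℕ} {y : HPrime} (hy : y ∈ hfil (-(N : ℤ))) (k : Fin d) :
    linPoly k y = ∑ n ∈ Finset.range N, hcoeff (-(n + 1 : ℤ)) y • MvPolynomial.X (k, n) := by
  rw [linPoly, linearCombination_polar_eq_sum hy]

theorem annihilateDer_eq_sum_smul (k : Fin d) (y : HPrime) (v : Fock d) :
    annihilateDer k y v = ∑ q ∈ v.vars,
      (if q.1 = k then symp y (bvec (-(q.2 + 1 : ℤ))) else 0) • MvPolynomial.pderiv q v := by
  rw [annihilateDer_eq_sum k y v le_rfl]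
  refine Finset.sum_congr rfl fun q _ => ?_
  rw [annihilateDer_X]
  split_ifs
  · rw [MvPolynomial.smul_eq_C_mul]
  · simp

theorem HolHAt.mode {y : (ι → ℂ) → HPrime} (hy : HolHAt y t) (k : Fin d) (hs : HolV s t) :
    HolV (fun u => mode ℓ k (y u) (s u)) t := by
  refine HolV.apply (fun v => ?_) hs
  simp only [mode_apply, annihilateDer_eq_sum_smul]
  refine HolV.add ?_ (HolV.smul (HolAt.const _ _) (HolV.sum fun q _ =>
    HolV.smul ?_ (HolV.const _ _)))
  · obtain ⟨N, hN⟩ := hy.exists_nat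
    refine HolV.congr (HolV.sum (A := Finset.range N) fun n _ =>
      HolV.smul (hy.1 (-(n + 1 : ℤ))) (HolV.const (MvPolynomial.X (k, n) * v) t)) ?_
    filter_upwards [hN] with u hu
    rw [linPoly_eq_sum hu, Finset.sum_mul]
    simp only [smul_mul_assoc]
  · split_ifs
    · exact hy.symp (HolHAt.const _ _)
    · exact HolAt.const _ _

/-! ### Holomorphic families of automorphisms -/

/-- A holomorphic family of symplectic automorphisms preserving `H'_+`, near a point. -/
structure GroupAt (ρ : (ι → ℂ) → (HPrime ≃ₗ[ℂ] HPrime)) (t : ι → ℂ) : Prop where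
  symplectic : ∀ᶠ u in 𝓝 t, IsSympPlus (ρ u)
  hol : ∀ f, HolHAt (fun u => ρ u f) t
  hol_symm : ∀ f, HolHAt (fun u => (ρ u).symm f) t

theorem GroupAt.symm {ρ : (ι → ℂ) → (HPrime ≃ₗ[ℂ] HPrime)} (h : GroupAt ρ t) :
    GroupAt (fun u => (ρ u).symm) t :=
  ⟨h.symplectic.mono fun _ hu => hu.symm, h.hol_symm, h.hol⟩

theorem GroupAt.isOpFamily {ρ : (ι → ℂ) → (HPrime ≃ₗ[ℂ] HPrime)} (h : GroupAt ρ t) :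
    IsOpFamily (fun u => (ρ u).toLinearMap) (fun u => (ρ u).symm.toLinearMap) t :=
  ⟨h.symplectic.mono fun _ hu => hu.adjoint, h.symplectic.mono fun _ hu _ hf => hu.map_plus hf,
    h.hol, h.hol_symm⟩

theorem GroupAt.apply {ρ : (ι → ℂ) → (HPrime ≃ₗ[ℂ] HPrime)} (h : GroupAt ρ t)
    {y : (ι → ℂ) → HPrime} (hy : HolHAt y t) : HolHAt (fun u => ρ u (y u)) t :=
  h.isOpFamily.apply hy

theorem GroupAt.mul {ρ σ : (ι → ℂ) → (HPrime ≃ₗ[ℂ] HPrime)} (hρ : GroupAt ρ t)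
    (hσ : GroupAt σ t) : GroupAt (fun u => ρ u * σ u) t := by
  refine ⟨?_, fun f => hρ.apply (hσ.hol f), fun f => hσ.symm.apply (hρ.hol_symm f)⟩
  filter_upwards [hρ.symplectic, hσ.symplectic] with u h1 h2 using h1.mul h2

theorem GroupAt.comp {ρ : (κ → ℂ) → (HPrime ≃ₗ[ℂ] HPrime)} {q : (ι → ℂ) → κ → ℂ}
    (h : GroupAt ρ (q t)) (hq : ∀ i, HolAt (fun u => q u i) t) :
    GroupAt (fun u => ρ (q u)) t :=
  ⟨(tendsto_of_holAt hq).eventually h.symplectic, fun f => HolHAt.comp (h.hol f) hq,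
    fun f => HolHAt.comp (h.hol_symm f) hq⟩

theorem SpPlus.isSympPlus {ρ : HPrime ≃ₗ[ℂ] HPrime} (h : ρ ∈ SpPlus) : IsSympPlus ρ := by
  obtain ⟨γ, -, h1, h2, -⟩ := h
  rw [← h1]
  exact h2 1 (by simp)

theorem IsGroupFamily.groupAt {T : Set (ι → ℂ)} {ρ : (ι → ℂ) → (HPrime ≃ₗ[ℂ] HPrime)}
    (hT : IsOpen T) (h : IsGroupFamily T ρ) (ht : t ∈ T) : GroupAt ρ t :=
  ⟨Filter.mem_of_superset (hT.mem_nhds ht) fun u hu => SpPlus.isSympPlus (h u hu).1,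
    fun f => ((h t ht).2 f).1, fun f => ((h t ht).2 f).2⟩

theorem GroupAt.fockAct {ρ : (ι → ℂ) → (HPrime ≃ₗ[ℂ] HPrime)} (h : GroupAt ρ t)
    (hs : HolV s t) : HolV (fun u => fockAct d ℓ (ρ u) (s u)) t := by
  refine HolV.apply (fun v => ?_) hs
  induction v using fock_induction with
  | hC a =>
    refine (HolV.const (MvPolynomial.C a) t).congr ?_
    filter_upwards [h.symplectic] with u hu
    rw [fockAct_C hu]
  | hadd v w hv hw => simpa only [map_add] using hv.add hw
  | hX p v hv =>
    refine HolV.congr (HolHAt.mode (ℓ := ℓ) (h.hol (bvec (-(p.2 + 1 : ℤ)))) p.1 hv) ?_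
    filter_upwards [h.symplectic] with u hu
    rw [fockAct_X_mul hu]

/-! ### Germs of sections -/

theorem coe_eq_coe {α : Type*} {f g : (ι → ℂ) → α} :
    (f : Germ (𝓝 t) α) = g ↔ ∀ᶠ u in 𝓝 t, f u = g u := Germ.coe_eq

theorem smul_germ {a : (ι → ℂ) → ℂ} (ha : HolAt a t) (s : (ι → ℂ) → Fock d) :
    ((⟨(a : Germ (𝓝 t) ℂ), a, ha, rfl⟩ : holGerms t) • (s : Germ (𝓝 t) (Fock d))) =
      ((fun u => a u • s u : (ι → ℂ) → Fock d) : Germ (𝓝 t) (Fock d)) := rfl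

/-- Replaces the span of constant germs by a concrete condition: locally bounded support and
holomorphic coefficients. All later arguments work with functions through this equivalence. -/
theorem mem_secGerms : (s : Germ (𝓝 t) (Fock d)) ∈ secGerms d t ↔ HolV s t := by
  constructor
  · intro h
    have key : ∀ φ ∈ secGerms d t, ∃ s : (ι → ℂ) → Fock d,
        HolV s t ∧ (s : Germ (𝓝 t) (Fock d)) = φ := by
      intro φ hφ
      induction hφ using Submodule.span_induction with
      | mem φ h =>
        obtain ⟨v, rfl⟩ := h
        exact ⟨_, HolV.const v t, rfl⟩
      | zero => exact ⟨_, HolV.const 0 t, rfl⟩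
      | add φ ψ _ _ h1 h2 =>
        obtain ⟨s, hs, rfl⟩ := h1
        obtain ⟨s', hs', rfl⟩ := h2
        exact ⟨_, hs.add hs', rfl⟩
      | smul a φ _ h1 =>
        obtain ⟨s, hs, rfl⟩ := h1
        obtain ⟨_, f, hf, rfl⟩ := a
        exact ⟨_, HolV.smul hf hs, rfl⟩
    obtain ⟨s', hs', e⟩ := key _ h
    exact hs'.congr (coe_eq_coe.1 e)
  · rintro ⟨⟨M, hM⟩, hs⟩
    have e : (s : Germ (𝓝 t) (Fock d)) = ∑ m ∈ M,
        (⟨((fun u => MvPolynomial.coeff m (s u) : (ι → ℂ) → ℂ) : Germ (𝓝 t) ℂ), _, hs m, rfl⟩ :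
          holGerms t) • ((fun _ => MvPolynomial.monomial m 1 : (ι → ℂ) → Fock d) :
            Germ (𝓝 t) (Fock d)) := by
      simp only [smul_germ (hs _)]
      have h2 : ∀ A : Finset (Fin d × ℕ →₀ ℕ), (∑ m ∈ A, ((fun u => MvPolynomial.coeff m (s u) •
          MvPolynomial.monomial m 1 : (ι → ℂ) → Fock d) : Germ (𝓝 t) (Fock d))) =
          ((fun u => ∑ m ∈ A, MvPolynomial.coeff m (s u) •
          MvPolynomial.monomial m 1 : (ι → ℂ) → Fock d) : Germ (𝓝 t) (Fock d)) := by
        classical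
        intro A
        induction A using Finset.induction_on with
        | empty => simp; rfl
        | insert a A ha ih =>
          simp only [Finset.sum_insert ha, ih]
          rfl
      rw [h2, coe_eq_coe]
      exact hM.mono fun u hu => fock_eq_sum hu
    rw [e]
    exact Submodule.sum_mem _ fun m _ => Submodule.smul_mem _ _ (Submodule.subset_span ⟨_, rfl⟩)

end HolV

/-! ### Derivatives along curves -/

/-- `y` has derivative `y'` at `0`, as a function with values in `H'`. -/
def HasDerivH (y : ℂ → HPrime) (y' : HPrime) : Prop :=
  (∃ N : ℕ, ∀ᶠ ε in 𝓝 0, y ε ∈ hfil (-(N : ℤ))) ∧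
    ∀ n, HasDerivAt (fun ε => hcoeff n (y ε)) (hcoeff n y') 0

/-- `w` has derivative `w'` at `0` and takes values in a finite-dimensional subspace. -/
def HasDerivF (w : ℂ → Fock d) (w' : Fock d) : Prop :=
  (∃ M : Finset (Fin d × ℕ →₀ ℕ), ∀ᶠ ε in 𝓝 0, (w ε).support ⊆ M) ∧
    ∀ m, HasDerivAt (fun ε => MvPolynomial.coeff m (w ε)) (MvPolynomial.coeff m w') 0

section HasDerivH

variable {y z : ℂ → HPrime} {y' z' : HPrime}

theorem hasDerivAt_eq_zero_of_eventually {f : ℂ → ℂ} {f' : ℂ} (h : HasDerivAt f f' 0)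
    (h0 : ∀ᶠ ε in 𝓝 0, f ε = 0) : f' = 0 :=
  h.unique ((hasDerivAt_const (0 : ℂ) (0 : ℂ)).congr_of_eventuallyEq h0)

theorem HasDerivH.const (y : HPrime) : HasDerivH (fun _ => y) 0 := by
  obtain ⟨N, hN⟩ := exists_mem_hfil y
  exact ⟨⟨N, Eventually.of_forall fun _ => hN⟩, fun n => by
    simpa using hasDerivAt_const (0 : ℂ) (hcoeff n y)⟩

theorem HasDerivH.mem_hfil {N : ℕ} (hy : HasDerivH y y')
    (h : ∀ᶠ ε in 𝓝 0, y ε ∈ hfil (-(N : ℤ))) : y' ∈ hfil (-(N : ℤ)) :=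
  HeisCoinv.mem_hfil.2 fun n hn => hasDerivAt_eq_zero_of_eventually (hy.2 n)
    (h.mono fun _ hε => HeisCoinv.mem_hfil.1 hε n hn)

theorem HasDerivH.exists_common (hy : HasDerivH y y') (hz : HasDerivH z z') :
    ∃ N : ℕ, ∀ᶠ ε in 𝓝 0, y ε ∈ hfil (-(N : ℤ)) ∧ z ε ∈ hfil (-(N : ℤ)) := by
  obtain ⟨M, hM⟩ := hy.1
  obtain ⟨N, hN⟩ := hz.1
  refine ⟨max M N, ?_⟩
  filter_upwards [hM, hN] with u h1 h2
  exact ⟨hfil_anti (by simp) h1, hfil_anti (by simp) h2⟩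

theorem HasDerivH.symp (hy : HasDerivH y y') (hz : HasDerivH z z') :
    HasDerivAt (fun ε => symp (y ε) (z ε)) (symp y' (z 0) + symp (y 0) z') 0 := by
  obtain ⟨N, hN⟩ := hy.exists_common hz
  have h1 := hy.mem_hfil (hN.mono fun _ h => h.1)
  have h2 := hz.mem_hfil (hN.mono fun _ h => h.2)
  have h0 := hN.self_of_nhds
  rw [symp_eq_sum h1 h0.2, symp_eq_sum h0.1 h2, ← Finset.sum_add_distrib]
  refine HasDerivAt.congr_of_eventuallyEq (f := fun ε => ∑ k ∈ Finset.Icc (-(N : ℤ)) N,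
    (k : ℂ) * hcoeff k (y ε) * hcoeff (-k) (z ε)) ?_
    (hN.mono fun ε hε => symp_eq_sum hε.1 hε.2)
  refine HasDerivAt.fun_sum fun k _ => ?_
  have := ((hy.2 k).const_mul (k : ℂ)).mul (hz.2 (-k))
  exact this

theorem HasDerivH.linearCombination (hy : HasDerivH y y') (v : ℕ → HPrime) :
    HasDerivH (fun ε => Finsupp.linearCombination ℂ v (polar (y ε)))
      (Finsupp.linearCombination ℂ v (polar y')) := by
  obtain ⟨N, hN⟩ := hy.1
  have h1 := hy.mem_hfil hN
  obtain ⟨K, hK⟩ : ∃ K : ℕ, ∀ n ∈ Finset.range N, v n ∈ hfil (-(K : ℤ)) := by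
    choose K hK using fun n => exists_mem_hfil (v n)
    refine ⟨(Finset.range N).sup K, fun n hn => hfil_anti ?_ (hK n)⟩
    have := Finset.le_sup (f := K) hn
    omega
  refine ⟨⟨K, ?_⟩, fun n => ?_⟩
  · filter_upwards [hN] with ε hε
    rw [linearCombination_polar_eq_sum hε]
    exact Submodule.sum_mem _ fun n hn => Submodule.smul_mem _ _ (hK n hn)
  · rw [linearCombination_polar_eq_sum h1, map_sum]
    refine HasDerivAt.congr_of_eventuallyEq (f := fun ε => ∑ k ∈ Finset.range N,
      hcoeff n (hcoeff (-(k + 1 : ℤ)) (y ε) • v k)) ?_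
      (hN.mono fun ε hε => by
        beta_reduce
        rw [linearCombination_polar_eq_sum hε, map_sum])
    refine HasDerivAt.fun_sum fun k _ => ?_
    simp only [map_smul, smul_eq_mul]
    exact (hy.2 _).mul_const _

end HasDerivH

section HasDerivF

variable {w x : ℂ → Fock d} {w' x' : Fock d}

theorem HasDerivF.congr (hw : HasDerivF w w') (h : ∀ᶠ ε in 𝓝 0, w ε = x ε) :
    HasDerivF x w' := by
  obtain ⟨⟨M, hM⟩, hw⟩ := hw
  refine ⟨⟨M, ?_⟩, fun m => (hw m).congr_of_eventuallyEq (h.mono fun ε hε => by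
    beta_reduce; rw [hε])⟩
  filter_upwards [hM, h] with u h1 h2
  rwa [← h2]

theorem HasDerivF.const (v : Fock d) : HasDerivF (fun _ => v) 0 :=
  ⟨⟨v.support, Eventually.of_forall fun _ => le_rfl⟩, fun m => by
    simpa using hasDerivAt_const (0 : ℂ) (MvPolynomial.coeff m v)⟩

theorem HasDerivF.add (hw : HasDerivF w w') (hx : HasDerivF x x') :
    HasDerivF (fun ε => w ε + x ε) (w' + x') := by
  classical
  obtain ⟨⟨M, hM⟩, hw⟩ := hw
  obtain ⟨⟨M', hM'⟩, hx⟩ := hx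
  refine ⟨⟨M ∪ M', ?_⟩, fun m => by simpa using (hw m).fun_add (hx m)⟩
  filter_upwards [hM, hM'] with u h1 h2
  exact MvPolynomial.support_add.trans (Finset.union_subset_union h1 h2)

theorem HasDerivF.smul {a : ℂ → ℂ} {a' : ℂ} (ha : HasDerivAt a a' 0) (hw : HasDerivF w w') :
    HasDerivF (fun ε => a ε • w ε) (a' • w 0 + a 0 • w') := by
  obtain ⟨⟨M, hM⟩, hw⟩ := hw
  exact ⟨⟨M, hM.mono fun u hu => MvPolynomial.support_smul.trans hu⟩,
    fun m => by simpa using ha.fun_mul (hw m)⟩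

theorem HasDerivF.sum {α : Type*} {A : Finset α} {F : α → ℂ → Fock d} {F' : α → Fock d}
    (h : ∀ i ∈ A, HasDerivF (F i) (F' i)) :
    HasDerivF (fun ε => ∑ i ∈ A, F i ε) (∑ i ∈ A, F' i) := by
  classical
  induction A using Finset.induction_on with
  | empty => simpa using HasDerivF.const 0
  | insert a A ha ih =>
    simp only [Finset.sum_insert ha]
    exact (h a (Finset.mem_insert_self a A)).add
      (ih fun i hi => h i (Finset.mem_insert_of_mem hi))

theorem HasDerivF.support_subset (hw : HasDerivF w w') {M : Finset (Fin d × ℕ →₀ ℕ)}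
    (hM : ∀ᶠ ε in 𝓝 0, (w ε).support ⊆ M) : w'.support ⊆ M := by
  intro m hm
  by_contra h
  refine MvPolynomial.mem_support_iff.1 hm
    (hasDerivAt_eq_zero_of_eventually (hw.2 m) (hM.mono fun ε hε => ?_))
  exact MvPolynomial.notMem_support_iff.1 fun h' => h (hε h')

/-- An arbitrary linear form on V is seen only through its values on finitely many monomials, so
coefficientwise derivatives suffice. -/
theorem HasDerivF.hasDerivV (hw : HasDerivF w w') : HasDerivV w w' := by
  intro l
  obtain ⟨M, hM⟩ := hw.1
  rw [fock_eq_sum (hw.support_subset hM), map_sum]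
  refine HasDerivAt.congr_of_eventuallyEq (f := fun ε => ∑ m ∈ M,
    l (MvPolynomial.coeff m (w ε) • MvPolynomial.monomial m 1)) ?_
    (hM.mono fun ε hε => by
      beta_reduce
      conv_lhs => rw [fock_eq_sum hε, map_sum])
  refine HasDerivAt.fun_sum fun m _ => ?_
  simp only [map_smul, smul_eq_mul]
  exact (hw.2 m).mul_const _

theorem HasDerivV.unique (h1 : HasDerivV w w') (h2 : HasDerivV w x') : w' = x' := by
  ext m
  exact (h1 (MvPolynomial.lcoeff ℂ m)).unique (h2 (MvPolynomial.lcoeff ℂ m))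

/-- The product rule for a varying operator on a varying vector, reduced to constant vectors by the
bounded support of w. -/
theorem HasDerivF.apply {L : ℂ → Fock d →ₗ[ℂ] Fock d} {L' : Fock d →ₗ[ℂ] Fock d}
    (hL : ∀ v, HasDerivF (fun ε => L ε v) (L' v)) (hw : HasDerivF w w') :
    HasDerivF (fun ε => L ε (w ε)) (L' (w 0) + L 0 w') := by
  obtain ⟨M, hM⟩ := hw.1
  have e1 := fock_eq_sum (hw.support_subset hM)
  have e2 := fock_eq_sum hM.self_of_nhds
  have e : L' (w 0) + L 0 w' = ∑ m ∈ M, (MvPolynomial.coeff m w' • L 0 (MvPolynomial.monomial m 1)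
      + MvPolynomial.coeff m (w 0) • L' (MvPolynomial.monomial m 1)) := by
    conv_lhs => rw [e1, e2]
    simp only [map_sum, map_smul, Finset.sum_add_distrib]
    rw [add_comm]
  rw [e]
  have h := HasDerivF.sum (A := M)
    (F := fun m ε => MvPolynomial.coeff m (w ε) • L ε (MvPolynomial.monomial m 1))
    (fun m _ => HasDerivF.smul (hw.2 m) (hL (MvPolynomial.monomial m 1)))
  refine h.congr ?_
  filter_upwards [hM] with ε hε
  conv_rhs => rw [fock_eq_sum hε, map_sum]
  simp only [map_smul]

theorem HasDerivH.mode_const {y : ℂ → HPrime} {y' : HPrime} (hy : HasDerivH y y') (k : Fin d)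
    (v : Fock d) : HasDerivF (fun ε => mode ℓ k (y ε) v) (mode ℓ k y' v) := by
  obtain ⟨N, hN⟩ := hy.1
  simp only [mode_apply, annihilateDer_eq_sum_smul]
  refine HasDerivF.add ?_ ?_
  · have e : linPoly k y' * v = ∑ n ∈ Finset.range N,
        (hcoeff (-(n + 1 : ℤ)) y' • (MvPolynomial.X (k, n) * v) +
          hcoeff (-(n + 1 : ℤ)) (y 0) • 0) := by
      rw [linPoly_eq_sum (hy.mem_hfil hN), Finset.sum_mul]
      simp only [smul_mul_assoc, smul_zero, add_zero]
    rw [e]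
    have h := HasDerivF.sum (A := Finset.range N)
      (F := fun n ε => hcoeff (-(n + 1 : ℤ)) (y ε) • (MvPolynomial.X (k, n) * v))
      (fun n _ => HasDerivF.smul (hy.2 (-(n + 1 : ℤ)))
        (HasDerivF.const (MvPolynomial.X (k, n) * v)))
    refine h.congr ?_
    filter_upwards [hN] with u hu
    rw [linPoly_eq_sum hu, Finset.sum_mul]
    simp only [smul_mul_assoc]
  · have h := HasDerivF.smul (hasDerivAt_const (0 : ℂ) ℓ) (HasDerivF.sum (A := v.vars)
      (F := fun q ε => (if q.1 = k then HeisCoinv.symp (y ε) (bvec (-(q.2 + 1 : ℤ))) else 0) •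
        MvPolynomial.pderiv q v)
      (F' := fun q => (if q.1 = k then HeisCoinv.symp y' (bvec (-(q.2 + 1 : ℤ))) else 0) •
        MvPolynomial.pderiv q v) fun q _ => by
        split_ifs
        · have := HasDerivF.smul (hy.symp (HasDerivH.const (bvec (-(q.2 + 1 : ℤ)))))
            (HasDerivF.const (MvPolynomial.pderiv q v))
          simpa using this
        · simpa using HasDerivF.const (d := d) 0)
    simpa using h

theorem HasDerivH.mode {y : ℂ → HPrime} {y' : HPrime} (hy : HasDerivH y y') (k : Fin d)
    (hw : HasDerivF w w') :
    HasDerivF (fun ε => mode ℓ k (y ε) (w ε)) (mode ℓ k y' (w 0) + mode ℓ k (y 0) w') :=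
  HasDerivF.apply (hy.mode_const k) hw

theorem HasDerivH.heis {Γ : Type*} [AddCommGroup Γ] (H : Module.Basis (Fin d) ℂ (ℂ ⊗[ℤ] Γ))
    (A : ℂ ⊗[ℤ] Γ) {y : ℂ → HPrime} {y' : HPrime} (hy : HasDerivH y y') (hw : HasDerivF w w') :
    HasDerivF (fun ε => heis H ℓ A (y ε) (w ε)) (heis H ℓ A y' (w 0) + heis H ℓ A (y 0) w') := by
  simp only [heis_apply, ← Finset.sum_add_distrib, ← smul_add]
  refine HasDerivF.sum fun k _ => ?_
  simpa using HasDerivF.smul (hasDerivAt_const (0 : ℂ) (H.repr A k)) (hy.mode k hw)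

/-- Differentiating the recursion for `fockAct` at the identity gives the recursion for `spAct`, and
both derivatives vanish on constants. -/
theorem hasDerivF_fockAct {η : ℂ → (HPrime ≃ₗ[ℂ] HPrime)} {S : HPrime →ₗ[ℂ] HPrime}
    (hS : ∀ f g, symp (S f) g + symp f (S g) = 0) (h1 : η 0 = 1)
    (hη : ∀ᶠ ε in 𝓝 0, IsSympPlus (η ε)) (h : ∀ f, HasDerivH (fun ε => η ε f) (S f))
    (hw : HasDerivF w w') :
    HasDerivF (fun ε => fockAct d ℓ (η ε) (w ε)) (spAct ℓ S (w 0) + w') := by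
  have key := HasDerivF.apply (L := fun ε => fockAct d ℓ (η ε)) (L' := spActHom d ℓ S)
    (fun v => ?_) hw
  · beta_reduce at key
    rwa [h1, fockAct_one] at key
  · change HasDerivF _ (spAct ℓ S v)
    induction v using fock_induction with
    | hC a =>
      rw [spAct_C]
      refine (HasDerivF.const (MvPolynomial.C a)).congr ?_
      filter_upwards [hη] with ε hε
      rw [fockAct_C hε]
    | hadd v w hv hw =>
      simpa only [map_add, spAct_add] using hv.add hw
    | hX p v hv =>
      have := HasDerivH.mode (ℓ := ℓ) (h (bvec (-(p.2 + 1 : ℤ)))) p.1 hv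
      rw [spAct_X_mul hS]
      simp only [h1, fockAct_one] at this
      rw [LinearEquiv.coe_one, id, mode_bvec] at this
      refine this.congr ?_
      filter_upwards [hη] with ε hε
      rw [fockAct_X_mul hε]

end HasDerivF

section Deriv

variable {ι : Type} {t : ι → ℂ} {δ : (ι → ℂ) → ι → ℂ}

theorem HolV.exists_deriv {s : (ι → ℂ) → Fock d} (hs : HolV s t)
    (hδ : ∀ i, HolAt (fun u => δ u i) t) :
    ∃ s' : (ι → ℂ) → Fock d, HolV s' t ∧
      ∀ᶠ u in 𝓝 t, ∀ γ, CurveAt γ u (δ u) → HasDerivF (fun ε => s (γ ε)) (s' u) := by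
  obtain ⟨⟨M, hM⟩, hs⟩ := hs
  choose f' hf' hd using fun m => (hs m).exists_deriv hδ
  refine ⟨fun u => ∑ m ∈ M, f' m u • MvPolynomial.monomial m 1,
    HolV.sum fun m _ => HolV.smul (hf' m) (HolV.const _ _), ?_⟩
  have h := (M.eventually_all).2 fun m _ => hd m
  filter_upwards [h, hM.eventually_nhds] with u h1 h2 γ hγ
  refine HasDerivF.congr (HasDerivF.sum (A := M)
    (F := fun m ε => MvPolynomial.coeff m (s (γ ε)) • MvPolynomial.monomial m 1)
    fun m hm => by
      simpa using HasDerivF.smul (h1 m hm γ hγ) (HasDerivF.const (MvPolynomial.monomial m 1))) ?_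
  filter_upwards [hγ.tendsto.eventually h2] with ε hε
  exact (fock_eq_sum hε).symm

/-- The neighbourhoods on which individual coefficients are differentiable may shrink with the
index. The derivative is therefore constructed pointwise, which is why f is assumed holomorphic at
all nearby points, and its holomorphy at t is checked one coefficient at a time. -/
theorem HolHAt.exists_deriv {f : (ι → ℂ) → HPrime} (hf : ∀ᶠ u in 𝓝 t, HolHAt f u)
    (hδ : ∀ i, HolAt (fun u => δ u i) t) :
    ∃ f' : (ι → ℂ) → HPrime, HolHAt f' t ∧
      ∀ᶠ u in 𝓝 t, ∀ γ, CurveAt γ u (δ u) → HasDerivH (fun ε => f (γ ε)) (f' u) := by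
  obtain ⟨N, hN⟩ := hf.self_of_nhds.exists_nat
  have hN' := hN.eventually_nhds
  have hd : ∀ u n, ∃ a : ℂ, HolHAt f u → ∀ γ, CurveAt γ u (δ u) →
      HasDerivAt (fun ε => hcoeff n (f (γ ε))) a 0 := by
    intro u n
    by_cases h : HolHAt f u
    -- Freezing the velocity at its value δ u avoids needing holomorphy of δ at u.
    · obtain ⟨f', -, h2⟩ := (h.1 n).exists_deriv (δ := fun _ => δ u) fun i => HolAt.const _ _
      exact ⟨f' u, fun _ => h2.self_of_nhds⟩
    · exact ⟨0, fun h' => absurd h' h⟩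
  choose a ha using hd
  -- Truncation loses nothing: the coefficients at 0 and below -N vanish identically near u, hence
  -- so do their derivatives.
  have hcoef : ∀ u, HolHAt f u → (∀ᶠ v in 𝓝 u, f v ∈ hfil (-(N : ℤ))) →
      ∀ n, hcoeff n (ofCoeffs N (a u)) = a u n := by
    intro u h1 h2 n
    rw [hcoeff_ofCoeffs]
    have h3 := ha u n h1 _ (CurveAt.line u (δ u))
    split_ifs with h4 h5
    · subst h4
      exact (hasDerivAt_eq_zero_of_eventually h3 (by simp)).symm
    · rfl
    · refine (hasDerivAt_eq_zero_of_eventually h3 ?_).symm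
      filter_upwards [(CurveAt.line u (δ u)).tendsto.eventually h2] with ε hε
      exact mem_hfil.1 hε n (by omega)
  refine ⟨fun u => ofCoeffs N (a u), ⟨fun n => ?_, -(N : ℤ), Eventually.of_forall fun u => ?_⟩, ?_⟩
  · obtain ⟨f', h1, h2⟩ := (hf.self_of_nhds.1 n).exists_deriv hδ
    refine h1.congr ?_
    filter_upwards [h2, hf, hN'] with u h3 h4 h5
    rw [hcoef u h4 h5]
    exact (h3 _ (CurveAt.line u (δ u))).unique (ha u n h4 _ (CurveAt.line u (δ u)))
  · refine mem_hfil.2 fun n hn => ?_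
    rw [hcoeff_ofCoeffs, if_neg (by omega), if_neg (by omega)]
  · filter_upwards [hf, hN'] with u h1 h2 γ hγ
    exact ⟨⟨N, hγ.tendsto.eventually h2⟩, fun n => by
      rw [hcoef u h1 h2]; exact ha u n h1 γ hγ⟩

end Deriv

/-! ### The parametrization of extended abelian varieties -/

section Chart

variable {g : ℕ} (c : ChartIdx g → ℂ)

theorem polar_graphVec (n : ℕ) : polar (graphVec c n) = Finsupp.single n 1 := by
  rw [graphVec, map_add, polar_bvec, polar_plus (hplus_mem _), add_zero]

/-- The element of the graph of `φ` with the same polar part as `y`. -/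
def graphLift : HPrime →ₗ[ℂ] HPrime := Finsupp.linearCombination ℂ (graphVec c) ∘ₗ polar

theorem graphLift_apply (y : HPrime) :
    graphLift c y = Finsupp.linearCombination ℂ (graphVec c) (polar y) := rfl

theorem polar_graphLift (y : HPrime) : polar (graphLift c y) = polar y :=
  polar_linearCombination (polar_graphVec c) _

theorem sub_graphLift_mem (y : HPrime) : y - graphLift c y ∈ HPlus := by
  rw [mem_plus_iff_polar, map_sub, polar_graphLift, sub_self]

theorem graphLift_mem (y : HPrime) : graphLift c y ∈ chartZ c :=
  Finsupp.mem_span_range_iff_exists_finsupp.2 ⟨polar y, rfl⟩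

theorem graphVec_mem (n : ℕ) : graphVec c n ∈ chartZ c := Submodule.subset_span ⟨n, rfl⟩

theorem graphLift_bvec (n : ℕ) : graphLift c (bvec (-(n + 1 : ℤ))) = graphVec c n := by
  rw [graphLift_apply, polar_bvec, Finsupp.linearCombination_single, one_smul]

theorem graphLift_plus {y : HPrime} (hy : y ∈ HPlus) : graphLift c y = 0 := by
  rw [graphLift_apply, polar_plus hy, map_zero]

variable {c}

theorem graphLift_of_mem {z : HPrime} (hz : z ∈ chartZ c) : graphLift c z = z := by
  obtain ⟨a, rfl⟩ := Finsupp.mem_span_range_iff_exists_finsupp.1 hz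
  change graphLift c (Finsupp.linearCombination ℂ (graphVec c) a) = _
  rw [graphLift_apply, polar_linearCombination (polar_graphVec c)]
  rfl

theorem eq_zero_of_mem_chartZ {z : HPrime} (hz : z ∈ chartZ c) (h : z ∈ HPlus) : z = 0 := by
  rw [← graphLift_of_mem hz, graphLift_plus c h]

theorem eq_of_mem_chartZ {z z' : HPrime} (hz : z ∈ chartZ c) (hz' : z' ∈ chartZ c)
    (h : polar z = polar z') : z = z' := by
  rw [← graphLift_of_mem hz, ← graphLift_of_mem hz', graphLift_apply, graphLift_apply, h]

theorem frameVec_mem (c : ChartIdx g → ℂ) (i : Fin g) : frameVec c i ∈ HPlus := hplus_mem _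

/-- Symmetry of φ, encoded by indexing its coefficients with unordered pairs, makes its graph
isotropic. -/
theorem symp_graphVec (m n : ℕ) : symp (graphVec c m) (graphVec c n) = 0 := by
  simp only [graphVec, map_add, LinearMap.add_apply]
  rw [symp_plus (hplus_mem _) (hplus_mem _), symp_bvec_left, symp_bvec_left, symp_bvec_right,
    neg_neg, neg_neg, hcoeff_hplus_nat, hcoeff_hplus_nat, hcoeff_bvec, if_neg (by omega),
    Sym2.eq_swap]
  push_cast
  ring

theorem symp_chartZ {y z : HPrime} (hy : y ∈ chartZ c) (hz : z ∈ chartZ c) : symp y z = 0 := by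
  obtain ⟨a, rfl⟩ := Finsupp.mem_span_range_iff_exists_finsupp.1 hy
  obtain ⟨b, rfl⟩ := Finsupp.mem_span_range_iff_exists_finsupp.1 hz
  simp only [Finsupp.sum, map_sum, LinearMap.sum_apply, map_smul, LinearMap.smul_apply,
    symp_graphVec, smul_zero, Finset.sum_const_zero]

/-- The graph is its own orthogonal: subtracting the element of Z with the same polar part leaves a
vector of H'_+ orthogonal to Z, hence to all b_{-n}. -/
theorem mem_chartZ_of_symp {y : HPrime} (h : ∀ n, symp (graphVec c n) y = 0) : y ∈ chartZ c := by
  have h0 : y - graphLift c y = 0 := by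
    refine symp_plus_left_ext (sub_graphLift_mem c y) fun n => ?_
    have h1 := h n
    have h2 := symp_chartZ (graphVec_mem c n) (graphLift_mem c y)
    have h3 := symp_plus (hplus_mem fun m => c (Sum.inl s(m, n)) * (n + 1))
      (sub_graphLift_mem c y)
    have h4 : bvec (-(n + 1 : ℤ)) = graphVec c n - hplus fun m => c (Sum.inl s(m, n)) * (n + 1) :=
      (add_sub_cancel_right _ _).symm
    rw [symp_antisymm, h4, map_sub symp, LinearMap.sub_apply, h3, map_sub, h1, h2]
    simp
  rw [sub_eq_zero.1 h0]
  exact graphLift_mem c y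

theorem mem_chart_F {Ω : Matrix (Fin g) (Fin g) ℂ} {y : HPrime} :
    y ∈ (chart Ω c).F ↔ y ∈ chartZ c ∧ ∀ i, symp (frameVec c i) y = 0 := by
  simp [chart, Submodule.mem_iInf]

/-- The same identity as `symp_decomp`, for the splitting of H' into the isotropic subspaces Z and
H'_+. -/
theorem symp_graphLift (y w : HPrime) :
    symp y w = symp y (graphLift c w) - symp w (graphLift c y) := by
  have h1 := symp_plus (sub_graphLift_mem c y) (sub_graphLift_mem c w)
  have h2 := symp_chartZ (graphLift_mem c y) (graphLift_mem c w)
  have h3 := symp_antisymm w (graphLift c y)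
  simp only [map_sub, LinearMap.sub_apply] at h1
  linear_combination h1 - h2 + h3

/-! ### Automorphisms in the coordinates (φ, h) -/

/-- The action of a symplectic automorphism in the coordinates `(φ, h)`. -/
def moveCoord (σ : HPrime ≃ₗ[ℂ] HPrime) (c : ChartIdx g → ℂ) : ChartIdx g → ℂ :=
  Sum.elim
    (Sym2.lift ⟨fun m n =>
        -(symp (σ.symm (bvec (-(m + 1 : ℤ)))) (graphLift c (σ.symm (bvec (-(n + 1 : ℤ))))) +
          symp (σ.symm (bvec (-(n + 1 : ℤ)))) (graphLift c (σ.symm (bvec (-(m + 1 : ℤ)))))) /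
          (2 * ((m : ℂ) + 1) * ((n : ℂ) + 1)),
      fun m n => by ring⟩)
    (fun p => hcoeff (p.2 + 1 : ℤ) (σ (frameVec c p.1)))

variable {σ : HPrime ≃ₗ[ℂ] HPrime}

theorem frameVec_moveCoord (hσ : IsSympPlus σ) (i : Fin g) :
    frameVec (moveCoord σ c) i = σ (frameVec c i) := by
  have h := hplus_hcoeff (hσ.map_plus (frameVec_mem c i))
  rw [← h]
  rfl

/-- Project σ⁻¹ b_{-n} to Z along H'_+ and move it by σ: the result lies in σZ and differs from
b_{-n} by an element of H'_+, so it is the graph vector of σZ. -/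
theorem graphVec_moveCoord (hσ : IsSympPlus σ) (n : ℕ) :
    graphVec (moveCoord σ c) n = σ (graphLift c (σ.symm (bvec (-(n + 1 : ℤ))))) := by
  set x := fun m : ℕ => σ.symm (bvec (-(m + 1 : ℤ))) with hx
  have hx' : ∀ m : ℕ, bvec (-(m + 1 : ℤ)) = σ (x m) := fun m => (σ.apply_symm_apply _).symm
  -- `moveCoord` is symmetrized so that it is defined for every σ; for symplectic σ the two halves
  -- agree.
  have hsymm : ∀ m, symp (x n) (graphLift c (x m)) = symp (x m) (graphLift c (x n)) := by
    intro m
    have h := symp_graphLift (c := c) (x n) (x m)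
    rw [← hσ.symplectic, ← hx', ← hx', symp_bvec_left, hcoeff_bvec, if_neg (by omega),
      mul_zero] at h
    exact (sub_eq_zero.1 h.symm)
  have hmem : σ (graphLift c (x n)) - bvec (-(n + 1 : ℤ)) ∈ HPlus := by
    rw [hx' n, ← map_sub, ← neg_sub, map_neg]
    exact neg_mem (hσ.map_plus (sub_graphLift_mem c _))
  have e : σ (graphLift c (x n)) = bvec (-(n + 1 : ℤ)) +
      (σ (graphLift c (x n)) - bvec (-(n + 1 : ℤ))) := (add_sub_cancel _ _).symm
  change _ = σ (graphLift c (x n))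
  rw [e, graphVec, ← hplus_hcoeff hmem]
  congr 2
  funext m
  rw [hcoeff_eq_symp, map_sub, symp_bvec_left _ (bvec _), hcoeff_bvec, if_neg (by omega),
    mul_zero, sub_zero, hx' m, hσ.symplectic]
  have h1 : (m : ℂ) + 1 ≠ 0 := Nat.cast_add_one_ne_zero m
  have h2 : (n : ℂ) + 1 ≠ 0 := Nat.cast_add_one_ne_zero n
  change -(symp (x m) (graphLift c (x n)) + symp (x n) (graphLift c (x m))) /
    (2 * ((m : ℂ) + 1) * ((n : ℂ) + 1)) * ((n : ℂ) + 1) = _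
  rw [hsymm m]
  field_simp
  ring

/-- Equality follows from one inclusion because both spaces are complements of H'_+, which σ
preserves. -/
theorem chartZ_moveCoord (hσ : IsSympPlus σ) :
    chartZ (moveCoord σ c) = (chartZ c).map σ.toLinearMap := by
  have hle : chartZ (moveCoord σ c) ≤ (chartZ c).map σ.toLinearMap := by
    rw [chartZ, Submodule.span_le]
    rintro _ ⟨n, rfl⟩
    rw [graphVec_moveCoord hσ]
    exact ⟨_, graphLift_mem c _, rfl⟩
  refine le_antisymm hle ?_
  rintro _ ⟨z, hz, rfl⟩
  obtain ⟨z', hz', e⟩ := hle (graphLift_mem (moveCoord σ c) (σ z))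
  have h1 : σ z - graphLift (moveCoord σ c) (σ z) = σ (z - z') := by
    rw [map_sub, ← e]
    rfl
  have h2 : z - z' ∈ HPlus := by
    have := hσ.symm.map_plus (sub_graphLift_mem (moveCoord σ c) (σ z))
    rwa [h1, σ.symm_apply_apply] at this
  rw [sub_eq_zero.1 (eq_zero_of_mem_chartZ (sub_mem hz hz') h2), e]
  exact graphLift_mem _ _

theorem conjVec_moveCoord (hσ : IsSympPlus σ) (Ω : Matrix (Fin g) (Fin g) ℂ) (x : Fin g → ℂ) :
    conjVec Ω (moveCoord σ c) x = σ (conjVec Ω c x) := by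
  simp only [conjVec, map_sum, map_smul, frameVec_moveCoord hσ]

/-- All pairings ⟨h_i, z⟩ are invariant, so Ω is unchanged and the group acts through the
coordinates φ and h alone. -/
theorem chart_move (hσ : IsSympPlus σ) (Ω : Matrix (Fin g) (Fin g) ℂ) (c : ChartIdx g → ℂ) :
    (chart Ω c).move σ = chart Ω (moveCoord σ c) := by
  have hsymp : ∀ i z, symp (frameVec (moveCoord σ c) i) (σ z) = symp (frameVec c i) z :=
    fun i z => by rw [frameVec_moveCoord hσ, hσ.symplectic]
  ext y
  · change y ∈ (chartZ c).map σ.toLinearMap ↔ y ∈ chartZ (moveCoord σ c)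
    rw [chartZ_moveCoord hσ]
  · change y ∈ ((chart Ω c).F).map σ.toLinearMap ↔ _
    rw [mem_chart_F, chartZ_moveCoord hσ]
    constructor
    · rintro ⟨z, hz, rfl⟩
      have hz := mem_chart_F.1 hz
      exact ⟨⟨z, hz.1, rfl⟩, fun i => (hsymp i z).trans (hz.2 i)⟩
    · rintro ⟨⟨z, hz, rfl⟩, h⟩
      exact ⟨z, mem_chart_F.2 ⟨hz, fun i => (hsymp i z).symm.trans (h i)⟩, rfl⟩
  · constructor
    · rintro ⟨_, ⟨z, hz, m, n, h, rfl⟩, rfl⟩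
      refine ⟨σ z, by rw [chartZ_moveCoord hσ]; exact ⟨z, hz, rfl⟩, m, n, ?_, ?_⟩
      · simp only [hsymp, h]
      · simp only [hsymp, conjVec_moveCoord hσ, ← map_add]
        rfl
    · rintro ⟨w, hw, m, n, h, rfl⟩
      rw [chartZ_moveCoord hσ] at hw
      obtain ⟨z, hz, rfl⟩ := hw
      change (fun i => symp (frameVec (moveCoord σ c) i) (σ z)) = _ at h
      simp only [hsymp] at h
      refine ⟨z + conjVec Ω c fun i => symp (frameVec c i) z, ⟨z, hz, m, n, h, rfl⟩, ?_⟩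
      change σ _ = σ z + conjVec Ω (moveCoord σ c) fun i => symp (frameVec (moveCoord σ c) i) (σ z)
      simp only [hsymp, conjVec_moveCoord hσ, ← map_add]

theorem moveCoord_mem_frames (hσ : IsSympPlus σ) (hc : c ∈ frames g) :
    moveCoord σ c ∈ frames g := by
  have e : frameVec (moveCoord σ c) = σ ∘ frameVec c := funext fun i => frameVec_moveCoord hσ i
  change LinearIndependent ℂ _
  rw [e]
  exact LinearIndependent.map' hc σ.toLinearMap (LinearEquiv.ker σ)

/-! ### Minors and the locus of frames -/

/-- The matrix of the pairings of `h_1, …, h_g` with `g` of the vectors `b_{-n-1}`. -/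
def minorMat (c : ChartIdx g → ℂ) (J : Fin g → ℕ) : Matrix (Fin g) (Fin g) ℂ :=
  Matrix.of fun i j => symp (frameVec c i) (bvec (-(J j + 1 : ℤ)))

theorem symp_frameVec_bvec (c : ChartIdx g → ℂ) (i : Fin g) (n : ℕ) :
    symp (frameVec c i) (bvec (-(n + 1 : ℤ))) = (n + 1) * c (Sum.inr (i, n)) := by
  rw [symp_bvec_right, neg_neg, frameVec, hcoeff_hplus_nat]
  push_cast
  ring

theorem mem_frames_of_det_ne_zero {J : Fin g → ℕ} (h : (minorMat c J).det ≠ 0) :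
    c ∈ frames g := by
  change LinearIndependent ℂ _
  rw [Fintype.linearIndependent_iff]
  intro a ha
  refine congrFun (Matrix.eq_zero_of_vecMul_eq_zero h ?_)
  funext j
  have := congrArg (fun y => symp y (bvec (-(J j + 1 : ℤ)))) ha
  simpa [Matrix.vecMul, dotProduct, minorMat] using this

/-- If the columns of pairings with the b_{-n} did not span ℂ^g, a linear form killing them would be
a linear relation among the h_i. So g of the columns form a basis. -/
theorem exists_det_ne_zero (hc : c ∈ frames g) : ∃ J : Fin g → ℕ, (minorMat c J).det ≠ 0 := by
  set col : ℕ → Fin g → ℂ := fun n i => symp (frameVec c i) (bvec (-(n + 1 : ℤ))) with hcol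
  have htop : Submodule.span ℂ (Set.range col) = ⊤ := by
    by_contra hne
    obtain ⟨f, hf, hle⟩ := Submodule.exists_le_ker_of_lt_top _ (lt_top_iff_ne_top.2 hne)
    apply hf
    have h0 : ∑ i, f (Pi.single i 1) • frameVec c i = 0 := by
      refine symp_plus_left_ext (Submodule.sum_mem _ fun i _ =>
        Submodule.smul_mem _ _ (frameVec_mem c i)) fun n => ?_
      have h1 : f (col n) = 0 := hle (Submodule.subset_span ⟨n, rfl⟩)
      rw [pi_eq_sum_univ' (col n), map_sum] at h1
      rw [← h1, map_sum, LinearMap.sum_apply]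
      refine Finset.sum_congr rfl fun i _ => ?_
      rw [map_smul, map_smul, LinearMap.smul_apply, smul_eq_mul, smul_eq_mul, mul_comm]
    have h1 := Fintype.linearIndependent_iff.1 hc _ h0
    exact LinearMap.pi_ext' fun i => LinearMap.ext_ring (h1 i)
  obtain ⟨f, hf, -, hli⟩ := Submodule.exists_fun_fin_finrank_span_eq ℂ (Set.range col)
  have hg : Module.finrank ℂ (Submodule.span ℂ (Set.range col)) = g := by
    rw [htop, finrank_top, Module.finrank_fin_fun]
  choose J hJ using hf
  refine ⟨fun j => J (Fin.cast hg.symm j), ?_⟩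
  have h2 : LinearIndependent ℂ (minorMat c fun j => J (Fin.cast hg.symm j)).col := by
    have e : (minorMat c fun j => J (Fin.cast hg.symm j)).col = f ∘ Fin.cast hg.symm := by
      funext j
      rw [Function.comp_apply, ← hJ]
      rfl
    rw [e]
    exact hli.comp _ (Fin.cast_injective _)
  exact ((Matrix.isUnit_iff_isUnit_det _).1
    (Matrix.linearIndependent_cols_iff_isUnit.1 h2)).ne_zero

theorem continuous_det_minorMat (J : Fin g → ℕ) :
    Continuous fun c : ChartIdx g → ℂ => (minorMat c J).det := by
  refine Continuous.matrix_det (continuous_matrix fun i j => ?_)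
  simp only [minorMat, Matrix.of_apply, symp_frameVec_bvec]
  exact continuous_const.mul (continuous_apply _)

/-- Linear independence is the union of the conditions that some g × g minor, a function of finitely
many coordinates, does not vanish. -/
theorem isOpen_frames : IsOpen (frames g) := by
  have : frames g = ⋃ J : Fin g → ℕ, {c | (minorMat c J).det ≠ 0} := by
    ext c
    rw [Set.mem_iUnion]
    exact ⟨exists_det_ne_zero, fun ⟨J, hJ⟩ => mem_frames_of_det_ne_zero hJ⟩
  rw [this]
  exact isOpen_iUnion fun J => isOpen_ne_fun (continuous_det_minorMat J) continuous_const

end Chart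

section HolChart

variable {g : ℕ} {ι : Type} {c : (ι → ℂ) → ChartIdx g → ℂ} {t : ι → ℂ}

theorem holHAt_graphVec (hc : ∀ i, HolAt (fun u => c u i) t) (n : ℕ) :
    HolHAt (fun u => graphVec (c u) n) t :=
  (HolHAt.const _ _).add (HolHAt.hplus fun _ => (hc _).mul (HolAt.const _ _))

theorem holHAt_frameVec (hc : ∀ i, HolAt (fun u => c u i) t) (i : Fin g) :
    HolHAt (fun u => frameVec (c u) i) t :=
  HolHAt.hplus fun _ => hc _

theorem HolHAt.graphLift {y : (ι → ℂ) → HPrime} (hc : ∀ i, HolAt (fun u => c u i) t)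
    (hy : HolHAt y t) : HolHAt (fun u => graphLift (c u) (y u)) t :=
  hy.linearCombination (holHAt_graphVec hc)

theorem GroupAt.moveCoord {ρ : (ι → ℂ) → (HPrime ≃ₗ[ℂ] HPrime)} (hρ : GroupAt ρ t)
    (hc : ∀ i, HolAt (fun u => c u i) t) (i : ChartIdx g) :
    HolAt (fun u => moveCoord (ρ u) (c u) i) t := by
  rcases i with p | ⟨i, n⟩
  · induction p using Sym2.inductionOn with
    | hf m n =>
      refine HolAt.mul (HolAt.neg (HolAt.add ?_ ?_)) (HolAt.const _ _)
      · exact (hρ.hol_symm _).symp (HolHAt.graphLift hc (hρ.hol_symm _))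
      · exact (hρ.hol_symm _).symp (HolHAt.graphLift hc (hρ.hol_symm _))
  · exact (hρ.apply (holHAt_frameVec hc i)).1 _

/-- Near `t`, the map `x` is given by holomorphic coordinates. -/
def Charted (P : PPAV g) (x : (ι → ℂ) → Triple) (t : ι → ℂ) : Prop :=
  ∃ Ω, IsPeriod P Ω ∧ ∃ c : (ι → ℂ) → ChartIdx g → ℂ, (∀ i, HolAt (fun u => c u i) t) ∧
    ∀ᶠ u in 𝓝 t, c u ∈ frames g ∧ x u = chart Ω (c u)

theorem IsSpFamily.charted {P : PPAV g} {T : Set (ι → ℂ)} {x : (ι → ℂ) → Triple}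
    (h : IsSpFamily P T x) (ht : t ∈ T) : Charted P x t := by
  obtain ⟨-, Ω, hΩ, c, hc⟩ := h t ht
  exact ⟨Ω, hΩ, c, hc.self_of_nhds.2.2, hc.mono fun u hu => ⟨hu.1, hu.2.1⟩⟩

theorem Charted.move {P : PPAV g} {x : (ι → ℂ) → Triple} (h : Charted P x t)
    {ρ : (ι → ℂ) → (HPrime ≃ₗ[ℂ] HPrime)} (hρ : GroupAt ρ t) :
    Charted P (fun u => (x u).move (ρ u)) t := by
  obtain ⟨Ω, hΩ, c, hc, e⟩ := h
  refine ⟨Ω, hΩ, fun u => HeisCoinv.moveCoord (ρ u) (c u), hρ.moveCoord hc, ?_⟩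
  filter_upwards [e, hρ.symplectic] with u h1 h2
  rw [h1.2, chart_move h2]
  exact ⟨moveCoord_mem_frames h2 h1.1, rfl⟩

end HolChart

/-! ### Local frames of the tautological sheaf -/

theorem HolAt.det {n : Type*} [Fintype n] [DecidableEq n] {ι : Type} {t : ι → ℂ}
    {A : (ι → ℂ) → Matrix n n ℂ} (h : ∀ i j, HolAt (fun u => A u i j) t) :
    HolAt (fun u => (A u).det) t := by
  simp only [Matrix.det_apply, Units.smul_def, zsmul_eq_mul]
  exact HolAt.sum fun σ _ => (HolAt.prod fun i _ => h _ _).const_mul _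

section Frame

variable {g : ℕ}

/-- The locus where no nonzero combination of the `b_{-n-1}`, `n ∈ J`, is the polar part of an
element of `F`. -/
def minorLocus (J : Fin g → ℕ) : Set Triple :=
  {a | ∀ z ∈ a.F, ∀ e : Fin g → ℂ, polar z = ∑ j, Finsupp.single (J j) (e j) → e = 0}

open Classical in
/-- The element of `F` whose polar part is `b_{-n-1}` modulo the `b_{-m-1}`, `m ∈ J`. -/
def frameSection (J : Fin g → ℕ) (n : ℕ) (a : Triple) : HPrime :=
  if h : ∃ z ∈ a.F, ∃ e : Fin g → ℂ, polar z = Finsupp.single n 1 - ∑ j, Finsupp.single (J j) (e j)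
  then h.choose else 0

variable {c : ChartIdx g → ℂ} {Ω : Matrix (Fin g) (Fin g) ℂ} {J : Fin g → ℕ}

theorem symp_frameVec_graphVec (i : Fin g) (n : ℕ) :
    symp (frameVec c i) (graphVec c n) = symp (frameVec c i) (bvec (-(n + 1 : ℤ))) := by
  rw [graphVec, map_add, symp_plus (frameVec_mem c i) (hplus_mem _), add_zero]

theorem polar_sum_graphVec (e : Fin g → ℂ) :
    polar (∑ j, e j • graphVec c (J j)) = ∑ j, Finsupp.single (J j) (e j) := by
  simp only [map_sum, map_smul, polar_graphVec, Finsupp.smul_single, smul_eq_mul, mul_one]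

theorem symp_frameVec_sum (e : Fin g → ℂ) (i : Fin g) :
    symp (frameVec c i) (∑ j, e j • graphVec c (J j)) = (minorMat c J).mulVec e i := by
  simp only [map_sum, map_smul, symp_frameVec_graphVec, Matrix.mulVec, dotProduct, minorMat,
    Matrix.of_apply, smul_eq_mul, mul_comm]

theorem sum_graphVec_mem (e : Fin g → ℂ) : ∑ j, e j • graphVec c (J j) ∈ chartZ c :=
  Submodule.sum_mem _ fun _ _ => Submodule.smul_mem _ _ (graphVec_mem c _)

/-- An element of Z with polar part supported on J is the matching combination e of graph vectors,
and it lies in F exactly when the minor kills e. -/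
theorem chart_mem_minorLocus : chart Ω c ∈ minorLocus J ↔ (minorMat c J).det ≠ 0 := by
  constructor
  · intro h hdet
    obtain ⟨e, he, h0⟩ := Matrix.exists_mulVec_eq_zero_iff.2 hdet
    refine he (h _ (mem_chart_F.2 ⟨sum_graphVec_mem e, fun i => ?_⟩) e (polar_sum_graphVec e))
    rw [symp_frameVec_sum, h0]
    rfl
  · intro hdet z hz e he
    obtain ⟨hz, h0⟩ := mem_chart_F.1 hz
    have ez : z = ∑ j, e j • graphVec c (J j) :=
      eq_of_mem_chartZ hz (sum_graphVec_mem e) (by rw [he, polar_sum_graphVec])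
    refine Matrix.eq_zero_of_mulVec_eq_zero hdet (funext fun i => ?_)
    rw [← symp_frameVec_sum, ← ez, h0]
    rfl

/-- The coefficients which put `b_{-n-1}` into `F`, by Cramer's rule. -/
def frameCoef (c : ChartIdx g → ℂ) (J : Fin g → ℕ) (n : ℕ) (j : Fin g) : ℂ :=
  (minorMat c J).det⁻¹ *
    ((minorMat c J).updateCol j fun i => symp (frameVec c i) (bvec (-(n + 1 : ℤ)))).det

theorem mulVec_frameCoef (h : (minorMat c J).det ≠ 0) (n : ℕ) (i : Fin g) :
    (minorMat c J).mulVec (frameCoef c J n) i = symp (frameVec c i) (bvec (-(n + 1 : ℤ))) := by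
  have e : frameCoef c J n = (minorMat c J).det⁻¹ •
      (minorMat c J).cramer fun i => symp (frameVec c i) (bvec (-(n + 1 : ℤ))) := by
    funext j
    rw [Pi.smul_apply, Matrix.cramer_apply]
    rfl
  rw [e, Matrix.mulVec_smul, Matrix.mulVec_cramer, smul_smul, inv_mul_cancel₀ h, one_smul]

/-- The section is chosen from the triple alone, so it is a function on Sp(X, Θ); uniqueness on the
minor locus identifies it with the explicit formula in any presentation. -/
theorem frameSection_chart (h : (minorMat c J).det ≠ 0) (n : ℕ) :
    frameSection J n (chart Ω c) = graphVec c n - ∑ j, frameCoef c J n j • graphVec c (J j) := by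
  have hp : polar (graphVec c n - ∑ j, frameCoef c J n j • graphVec c (J j)) =
      Finsupp.single n 1 - ∑ j, Finsupp.single (J j) (frameCoef c J n j) := by
    rw [map_sub, polar_graphVec, polar_sum_graphVec]
  have hm : graphVec c n - ∑ j, frameCoef c J n j • graphVec c (J j) ∈ (chart Ω c).F := by
    refine mem_chart_F.2 ⟨sub_mem (graphVec_mem c n) (sum_graphVec_mem _), fun i => ?_⟩
    rw [map_sub, symp_frameVec_sum, mulVec_frameCoef h, symp_frameVec_graphVec, sub_self]
  have hex : ∃ z ∈ (chart Ω c).F, ∃ e : Fin g → ℂ,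
      polar z = Finsupp.single n 1 - ∑ j, Finsupp.single (J j) (e j) := ⟨_, hm, _, hp⟩
  rw [frameSection, dif_pos hex]
  obtain ⟨h1, e, h2⟩ := hex.choose_spec
  have h3 := chart_mem_minorLocus.2 h _ (sub_mem h1 hm) (frameCoef c J n - e) (by
    rw [map_sub, h2, hp]
    simp only [Pi.sub_apply, Finsupp.single_sub, Finset.sum_sub_distrib]
    abel)
  refine eq_of_mem_chartZ (mem_chart_F.1 h1).1 (mem_chart_F.1 hm).1 ?_
  rw [h2, hp, sub_eq_zero.1 h3]

theorem frameSection_mem (h : (minorMat c J).det ≠ 0) (n : ℕ) :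
    frameSection J n (chart Ω c) ∈ (chart Ω c).F := by
  rw [frameSection_chart h]
  refine mem_chart_F.2 ⟨sub_mem (graphVec_mem c n) (sum_graphVec_mem _), fun i => ?_⟩
  rw [map_sub, symp_frameVec_sum, mulVec_frameCoef h, symp_frameVec_graphVec, sub_self]

theorem isOpenSp_minorLocus (P : PPAV g) (J : Fin g → ℕ) : IsOpenSp P (minorLocus J) := by
  intro Ω _
  simp only [chart_mem_minorLocus]
  exact isOpen_frames.inter (isOpen_ne_fun (continuous_det_minorMat J) continuous_const)

/-- Holomorphy is read off Cramer's rule, whose only denominator is the nonvanishing minor. -/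
theorem isTautSection_frameSection (P : PPAV g) (J : Fin g → ℕ) (n : ℕ) :
    IsTautSection P (minorLocus J) (frameSection J n) := by
  intro Ω _ c _ h
  rw [chart_mem_minorLocus] at h
  refine ⟨?_, frameSection_mem h n⟩
  have hc : ∀ i, HolAt (fun c' : ChartIdx g → ℂ => c' i) c := fun i => HolAt.coord i c
  have hM : ∀ i j, HolAt (fun c' => minorMat c' J i j) c := fun i j =>
    (holHAt_frameVec hc i).symp (HolHAt.const (bvec (-(J j + 1 : ℤ))) c)
  have hcoef : ∀ j, HolAt (fun c' => frameCoef c' J n j) c := by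
    intro j
    refine ((HolAt.det hM).inv h).mul (HolAt.det fun i k => ?_)
    simp only [Matrix.updateCol_apply]
    split_ifs
    · exact (holHAt_frameVec hc i).symp (HolHAt.const _ _)
    · exact hM i k
  refine HolHAt.congr (HolHAt.sub (holHAt_graphVec hc n)
    (HolHAt.sum (s := Finset.univ) fun j _ => HolHAt.smul (hcoef j) (holHAt_graphVec hc (J j)))) ?_
  filter_upwards [(continuous_det_minorMat J).continuousAt.eventually_ne h] with c' h'
  rw [frameSection_chart h']

/-- Subtracting the combination leaves an element of F whose polar part is supported on J, and on
the minor locus such an element is 0. The coefficients are just polar coefficients of y, so they are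
holomorphic when y is. -/
theorem eq_sum_frameSection (h : (minorMat c J).det ≠ 0) {y : HPrime} (hy : y ∈ (chart Ω c).F)
    {N : ℕ} (hN : y ∈ hfil (-(N : ℤ))) :
    y = ∑ n ∈ Finset.range N, hcoeff (-(n + 1 : ℤ)) y • frameSection J n (chart Ω c) := by
  set w := ∑ n ∈ Finset.range N, hcoeff (-(n + 1 : ℤ)) y • frameSection J n (chart Ω c) with hw
  have hwF : w ∈ (chart Ω c).F :=
    Submodule.sum_mem _ fun n _ => Submodule.smul_mem _ _ (frameSection_mem h n)
  have hpy : polar y = ∑ n ∈ Finset.range N, hcoeff (-(n + 1 : ℤ)) y • Finsupp.single n 1 := by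
    rw [← linearCombination_polar_eq_sum hN fun n => Finsupp.single n (1 : ℂ)]
    rw [Finsupp.linearCombination_apply]
    simp only [Finsupp.smul_single, smul_eq_mul, mul_one]
    exact (Finsupp.sum_single _).symm
  have hpw : polar (y - w) = ∑ j, Finsupp.single (J j)
      (∑ n ∈ Finset.range N, hcoeff (-(n + 1 : ℤ)) y * frameCoef c J n j) := by
    rw [map_sub, hpy, hw, map_sum, ← Finset.sum_sub_distrib]
    simp only [Finsupp.single_finsetSum]
    rw [Finset.sum_comm]
    refine Finset.sum_congr rfl fun n _ => ?_
    rw [frameSection_chart h, map_smul, map_sub, polar_graphVec, polar_sum_graphVec, ← smul_sub,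
      sub_sub_cancel, Finset.smul_sum]
    simp only [Finsupp.smul_single, smul_eq_mul]
  have h3 := chart_mem_minorLocus.2 h _ (sub_mem hy hwF) _ hpw
  have h4 : y - w = 0 := by
    refine eq_zero_of_mem_chartZ (mem_chart_F.1 (sub_mem hy hwF)).1 (mem_plus_iff_polar.2 ?_)
    rw [hpw]
    refine Finset.sum_eq_zero fun j _ => ?_
    rw [show (∑ n ∈ Finset.range N, hcoeff (-(n + 1 : ℤ)) y * frameCoef c J n j) = 0 from
      congrFun h3 j, Finsupp.single_zero]
  exact sub_eq_zero.1 h4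

end Frame

/-! ### The image of `𝔥_Γ^out` -/

section OutAt

variable {Γ : Type*} [AddCommGroup Γ] {d : ℕ} (H : Module.Basis (Fin d) ℂ (ℂ ⊗[ℤ] Γ)) (ℓ : ℂ)
  {g : ℕ} (P : PPAV g) {ι κ : Type} {t : ι → ℂ}

theorem heis_sum_smul (A : ℂ ⊗[ℤ] Γ) {α : Type*} (B : Finset α) (a : α → ℂ) (y : α → HPrime)
    (v : Fock d) :
    heis H ℓ A (∑ i ∈ B, a i • y i) v = ∑ i ∈ B, a i • heis H ℓ A (y i) v := by
  simp only [heis_apply, ← modeHom_apply, map_sum, map_smul, LinearMap.sum_apply,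
    LinearMap.smul_apply, Finset.smul_sum]
  rw [Finset.sum_comm]
  exact Finset.sum_congr rfl fun i _ => Finset.sum_congr rfl fun k _ => smul_comm _ _ _

theorem heis_sub (A : ℂ ⊗[ℤ] Γ) (y z : HPrime) (v : Fock d) :
    heis H ℓ A (y - z) v = heis H ℓ A y v - heis H ℓ A z v := by
  simp only [heis_apply, mode_sub, smul_sub, Finset.sum_sub_distrib]

/-- The germ of `s` at `t` lies in the stalk of the image of `x^* 𝔥_Γ^out (V ⊗ 𝒪)`. -/
def OutAt (x : (ι → ℂ) → Triple) (t : ι → ℂ) (s : (ι → ℂ) → Fock d) : Prop :=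
  (s : Germ (𝓝 t) (Fock d)) ∈ outGerms H ℓ P x t

variable {H ℓ P} {x : (ι → ℂ) → Triple} {s s' : (ι → ℂ) → Fock d}

theorem OutAt.congr (h : OutAt H ℓ P x t s) (e : ∀ᶠ u in 𝓝 t, s u = s' u) :
    OutAt H ℓ P x t s' := by
  rw [OutAt, ← coe_eq_coe.2 e]
  exact h

theorem OutAt.zero : OutAt H ℓ P x t fun _ => 0 := Submodule.zero_mem _

theorem OutAt.add (h : OutAt H ℓ P x t s) (h' : OutAt H ℓ P x t s') :
    OutAt H ℓ P x t fun u => s u + s' u := Submodule.add_mem _ h h'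

theorem OutAt.sub (h : OutAt H ℓ P x t s) (h' : OutAt H ℓ P x t s') :
    OutAt H ℓ P x t fun u => s u - s' u := Submodule.sub_mem _ h h'

theorem OutAt.smul {a : (ι → ℂ) → ℂ} (ha : HolAt a t) (h : OutAt H ℓ P x t s) :
    OutAt H ℓ P x t fun u => a u • s u :=
  Submodule.smul_mem _ (⟨(a : Germ (𝓝 t) ℂ), a, ha, rfl⟩ : holGerms t) h

theorem OutAt.sum {α : Type*} {B : Finset α} {F : α → (ι → ℂ) → Fock d}
    (h : ∀ i ∈ B, OutAt H ℓ P x t (F i)) : OutAt H ℓ P x t fun u => ∑ i ∈ B, F i u := by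
  classical
  induction B using Finset.induction_on with
  | empty => simpa using OutAt.zero
  | insert a B ha ih =>
    simp only [Finset.sum_insert ha]
    exact (h a (Finset.mem_insert_self a B)).add
      (ih fun i hi => h i (Finset.mem_insert_of_mem hi))

/-- Span induction carried over from germs to functions; closure under eventual equality accounts
for the choice of representatives. -/
theorem OutAt.induction {Q : ((ι → ℂ) → Fock d) → Prop}
    (congr : ∀ s s', (∀ᶠ u in 𝓝 t, s u = s' u) → Q s → Q s')
    (gen : ∀ U f A w, IsOpenSp P U → x t ∈ U → IsTautSection P U f → HolV w t →
      Q fun u => heis H ℓ A (f (x u)) (w u))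
    (zero : Q fun _ => 0) (add : ∀ s s', Q s → Q s' → Q fun u => s u + s' u)
    (smul : ∀ a s, HolAt a t → Q s → Q fun u => a u • s u)
    (h : OutAt H ℓ P x t s) : Q s := by
  have key : ∀ φ ∈ outGerms H ℓ P x t, ∃ s : (ι → ℂ) → Fock d,
      Q s ∧ (s : Germ (𝓝 t) (Fock d)) = φ := by
    intro φ hφ
    induction hφ using Submodule.span_induction with
    | mem φ h =>
      obtain ⟨U, f, A, w, h1, h2, h3, h4, rfl⟩ := h
      exact ⟨_, gen U f A w h1 h2 h3 (mem_secGerms.1 h4), rfl⟩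
    | zero => exact ⟨_, zero, rfl⟩
    | add φ ψ _ _ h1 h2 =>
      obtain ⟨s, hs, rfl⟩ := h1
      obtain ⟨s', hs', rfl⟩ := h2
      exact ⟨_, add _ _ hs hs', rfl⟩
    | smul a φ _ h1 =>
      obtain ⟨s, hs, rfl⟩ := h1
      obtain ⟨_, f, hf, rfl⟩ := a
      exact ⟨_, smul f s hf hs, rfl⟩
  obtain ⟨s₁, h1, e⟩ := key _ h
  exact congr _ _ (coe_eq_coe.1 e) h1

/-- The image of 𝔥^out is generated by pull-backs of sections over Sp(X, Θ), while group and Lie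
algebra produce families of vectors of F with no such origin. Expanding in the local frame closes
this gap. -/
theorem OutAt.of_mem (hx : Charted P x t) {y : (ι → ℂ) → HPrime} (hy : HolHAt y t)
    (hF : ∀ᶠ u in 𝓝 t, y u ∈ (x u).F) (A : ℂ ⊗[ℤ] Γ) (hs : HolV s t) :
    OutAt H ℓ P x t fun u => heis H ℓ A (y u) (s u) := by
  obtain ⟨Ω, hΩ, c, hc, e⟩ := hx
  obtain ⟨J, hJ⟩ := exists_det_ne_zero e.self_of_nhds.1
  obtain ⟨N, hN⟩ := hy.exists_nat
  have hJ' : ∀ᶠ u in 𝓝 t, (minorMat (c u) J).det ≠ 0 :=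
    (tendsto_of_holAt hc).eventually ((continuous_det_minorMat J).continuousAt.eventually_ne hJ)
  refine OutAt.congr (OutAt.sum (B := Finset.range N) fun n _ =>
    OutAt.smul (hy.1 (-(n + 1 : ℤ))) (s := fun u => heis H ℓ A (frameSection J n (x u)) (s u))
      (Submodule.subset_span ⟨minorLocus J, frameSection J n, A, s, isOpenSp_minorLocus P J, ?_,
        isTautSection_frameSection P J n, mem_secGerms.2 hs, rfl⟩)) ?_
  · rw [e.self_of_nhds.2]
    exact chart_mem_minorLocus.2 hJ
  · filter_upwards [e, hF, hN, hJ'] with u h1 h2 h3 h4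
    rw [h1.2] at h2
    conv_rhs => rw [eq_sum_frameSection h4 h2 h3]
    rw [heis_sum_smul, h1.2]

theorem IsTautSection.holHAt {U : Set Triple} {f : Triple → HPrime} (hf : IsTautSection P U f)
    (hx : Charted P x t) (hU : x t ∈ U) : HolHAt (fun u => f (x u)) t := by
  obtain ⟨Ω, hΩ, c, hc, e⟩ := hx
  have h0 := e.self_of_nhds
  rw [h0.2] at hU
  exact (HolHAt.comp (hf Ω hΩ _ h0.1 hU).1 hc).congr (e.mono fun u hu => by rw [hu.2])

theorem Charted.eventually_mem {U : Set Triple} (hU : IsOpenSp P U) (hx : Charted P x t)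
    (h : x t ∈ U) : ∀ᶠ u in 𝓝 t, x u ∈ U := by
  obtain ⟨Ω, hΩ, c, hc, e⟩ := hx
  have h0 := e.self_of_nhds
  rw [h0.2] at h
  filter_upwards [e, (tendsto_of_holAt hc).eventually ((hU Ω hΩ).mem_nhds ⟨h0.1, h⟩)] with u h1 h2
  rw [h1.2]
  exact h2.2

theorem IsTautSection.eventually_mem {U : Set Triple} {f : Triple → HPrime}
    (hf : IsTautSection P U f) (hUo : IsOpenSp P U) (hx : Charted P x t) (hU : x t ∈ U) :
    ∀ᶠ u in 𝓝 t, f (x u) ∈ (x u).F := by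
  have h := hx.eventually_mem hUo hU
  obtain ⟨Ω, hΩ, c, hc, e⟩ := hx
  filter_upwards [e, h] with u h1 h2
  rw [h1.2] at h2 ⊢
  exact (hf Ω hΩ _ h1.1 h2).2

/-- By the intertwining property a generator with f goes to one with ρ f, a holomorphic family in
ρF. -/
theorem OutAt.fockAct {ρ : (ι → ℂ) → (HPrime ≃ₗ[ℂ] HPrime)} (hx : Charted P x t)
    (hρ : GroupAt ρ t) (h : OutAt H ℓ P x t s) :
    OutAt H ℓ P (fun u => (x u).move (ρ u)) t fun u => fockAct d ℓ (ρ u) (s u) := by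
  refine OutAt.induction (Q := fun s => OutAt H ℓ P (fun u => (x u).move (ρ u)) t
    fun u => HeisCoinv.fockAct d ℓ (ρ u) (s u)) ?_ ?_ ?_ ?_ ?_ h
  · intro s s' e h
    exact h.congr (e.mono fun u hu => by rw [hu])
  · intro U f A w hU hxU hf hw
    refine OutAt.congr (OutAt.of_mem (hx.move hρ) (hρ.apply (hf.holHAt hx hxU)) ?_ A
      (hρ.fockAct (ℓ := ℓ) hw)) ?_
    · filter_upwards [hf.eventually_mem hU hx hxU] with u hu
      exact ⟨_, hu, rfl⟩
    · filter_upwards [hρ.symplectic] with u hu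
      rw [fockAct_heis H hu]
  · simpa using OutAt.zero
  · intro s s' h h'
    simpa using h.add h'
  · intro a s ha h
    simpa using h.smul ha

theorem OutAt.comp {x : (κ → ℂ) → Triple} {s : (κ → ℂ) → Fock d} {q : (ι → ℂ) → κ → ℂ}
    (hq : ∀ i, HolAt (fun u => q u i) t) (h : OutAt H ℓ P x (q t) s) :
    OutAt H ℓ P (fun u => x (q u)) t fun u => s (q u) := by
  refine OutAt.induction (Q := fun s => OutAt H ℓ P (fun u => x (q u)) t
    fun u => s (q u)) ?_ ?_ ?_ ?_ ?_ h
  · intro s s' e h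
    exact h.congr ((tendsto_of_holAt hq).eventually e)
  · intro U f A w hU hxU hf hw
    exact Submodule.subset_span ⟨U, f, A, fun u => w (q u), hU, hxU, hf,
      mem_secGerms.2 (HolV.comp hw hq), rfl⟩
  · exact OutAt.zero
  · intro s s' h h'
    exact h.add h'
  · intro a s ha h
    exact h.smul (HolAt.comp ha hq)

theorem OutAt.congr_family {x' : (ι → ℂ) → Triple} (e : ∀ᶠ u in 𝓝 t, x u = x' u)
    (h : OutAt H ℓ P x t s) : OutAt H ℓ P x' t s := by
  refine OutAt.induction (Q := fun s => OutAt H ℓ P x' t s) ?_ ?_ ?_ ?_ ?_ h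
  · intro s s' e h
    exact h.congr e
  · intro U f A w hU hxU hf hw
    refine OutAt.congr (s := fun u => heis H ℓ A (f (x' u)) (w u)) (Submodule.subset_span
      ⟨U, f, A, w, hU, e.self_of_nhds ▸ hxU, hf, mem_secGerms.2 hw, rfl⟩) ?_
    filter_upwards [e] with u hu
    rw [hu]
  · exact OutAt.zero
  · intro s s' h h'
    exact h.add h'
  · intro a s ha h
    exact h.smul ha

theorem OutAt.mem_outImage (hx : Charted P x t) (h : OutAt H ℓ P x t s) :
    s t ∈ outImage H ℓ (x t).F := by
  refine OutAt.induction (Q := fun s => s t ∈ outImage H ℓ (x t).F) ?_ ?_ ?_ ?_ ?_ h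
  · intro s s' e h
    rwa [← e.self_of_nhds]
  · intro U f A w hU hxU hf _
    exact Submodule.subset_span ⟨A, _, (hf.eventually_mem hU hx hxU).self_of_nhds, _, rfl⟩
  · exact Submodule.zero_mem _
  · intro s s' h h'
    exact Submodule.add_mem _ h h'
  · intro a s _ h
    exact Submodule.smul_mem _ _ h

end OutAt

/-! ### The equivariant structure -/

section Equivariant

variable {Γ : Type*} [AddCommGroup Γ] {d : ℕ} (H : Module.Basis (Fin d) ℂ (ℂ ⊗[ℤ] Γ)) (ℓ : ℂ)
  {g : ℕ} (P : PPAV g) {ι : Type}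

/-- The action of a family of symplectic automorphisms on germs. -/
def germAct (d : ℕ) (ℓ : ℂ) (ρ : (ι → ℂ) → (HPrime ≃ₗ[ℂ] HPrime)) (t : ι → ℂ) :
    Germ (𝓝 t) (Fock d) →ₗ[holGerms t] Germ (𝓝 t) (Fock d) where
  toFun φ := Germ.map₂ (fun (L : Fock d →ₗ[ℂ] Fock d) v => L v)
    ((fun u => fockAct d ℓ (ρ u) : (ι → ℂ) → Fock d →ₗ[ℂ] Fock d) : Germ (𝓝 t) _) φ
  map_add' φ ψ := by
    induction φ using Germ.inductionOn
    induction ψ using Germ.inductionOn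
    exact coe_eq_coe.2 (Eventually.of_forall fun u => map_add _ _ _)
  map_smul' a φ := by
    obtain ⟨_, f, hf, rfl⟩ := a
    induction φ using Germ.inductionOn
    exact coe_eq_coe.2 (Eventually.of_forall fun u => map_smul _ _ _)

/-- The action on germs preserves sections and the image of `𝔥_Γ^out`. -/
def ActsOnStalk (ρ : (ι → ℂ) → (HPrime ≃ₗ[ℂ] HPrime)) (x : (ι → ℂ) → Triple) (t : ι → ℂ) : Prop :=
  (∀ φ ∈ secGerms d t, germAct d ℓ ρ t φ ∈ secGerms d t) ∧
    ∀ φ ∈ outGerms H ℓ P x t, germAct d ℓ ρ t φ ∈ outGerms H ℓ P (fun u => (x u).move (ρ u)) t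

theorem actsOnStalk {ρ : (ι → ℂ) → (HPrime ≃ₗ[ℂ] HPrime)} {x : (ι → ℂ) → Triple} {t : ι → ℂ}
    (hρ : GroupAt ρ t) (hx : Charted P x t) : ActsOnStalk H ℓ P ρ x t := by
  constructor
  · intro φ
    induction φ using Germ.inductionOn with
    | _ s =>
      intro h
      exact mem_secGerms.2 (hρ.fockAct (mem_secGerms.1 h))
  · intro φ
    induction φ using Germ.inductionOn with
    | _ s =>
      intro h
      exact OutAt.fockAct hx hρ h

open Classical in
/-- The map between stalks of pull-backs of the sheaf of coinvariants. -/
def stalkMap (ρ : (ι → ℂ) → (HPrime ≃ₗ[ℂ] HPrime)) (x : (ι → ℂ) → Triple) (t : ι → ℂ) :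
    Stalk H ℓ P x t →ₗ[holGerms t] Stalk H ℓ P (fun u => (x u).move (ρ u)) t :=
  -- An equivariant structure asks for a map for all ρ and x, holomorphic or not; the zero map fills
  -- in where the action does not descend.
  if h : ActsOnStalk H ℓ P ρ x t then
    Submodule.mapQ _ _ ((germAct d ℓ ρ t).restrict h.1) fun _ hφ => h.2 _ hφ
  else 0

variable {H ℓ P} {ρ : (ι → ℂ) → (HPrime ≃ₗ[ℂ] HPrime)} {x : (ι → ℂ) → Triple} {t : ι → ℂ}

theorem cls_eq_cls {s s' : (ι → ℂ) → Fock d} (hs : (s : Germ (𝓝 t) (Fock d)) ∈ secGerms d t)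
    (hs' : (s' : Germ (𝓝 t) (Fock d)) ∈ secGerms d t) :
    Stalk.cls H ℓ P x t s hs = Stalk.cls H ℓ P x t s' hs' ↔
      OutAt H ℓ P x t fun u => s u - s' u :=
  Submodule.Quotient.eq _

theorem stalkMap_cls (hρ : GroupAt ρ t) (hx : Charted P x t) {s : (ι → ℂ) → Fock d}
    (hs : HolV s t) :
    stalkMap H ℓ P ρ x t (Stalk.cls H ℓ P x t s (mem_secGerms.2 hs)) =
      Stalk.cls H ℓ P (fun u => (x u).move (ρ u)) t (fun u => fockAct d ℓ (ρ u) (s u))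
        (mem_secGerms.2 (hρ.fockAct hs)) := by
  rw [stalkMap, dif_pos (actsOnStalk H ℓ P hρ hx)]
  rfl

/-- Reduces statements about stalks to functions: the represented section is T_ρ s up to the image
of 𝔥^out. -/
theorem represents_stalkMap (hρ : GroupAt ρ t) (hx : Charted P x t) {s s' : (ι → ℂ) → Fock d} :
    Represents H ℓ P (stalkMap H ℓ P ρ x t) s s' ↔ HolV s t ∧ HolV s' t ∧
      OutAt H ℓ P (fun u => (x u).move (ρ u)) t fun u => fockAct d ℓ (ρ u) (s u) - s' u := by
  constructor
  · rintro ⟨hs, hs', e⟩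
    refine ⟨mem_secGerms.1 hs, mem_secGerms.1 hs', ?_⟩
    rw [stalkMap_cls hρ hx (mem_secGerms.1 hs), cls_eq_cls] at e
    exact e
  · rintro ⟨hs, hs', e⟩
    refine ⟨mem_secGerms.2 hs, mem_secGerms.2 hs', ?_⟩
    rw [stalkMap_cls hρ hx hs, cls_eq_cls]
    exact e

theorem exists_cls (q : Stalk H ℓ P x t) :
    ∃ (s : (ι → ℂ) → Fock d) (hs : HolV s t), q = Stalk.cls H ℓ P x t s (mem_secGerms.2 hs) := by
  obtain ⟨⟨φ, hφ⟩, rfl⟩ := Submodule.Quotient.mk_surjective _ q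
  induction φ using Germ.inductionOn with
  | _ s => exact ⟨s, mem_secGerms.1 hφ, rfl⟩

theorem move_move (σ τ : HPrime ≃ₗ[ℂ] HPrime) (a : Triple) :
    (a.move σ).move τ = a.move (τ * σ) := by
  refine Triple.ext ?_ ?_ ?_
  · exact (Submodule.map_comp _ _ _).symm
  · exact (Submodule.map_comp _ _ _).symm
  · exact AddSubgroup.map_map _ _ _

theorem move_one (a : Triple) : a.move 1 = a := by
  ext y
  · simp [Triple.move]
  · simp [Triple.move]
  · simp [Triple.move]

theorem fockAct_symm_fockAct {σ : HPrime ≃ₗ[ℂ] HPrime} (h : IsSympPlus σ) (v : Fock d) :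
    fockAct d ℓ σ.symm (fockAct d ℓ σ v) = v := by
  rw [← fockAct_mul h.symm h]
  have : σ.symm * σ = 1 := inv_mul_cancel σ
  rw [this, fockAct_one]

/-- The inverse is induced by the family ρ⁻¹, which is again holomorphic. -/
theorem stalkMap_bijective (hρ : GroupAt ρ t) (hx : Charted P x t) :
    Function.Bijective (stalkMap H ℓ P ρ x t) := by
  constructor
  · rw [injective_iff_map_eq_zero]
    intro q hq
    obtain ⟨s, hs, rfl⟩ := exists_cls q
    have h0 : HolV (fun _ => (0 : Fock d)) t := HolV.const 0 t
    have hz : ∀ y : (ι → ℂ) → Triple, Stalk.cls H ℓ P y t (fun _ => 0) (mem_secGerms.2 h0) = 0 :=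
      fun y => rfl
    rw [stalkMap_cls hρ hx hs, ← hz, cls_eq_cls] at hq
    rw [← hz, cls_eq_cls]
    have h1 := (OutAt.fockAct (hx.move hρ) hρ.symm hq)
    refine (h1.congr_family (x' := x) (Eventually.of_forall fun u => ?_)).congr ?_
    · rw [move_move]
      have : (ρ u).symm * ρ u = 1 := inv_mul_cancel (ρ u)
      rw [this, move_one]
    · filter_upwards [hρ.symplectic] with u hu
      rw [sub_zero, sub_zero, fockAct_symm_fockAct hu]
  · intro q
    obtain ⟨s, hs, rfl⟩ := exists_cls q
    refine ⟨_, (stalkMap_cls hρ hx (hρ.symm.fockAct (ℓ := ℓ) hs)).trans ((cls_eq_cls _ _).2 ?_)⟩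
    refine OutAt.zero.congr ?_
    filter_upwards [hρ.symplectic] with u hu
    have := fockAct_symm_fockAct (ℓ := ℓ) hu.symm (s u)
    rw [LinearEquiv.symm_symm] at this
    rw [this, sub_self]

variable (H ℓ P)

theorem groupAt_one (t : ι → ℂ) : GroupAt (fun _ => 1) t :=
  ⟨Eventually.of_forall fun _ => isSympPlus_one, fun f => HolHAt.const f t,
    fun f => HolHAt.const f t⟩

/-- The equivariant structure on the sheaf of coinvariants. -/
def equivariantStructure : EquivariantStructure H ℓ P where
  map := stalkMap H ℓ P
  bijective T ρ x hT hρ hx t ht := stalkMap_bijective (hρ.groupAt hT ht) (hx.charted ht)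
  isLocal T ρ x hT hρ hx s hs t ht := by
    refine ⟨fun u => fockAct d ℓ (ρ u) (s u), ?_⟩
    filter_upwards [hT.mem_nhds ht] with u hu
    rw [represents_stalkMap (hρ.groupAt hT hu) (hx.charted hu)]
    have h := mem_secGerms.1 (hs u hu)
    exact ⟨h, (hρ.groupAt hT hu).fockAct h, by simpa using OutAt.zero⟩
  pullback T T' ρ x ρ' x' q hT hT' hρ hx hq e t ht s s' h := by
    have hqt := (hq t ht).2
    have h1 := hρ.groupAt hT (hq t ht).1
    have h2 := hx.charted (hq t ht).1
    have e' : ∀ᶠ u in 𝓝 t, ρ' u = ρ (q u) ∧ x' u = x (q u) :=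
      Filter.mem_of_superset (hT'.mem_nhds ht) fun u hu => e u hu
    rw [represents_stalkMap h1 h2] at h
    have h1' : GroupAt ρ' t := by
      obtain ⟨a, b, c⟩ := h1.comp hqt
      refine ⟨?_, fun f => (b f).congr ?_, fun f => (c f).congr ?_⟩
      · filter_upwards [a, e'] with u hu hu'
        rwa [hu'.1]
      · filter_upwards [e'] with u hu
        rw [hu.1]
      · filter_upwards [e'] with u hu
        rw [hu.1]
    have h2' : Charted P x' t := by
      obtain ⟨Ω, hΩ, c, hc, hc'⟩ := h2
      refine ⟨Ω, hΩ, fun u => c (q u), fun i => HolAt.comp (hc i) hqt, ?_⟩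
      filter_upwards [(tendsto_of_holAt hqt).eventually hc', e'] with u hu hu'
      rw [hu'.2]
      exact hu
    rw [represents_stalkMap h1' h2']
    refine ⟨HolV.comp (s := s) h.1 hqt, HolV.comp (s := s') h.2.1 hqt, ?_⟩
    refine ((h.2.2.comp hqt).congr_family ?_).congr ?_
    · filter_upwards [e'] with u hu
      rw [hu.1, hu.2]
    · filter_upwards [e'] with u hu
      rw [hu.1]
      rfl
  unit T x hT hx t ht s hs := by
    rw [represents_stalkMap (groupAt_one t) (hx.charted ht)]
    have h := mem_secGerms.1 hs
    exact ⟨h, h, by simpa [fockAct_one] using OutAt.zero⟩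
  cocycle T ρ σ x hT hρ hσ hx t ht s s' s'' h h' := by
    have hρ' := hρ.groupAt hT ht
    have hσ' := hσ.groupAt hT ht
    have hx' := hx.charted ht
    rw [represents_stalkMap hσ' hx'] at h
    rw [represents_stalkMap hρ' (hx'.move hσ')] at h'
    rw [represents_stalkMap (hρ'.mul hσ') hx']
    refine ⟨h.1, h'.2.1, ?_⟩
    -- The error of the first representative is transported by T_ρ and added to the error of the
    -- second.
    have h3 := (OutAt.fockAct (hx'.move hσ') hρ' h.2.2).add h'.2.2
    refine (h3.congr_family (Eventually.of_forall fun u => move_move _ _ _)).congr ?_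
    filter_upwards [hρ'.symplectic, hσ'.symplectic] with u h1 h2
    rw [fockAct_mul h1 h2, map_sub]
    abel

end Equivariant

/-! ### Triviality on the fibres -/

section Fibre

variable {Γ : Type*} [AddCommGroup Γ] {d : ℕ} {H : Module.Basis (Fin d) ℂ (ℂ ⊗[ℤ] Γ)} {ℓ : ℂ}
  {g : ℕ} {P : PPAV g}

/-- The vectors obtained from the vacuum by the modes of elements of the graph of `φ`. -/
inductive GraphGen (ℓ : ℂ) (c : ChartIdx g → ℂ) : Fock d → Prop
  | const (a : ℂ) : GraphGen ℓ c (MvPolynomial.C a)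
  | add (v w : Fock d) : GraphGen ℓ c v → GraphGen ℓ c w → GraphGen ℓ c (v + w)
  | mode (k : Fin d) (n : ℕ) (v : Fock d) : GraphGen ℓ c v →
      GraphGen ℓ c (mode ℓ k (graphVec c n) v)

variable {c : ChartIdx g → ℂ}

theorem GraphGen.smul {v : Fock d} (h : GraphGen ℓ c v) (r : ℂ) : GraphGen ℓ c (r • v) := by
  induction h with
  | const a => rw [MvPolynomial.smul_eq_C_mul, ← MvPolynomial.C_mul]; exact .const _
  | add v w _ _ hv hw => rw [smul_add]; exact .add _ _ hv hw
  | mode k n v _ hv => rw [← map_smul]; exact .mode _ _ _ hv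

/-- A mode of H'_+ moves past the modes of Z at the cost of scalars and finally kills the constants.
-/
theorem GraphGen.mode_plus {v : Fock d} (h : GraphGen ℓ c v) (k : Fin d) {y : HPrime}
    (hy : y ∈ HPlus) : GraphGen ℓ c (HeisCoinv.mode ℓ k y v) := by
  induction h with
  | const a => rw [mode_plus_C k hy, ← MvPolynomial.C_0]; exact .const _
  | add v w _ _ hv hw => rw [map_add]; exact .add _ _ hv hw
  | mode l n v h hv => rw [mode_commutator]; exact .add _ _ (.mode _ _ _ hv) (h.smul _)

/-- Multiplication by a variable is the mode of a graph vector minus a mode of H'_+. This allows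
induction along Z ⊆ F^⊥; the b_{-n} themselves need not lie in F^⊥. -/
theorem graphGen (ℓ : ℂ) (c : ChartIdx g → ℂ) (v : Fock d) : GraphGen ℓ c v := by
  induction v using fock_induction with
  | hC a => exact .const a
  | hadd v w hv hw => exact .add _ _ hv hw
  | hX p v hv =>
    have e : graphVec c p.2 - bvec (-(p.2 + 1 : ℤ)) ∈ HPlus := by
      rw [graphVec, add_sub_cancel_left]
      exact hplus_mem _
    have h1 : MvPolynomial.X p * v = mode ℓ p.1 (graphVec c p.2) v +
        (-1 : ℂ) • mode ℓ p.1 (graphVec c p.2 - bvec (-(p.2 + 1 : ℤ))) v := by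
      rw [mode_sub, mode_bvec, neg_one_smul]
      abel
    rw [h1]
    exact .add _ _ (.mode _ _ _ hv) ((hv.mode_plus _ e).smul _)

theorem mode_mem_outImage {F : Submodule ℂ HPrime} {y : HPrime} (hy : y ∈ F) (k : Fin d)
    (v : Fock d) : mode ℓ k y v ∈ outImage H ℓ F := by
  refine Submodule.subset_span ⟨H k, y, hy, v, ?_⟩
  rw [heis_apply, Finset.sum_eq_single k]
  · simp
  · intro l _ hl
    simp [Ne.symm hl]
  · simp

/-- The commutator of a mode of F^⊥ with a mode of F is a multiple of ⟨y, f⟩ = 0. -/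
theorem mode_perp_mem_outImage {F : Submodule ℂ HPrime} {y : HPrime} (hy : y ∈ perp F)
    (k : Fin d) {v : Fock d} (hv : v ∈ outImage H ℓ F) : mode ℓ k y v ∈ outImage H ℓ F := by
  have hle : outImage H ℓ F ≤ (outImage H ℓ F).comap (mode ℓ k y) := by
    conv_lhs => rw [outImage]
    rw [Submodule.span_le]
    rintro _ ⟨A, f, hf, w, rfl⟩
    change mode ℓ k y (heis H ℓ A f w) ∈ outImage H ℓ F
    rw [heis_apply, map_sum]
    refine Submodule.sum_mem _ fun l _ => ?_
    have h0 : symp y f = 0 := by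
      rw [symp_antisymm, neg_eq_zero]
      exact hy f hf
    rw [map_smul, mode_commutator, h0]
    refine Submodule.smul_mem _ _ ?_
    simpa using mode_mem_outImage hf l _
  exact hle hv

theorem fockAct_sub_mem_outImage {F : Submodule ℂ HPrime} {ρ : HPrime ≃ₗ[ℂ] HPrime}
    (hρ : IsSympPlus ρ) (hZ : chartZ c ≤ perp F) (h1 : ∀ y ∈ perp F, ρ y ∈ perp F)
    (h2 : ∀ y ∈ perp F, ρ y - y ∈ F) (v : Fock d) :
    fockAct d ℓ ρ v - v ∈ outImage H ℓ F := by
  induction graphGen ℓ c v with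
  | const a => rw [fockAct_C hρ, sub_self]; exact Submodule.zero_mem _
  | add v w _ _ hv hw =>
    rw [map_add, add_sub_add_comm]
    exact Submodule.add_mem _ hv hw
  | mode k n v _ hv =>
    have hz := hZ (graphVec_mem c n)
    -- The induction hypothesis handles the first summand, since ρz stays in F^⊥, and ρz - z ∈ F
    -- handles the second.
    have e : fockAct d ℓ ρ (mode ℓ k (graphVec c n) v) - mode ℓ k (graphVec c n) v =
        mode ℓ k (ρ (graphVec c n)) (fockAct d ℓ ρ v - v) +
          mode ℓ k (ρ (graphVec c n) - graphVec c n) v := by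
      rw [fockAct_mode hρ, map_sub, mode_sub]
      abel
    rw [e]
    exact Submodule.add_mem _ (mode_perp_mem_outImage (h1 _ hz) k hv)
      (mode_mem_outImage (h2 _ hz) k v)

theorem chartZ_le_perp (Ω : Matrix (Fin g) (Fin g) ℂ) (c : ChartIdx g → ℂ) :
    chartZ c ≤ perp (chart Ω c).F :=
  fun _ hz _ hf => symp_chartZ (mem_chart_F.1 hf).1 hz

theorem trivialOnFibres_equivariantStructure :
    (equivariantStructure H ℓ P).TrivialOnFibres := by
  intro ι T ρ x hT hρ hx t ht hF s s' hrep
  have hρ' := hρ.groupAt hT ht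
  have hx' := hx.charted ht
  obtain ⟨-, -, hout⟩ := (represents_stalkMap hρ' hx').1 hrep
  have h1 := hout.mem_outImage (hx'.move hρ')
  obtain ⟨-, hperp, hFF, htriv⟩ := hF
  obtain ⟨Ω, -, c, -, hc⟩ := hx'
  have hsymp := hρ'.symplectic.self_of_nhds
  have hFe : ((x t).move (ρ t)).F = (x t).F := hFF
  rw [hFe] at h1
  have h2 := fockAct_sub_mem_outImage (H := H) (ℓ := ℓ) (F := (x t).F) (c := c t) hsymp
    (by rw [hc.self_of_nhds.2]; exact chartZ_le_perp Ω (c t))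
    (fun y hy => by rw [← hperp]; exact ⟨y, hy, rfl⟩) htriv (s t)
  rw [Submodule.Quotient.eq, ← neg_sub, Submodule.neg_mem_iff]
  have e : s t - s' t = (fockAct d ℓ (ρ t) (s t) - s' t) - (fockAct d ℓ (ρ t) (s t) - s t) := by
    abel
  rw [e]
  exact Submodule.sub_mem _ h1 h2

end Fibre

/-! ### Coordinate changes between the parametrizations -/

section Transition

variable {g : ℕ}

/-- Membership in the lattice `ℤ^g Ω + ℤ^g`. -/
def IsLat (Ω : Matrix (Fin g) (Fin g) ℂ) (x : Fin g → ℂ) : Prop :=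
  ∃ m n : Fin g → ℤ, x = Matrix.vecMul (fun i => (m i : ℂ)) Ω + fun i => (n i : ℂ)

/-- The row vector `π x̄ (Im Ω)⁻¹`. -/
def conjCoef (Ω : Matrix (Fin g) (Fin g) ℂ) (x : Fin g → ℂ) (j : Fin g) : ℂ :=
  (Real.pi : ℂ) * Matrix.vecMul (star x) ((Ω.map Complex.im)⁻¹.map Complex.ofReal) j

theorem conjVec_eq (Ω : Matrix (Fin g) (Fin g) ℂ) (c : ChartIdx g → ℂ) (x : Fin g → ℂ) :
    conjVec Ω c x = ∑ j, conjCoef Ω x j • frameVec c j := rfl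

theorem mem_chart_K {Ω : Matrix (Fin g) (Fin g) ℂ} {c : ChartIdx g → ℂ} {y : HPrime} :
    y ∈ (chart Ω c).K ↔ ∃ z ∈ chartZ c, IsLat Ω (fun i => symp (frameVec c i) z) ∧
      y = z + conjVec Ω c fun i => symp (frameVec c i) z :=
  ⟨fun ⟨z, hz, m, n, h, e⟩ => ⟨z, hz, ⟨m, n, h⟩, e⟩, fun ⟨z, hz, ⟨m, n, h⟩, e⟩ =>
    ⟨z, hz, m, n, h, e⟩⟩

variable {Ω Ω' : Matrix (Fin g) (Fin g) ℂ} {c c' : ChartIdx g → ℂ}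

theorem conjVec_mem_plus (Ω : Matrix (Fin g) (Fin g) ℂ) (c : ChartIdx g → ℂ) (x : Fin g → ℂ) :
    conjVec Ω c x ∈ HPlus :=
  Submodule.sum_mem _ fun _ _ => Submodule.smul_mem _ _ (frameVec_mem c _)

theorem exists_symp_frameVec (hc : c ∈ frames g) (x : Fin g → ℂ) :
    ∃ z ∈ chartZ c, ∀ i, symp (frameVec c i) z = x i := by
  obtain ⟨J, hJ⟩ := exists_det_ne_zero hc
  refine ⟨_, sum_graphVec_mem (J := J) ((minorMat c J)⁻¹.mulVec x), fun i => ?_⟩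
  rw [symp_frameVec_sum, Matrix.mulVec_mulVec, Matrix.mul_nonsing_inv _ hJ.isUnit,
    Matrix.one_mulVec]

theorem graphVec_eq_of_chart_eq (h : chart Ω c = chart Ω' c') : graphVec c = graphVec c' := by
  have hZ : chartZ c = chartZ c' := congrArg Triple.Z h
  funext n
  refine eq_of_mem_chartZ (c := c') (hZ ▸ graphVec_mem c n) (graphVec_mem c' n) ?_
  rw [polar_graphVec, polar_graphVec]

theorem inl_eq_of_graphVec_eq (h : graphVec c = graphVec c') (p : Sym2 ℕ) :
    c (Sum.inl p) = c' (Sum.inl p) := by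
  induction p using Sym2.inductionOn with
  | hf m n =>
    have h1 := congrArg (hcoeff (m + 1 : ℤ)) (congrFun h n)
    rw [graphVec, graphVec, map_add, map_add, hcoeff_hplus_nat, hcoeff_hplus_nat] at h1
    exact mul_right_cancel₀ (Nat.cast_add_one_ne_zero n) (add_left_cancel h1)

theorem graphVec_eq_of_inl_eq (h : ∀ p, c (Sum.inl p) = c' (Sum.inl p)) :
    graphVec c = graphVec c' := by
  funext n
  simp only [graphVec, h]

/-- F^⊥ ∩ H'_+ is spanned by the h_i: after subtracting the combination with the same pairings on J,
the remainder pairs to 0 with the frame of F, hence with every b_{-n}. -/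
theorem mem_span_frameVec (hc : c ∈ frames g) {y : HPrime} (hy : y ∈ HPlus)
    (h0 : ∀ z ∈ (chart Ω c).F, symp y z = 0) :
    ∃ a : Fin g → ℂ, y = ∑ k, a k • frameVec c k := by
  obtain ⟨J, hJ⟩ := exists_det_ne_zero hc
  set a := Matrix.vecMul (fun j => symp y (bvec (-(J j + 1 : ℤ)))) (minorMat c J)⁻¹ with ha
  set w := ∑ k, a k • frameVec c k with hw
  have hwp : w ∈ HPlus :=
    Submodule.sum_mem _ fun _ _ => Submodule.smul_mem _ _ (frameVec_mem c _)
  have hb : ∀ (v : HPrime), v ∈ HPlus → ∀ n,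
      symp v (graphVec c n) = symp v (bvec (-(n + 1 : ℤ))) := fun v hv n => by
    rw [graphVec, map_add, symp_plus hv (hplus_mem _), add_zero]
  have hJ0 : ∀ j, symp (y - w) (graphVec c (J j)) = 0 := by
    intro j
    rw [hb _ (sub_mem hy hwp), map_sub, LinearMap.sub_apply, sub_eq_zero]
    have h1 : Matrix.vecMul a (minorMat c J) j = symp y (bvec (-(J j + 1 : ℤ))) := by
      rw [ha, Matrix.vecMul_vecMul, Matrix.nonsing_inv_mul _ hJ.isUnit, Matrix.vecMul_one]
    rw [← h1, hw]
    simp [Matrix.vecMul, dotProduct, minorMat]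
  have hF0 : ∀ z ∈ (chart Ω c).F, symp (y - w) z = 0 := by
    intro z hz
    rw [map_sub, LinearMap.sub_apply, h0 z hz, hw]
    simp [(mem_chart_F.1 hz).2]
  refine ⟨a, sub_eq_zero.1 (symp_plus_left_ext (sub_mem hy hwp) fun n => ?_)⟩
  have h1 := hF0 _ (frameSection_mem (Ω := Ω) hJ n)
  rw [frameSection_chart hJ, map_sub, map_sum] at h1
  simp only [map_smul, hJ0, smul_zero, Finset.sum_const_zero, sub_zero] at h1
  rw [← hb _ (sub_mem hy hwp), h1]

/-- `A` is the coordinate change between two presentations of a point of `Sp(X, Θ)`. -/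
structure IsTransition (Ω Ω' : Matrix (Fin g) (Fin g) ℂ) (A : Matrix (Fin g) (Fin g) ℂ) :
    Prop where
  injective : ∀ x, A.mulVec x = 0 → x = 0
  lattice : ∀ x, IsLat Ω x ↔ IsLat Ω' (A.mulVec x)
  conj : ∀ x, IsLat Ω x → ∀ k, conjCoef Ω x k = ∑ j, conjCoef Ω' (A.mulVec x) j * A j k

theorem symp_frameVec_mulVec {A : Matrix (Fin g) (Fin g) ℂ}
    (h : ∀ i, frameVec c' i = ∑ k, A i k • frameVec c k) (z : HPrime) :
    (fun i => symp (frameVec c' i) z) = A.mulVec fun i => symp (frameVec c i) z := by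
  funext i
  rw [h, map_sum, LinearMap.sum_apply]
  simp only [map_smul, LinearMap.smul_apply, smul_eq_mul, Matrix.mulVec, dotProduct]

/-- F determines the span of the h_i, which gives A. The lattice and conjugation conditions come
from K, whose elements decompose uniquely into a part in Z and a part in H'_+. -/
theorem exists_transition (hc : c ∈ frames g) (heq : chart Ω c = chart Ω' c') :
    ∃ A : Matrix (Fin g) (Fin g) ℂ, IsTransition Ω Ω' A ∧
      ∀ i, frameVec c' i = ∑ k, A i k • frameVec c k := by
  have hZ : chartZ c = chartZ c' := congrArg Triple.Z heq
  have hF : (chart Ω c).F = (chart Ω' c').F := congrArg Triple.F heq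
  have hK : (chart Ω c).K = (chart Ω' c').K := congrArg Triple.K heq
  choose A hA using fun i => mem_span_frameVec (Ω := Ω) hc (frameVec_mem c' i) fun z hz =>
    (mem_chart_F.1 (hF ▸ hz)).2 i
  have hx := symp_frameVec_mulVec (A := A) hA
  -- Uniqueness of the decomposition, from Z ∩ H'_+ = 0.
  have key : ∀ z ∈ chartZ c, ∀ z' ∈ chartZ c, ∀ v ∈ HPlus, ∀ v' ∈ HPlus,
      z + v = z' + v' → z = z' ∧ v = v' := by
    intro z hz z' hz' v hv v' hv' e
    have h1 : z = z' := by
      refine eq_of_mem_chartZ hz hz' ?_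
      have := congrArg polar e
      rwa [map_add, map_add, polar_plus hv, polar_plus hv', add_zero, add_zero] at this
    exact ⟨h1, by rw [h1] at e; exact add_left_cancel e⟩
  have hlat : ∀ z ∈ chartZ c, IsLat Ω (fun i => symp (frameVec c i) z) →
      IsLat Ω' (fun i => symp (frameVec c' i) z) ∧
      (conjVec Ω c fun i => symp (frameVec c i) z) =
        conjVec Ω' c' fun i => symp (frameVec c' i) z := by
    intro z hz hl
    have h1 : z + (conjVec Ω c fun i => symp (frameVec c i) z) ∈ (chart Ω' c').K := by
      rw [← hK]
      exact mem_chart_K.2 ⟨z, hz, hl, rfl⟩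
    obtain ⟨z', hz', hl', e⟩ := mem_chart_K.1 h1
    obtain ⟨rfl, e2⟩ := key z hz z' (hZ ▸ hz') _ (conjVec_mem_plus _ _ _) _
      (conjVec_mem_plus _ _ _) e
    exact ⟨hl', e2⟩
  have hlat' : ∀ z ∈ chartZ c, IsLat Ω' (fun i => symp (frameVec c' i) z) →
      IsLat Ω (fun i => symp (frameVec c i) z) := by
    intro z hz hl
    have h1 : z + (conjVec Ω' c' fun i => symp (frameVec c' i) z) ∈ (chart Ω c).K := by
      rw [hK]
      exact mem_chart_K.2 ⟨z, hZ ▸ hz, hl, rfl⟩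
    obtain ⟨z', hz', hl', e⟩ := mem_chart_K.1 h1
    obtain ⟨rfl, -⟩ := key z hz z' hz' _ (conjVec_mem_plus _ _ _) _ (conjVec_mem_plus _ _ _) e
    exact hl'
  refine ⟨A, ⟨fun x hAx => ?_, fun x => ?_, fun x hl k => ?_⟩, hA⟩
  · obtain ⟨z, hz, hzx⟩ := exists_symp_frameVec hc x
    have h1 : z ∈ (chart Ω' c').F := by
      refine mem_chart_F.2 ⟨hZ ▸ hz, fun i => ?_⟩
      have := congrFun (hx z) i
      beta_reduce at this
      rw [this, funext hzx, hAx]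
      rfl
    rw [← hF] at h1
    funext i
    rw [← hzx, (mem_chart_F.1 h1).2 i]
    rfl
  · obtain ⟨z, hz, hzx⟩ := exists_symp_frameVec hc x
    rw [← funext hzx, ← hx]
    exact ⟨fun h => (hlat z hz h).1, hlat' z hz⟩
  · obtain ⟨z, hz, hzx⟩ := exists_symp_frameVec hc x
    have h1 := (hlat z hz (by rwa [funext hzx])).2
    rw [hx, funext hzx, conjVec_eq, conjVec_eq] at h1
    simp only [hA, Finset.smul_sum, smul_smul] at h1
    rw [Finset.sum_comm] at h1
    simp only [← Finset.sum_smul] at h1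
    rw [← sub_eq_zero, ← Finset.sum_sub_distrib] at h1
    simp only [← sub_smul] at h1
    exact sub_eq_zero.1 (Fintype.linearIndependent_iff.1 hc _ h1 k)

/-- The conditions on A involve Ω and Ω' only, so the same A identifies any other two points with
equal φ and frames related by A. -/
theorem IsTransition.chart_eq {A : Matrix (Fin g) (Fin g) ℂ} (hA : IsTransition Ω Ω' A)
    (h : ∀ i, frameVec c' i = ∑ k, A i k • frameVec c k)
    (hg : ∀ p, c (Sum.inl p) = c' (Sum.inl p)) : chart Ω c = chart Ω' c' := by
  have hx := symp_frameVec_mulVec h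
  have hZ : chartZ c = chartZ c' := by
    rw [chartZ, chartZ, graphVec_eq_of_inl_eq hg]
  have hconj : ∀ x, IsLat Ω x → conjVec Ω c x = conjVec Ω' c' (A.mulVec x) := by
    intro x hl
    rw [conjVec_eq, conjVec_eq]
    simp only [h, Finset.smul_sum, smul_smul]
    rw [Finset.sum_comm]
    simp only [← Finset.sum_smul, hA.conj x hl]
  refine Triple.ext hZ ?_ ?_
  · ext y
    rw [mem_chart_F, mem_chart_F, hZ]
    refine and_congr_right fun _ => ⟨fun h0 i => ?_, fun h0 i => ?_⟩
    · have := congrFun (hx y) i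
      beta_reduce at this
      rw [this, show (fun i => symp (frameVec c i) y) = 0 from funext h0, Matrix.mulVec_zero]
      rfl
    · exact congrFun (hA.injective _ ((hx y).symm.trans (funext h0))) i
  · ext y
    rw [mem_chart_K, mem_chart_K, hZ]
    refine exists_congr fun z => and_congr_right fun _ => ?_
    rw [hx, ← hA.lattice]
    exact and_congr_right fun hl => by rw [hconj _ hl]

end Transition

/-! ### The vector fields on the coordinate space -/

section SpField

variable {g : ℕ} {S : HPrime →ₗ[ℂ] HPrime}

theorem IsSpAlg.map_plus (hS : IsSpAlg S) {y : HPrime} (hy : y ∈ HPlus) : S y ∈ HPlus :=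
  hS.plus ⟨y, hy, rfl⟩

theorem IsSpAlg.isOpFamily (hS : IsSpAlg S) {ι : Type} (t : ι → ℂ) :
    IsOpFamily (fun _ => S) (fun _ => -S) t := by
  refine ⟨Eventually.of_forall fun _ f g => ?_, Eventually.of_forall fun _ _ hf => hS.map_plus hf,
    fun f => HolHAt.const _ _, fun f => HolHAt.const _ _⟩
  rw [LinearMap.neg_apply, map_neg]
  exact eq_neg_of_add_eq_zero_left (hS.skew f g)

theorem holAt_spField (hS : IsSpAlg S) {ι : Type} {t : ι → ℂ} {c : (ι → ℂ) → ChartIdx g → ℂ}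
    (hc : ∀ i, HolAt (fun u => c u i) t) (i : ChartIdx g) :
    HolAt (fun u => spField S (c u) i) t := by
  rcases i with p | ⟨i, n⟩
  · induction p using Sym2.inductionOn with
    | hf m n =>
      have h := fun n => (hS.isOpFamily t).apply (holHAt_graphVec hc n)
      refine HolAt.mul (HolAt.neg (HolAt.add ?_ ?_)) (HolAt.const _ _)
      · exact (holHAt_graphVec hc m).symp (h n)
      · exact (holHAt_graphVec hc n).symp (h m)
  · exact ((hS.isOpFamily t).apply (holHAt_frameVec hc i)).1 _

variable {c : ChartIdx g → ℂ}

theorem hplus_add_smul (a b : ℕ → ℂ) (ε : ℂ) :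
    hplus (fun n => a n + ε * b n) = hplus a + ε • hplus b := by
  refine hprime_ext fun n => ?_
  rw [map_add, map_smul]
  by_cases hn : n < 1
  · rw [mem_hfil.1 (hplus_mem _) n hn, mem_hfil.1 (hplus_mem _) n hn,
      mem_hfil.1 (hplus_mem _) n hn]
    simp
  · obtain ⟨k, rfl⟩ : ∃ k : ℕ, n = k + 1 := ⟨(n - 1).toNat, by omega⟩
    simp only [hcoeff_hplus_nat, smul_eq_mul]

theorem hplus_spField_inr (hS : IsSpAlg S) (i : Fin g) :
    hplus (fun n => spField S c (Sum.inr (i, n))) = S (frameVec c i) := by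
  have h := hplus_hcoeff (hS.map_plus (frameVec_mem c i))
  rw [← h]
  rfl

theorem frameVec_add_smul_spField (hS : IsSpAlg S) (ε : ℂ) (i : Fin g) :
    frameVec (c + ε • spField S c) i = frameVec c i + ε • S (frameVec c i) := by
  rw [← hplus_spField_inr hS, frameVec, frameVec, ← hplus_add_smul]
  rfl

/-- The vector field descends to Sp(X, Θ): its φ-component depends only on the graph vectors, and
its h-component S h_i commutes with the constant matrix A. -/
theorem chart_add_smul_spField (hS : IsSpAlg S) {Ω Ω' : Matrix (Fin g) (Fin g) ℂ}
    {c' : ChartIdx g → ℂ} (hc : c ∈ frames g) (h : chart Ω c = chart Ω' c') (ε : ℂ) :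
    chart Ω (c + ε • spField S c) = chart Ω' (c' + ε • spField S c') := by
  obtain ⟨A, hA, hf⟩ := exists_transition hc h
  have hg := graphVec_eq_of_chart_eq h
  refine hA.chart_eq (fun i => ?_) fun p => ?_
  · simp only [frameVec_add_smul_spField hS, hf, map_sum, map_smul, smul_add,
      Finset.sum_add_distrib, Finset.smul_sum]
    congr 1
    exact Finset.sum_congr rfl fun k _ => smul_comm _ _ _
  · change c _ + ε * spField S c (Sum.inl p) = c' _ + ε * spField S c' (Sum.inl p)
    rw [inl_eq_of_graphVec_eq hg p]
    congr 2
    simp only [spField, Sum.elim_inl, hg]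

/-- The velocity of a graph vector is the projection of its image under S to H'_+ along Z. Skewness
of S makes the two terms symmetrized in `spField` equal. -/
theorem hplus_spField_inl (hS : IsSpAlg S) (n : ℕ) :
    hplus (fun m => spField S c (Sum.inl s(m, n)) * (n + 1)) =
      S (graphVec c n) - graphLift c (S (graphVec c n)) := by
  have hr := sub_graphLift_mem c (S (graphVec c n))
  rw [← hplus_hcoeff hr]
  congr 1
  funext m
  have h1 : symp (bvec (-(m + 1 : ℤ))) (S (graphVec c n) - graphLift c (S (graphVec c n))) =
      symp (graphVec c m) (S (graphVec c n)) := by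
    have h2 := symp_chartZ (graphVec_mem c m) (graphLift_mem c (S (graphVec c n)))
    have h3 := symp_plus (hplus_mem fun k => c (Sum.inl s(k, m)) * (m + 1)) hr
    have h4 : graphVec c m = bvec (-(m + 1 : ℤ)) + hplus fun k => c (Sum.inl s(k, m)) * (m + 1) :=
      rfl
    have h5 : symp (graphVec c m) (S (graphVec c n) - graphLift c (S (graphVec c n))) =
        symp (bvec (-(m + 1 : ℤ))) (S (graphVec c n) - graphLift c (S (graphVec c n))) := by
      rw [h4, map_add symp, LinearMap.add_apply, h3, add_zero]
    rw [← h5, map_sub, h2, sub_zero]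
  have hsym : symp (graphVec c n) (S (graphVec c m)) = symp (graphVec c m) (S (graphVec c n)) := by
    have := hS.skew (graphVec c n) (graphVec c m)
    rw [symp_antisymm (S _)] at this
    linear_combination this
  rw [hcoeff_eq_symp, h1]
  change -(symp (graphVec c m) (S (graphVec c n)) + symp (graphVec c n) (S (graphVec c m))) /
    (2 * ((m : ℂ) + 1) * ((n : ℂ) + 1)) * ((n : ℂ) + 1) = _
  have h1 : (m : ℂ) + 1 ≠ 0 := Nat.cast_add_one_ne_zero m
  have h2 : (n : ℂ) + 1 ≠ 0 := Nat.cast_add_one_ne_zero n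
  rw [hsym]
  field_simp
  ring

theorem hasDerivH_hplus {a : ℂ → ℕ → ℂ} {a' : ℕ → ℂ}
    (h : ∀ n, HasDerivAt (fun ε => a ε n) (a' n) 0) :
    HasDerivH (fun ε => hplus (a ε)) (hplus a') := by
  refine ⟨⟨0, Eventually.of_forall fun _ => hfil_anti (by simp) (hplus_mem _)⟩, fun n => ?_⟩
  by_cases hn : n < 1
  · rw [mem_hfil.1 (hplus_mem _) n hn]
    exact (hasDerivAt_const (0 : ℂ) (0 : ℂ)).congr_of_eventuallyEq
      (Eventually.of_forall fun ε => mem_hfil.1 (hplus_mem _) n hn)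
  · obtain ⟨k, rfl⟩ : ∃ k : ℕ, n = k + 1 := ⟨(n - 1).toNat, by omega⟩
    simpa only [hcoeff_hplus_nat] using h k

theorem HasDerivH.const_add {y : ℂ → HPrime} {y' : HPrime} (h : HasDerivH y y') (z : HPrime) :
    HasDerivH (fun ε => z + y ε) y' := by
  obtain ⟨N, hN⟩ := (HasDerivH.const z).exists_common h
  exact ⟨⟨N, hN.mono fun _ hε => add_mem hε.1 hε.2⟩, fun n => by
    simpa using (h.2 n).const_add (hcoeff n z)⟩

theorem hasDerivH_graphVec {γ : ℂ → ChartIdx g → ℂ} {δ : ChartIdx g → ℂ} (hγ : CurveAt γ c δ)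
    (n : ℕ) : HasDerivH (fun ε => graphVec (γ ε) n)
      (hplus fun m => δ (Sum.inl s(m, n)) * (n + 1)) :=
  (hasDerivH_hplus fun _ => (hγ.2 _).mul_const _).const_add _

theorem hasDerivH_frameVec {γ : ℂ → ChartIdx g → ℂ} {δ : ChartIdx g → ℂ} (hγ : CurveAt γ c δ)
    (i : Fin g) : HasDerivH (fun ε => frameVec (γ ε) i) (hplus fun n => δ (Sum.inr (i, n))) :=
  hasDerivH_hplus fun _ => hγ.2 _

/-- Along the flow y stays orthogonal to the moving graph vectors and to the moving h_i.
Differentiating these equations and using skewness of S shows that S y - y' satisfies the equations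
of F at the starting point. -/
theorem sub_deriv_mem_F (hS : IsSpAlg S) {Ω : Matrix (Fin g) (Fin g) ℂ}
    {γ : ℂ → ChartIdx g → ℂ} (hγ : CurveAt γ c (spField S c)) {y : ℂ → HPrime} {y' : HPrime}
    (hy : HasDerivH y y') (hF : ∀ᶠ ε in 𝓝 0, y ε ∈ (chart Ω (γ ε)).F) :
    S (y 0) - y' ∈ (chart Ω c).F := by
  have h0 := hF.self_of_nhds
  rw [hγ.1] at h0
  have hy0 := mem_chart_F.1 h0
  refine mem_chart_F.2 ⟨mem_chartZ_of_symp fun n => ?_, fun i => ?_⟩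
  · have h1 := hasDerivAt_eq_zero_of_eventually ((hasDerivH_graphVec hγ n).symp hy)
      (hF.mono fun ε hε => symp_chartZ (graphVec_mem _ n) (mem_chart_F.1 hε).1)
    rw [hplus_spField_inl hS, hγ.1, map_sub symp, LinearMap.sub_apply,
      symp_chartZ (graphLift_mem c _) hy0.1] at h1
    have h2 := hS.skew (graphVec c n) (y 0)
    rw [map_sub]
    linear_combination h2 - h1
  · have h1 := hasDerivAt_eq_zero_of_eventually ((hasDerivH_frameVec hγ i).symp hy)
      (hF.mono fun ε hε => (mem_chart_F.1 hε).2 i)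
    rw [hplus_spField_inr hS, hγ.1] at h1
    have h2 := hS.skew (frameVec c i) (y 0)
    rw [map_sub]
    linear_combination h2 - h1

end SpField

/-! ### The action of the Lie algebra on sections -/

section Sections

variable {Γ : Type*} [AddCommGroup Γ] {d : ℕ} {H : Module.Basis (Fin d) ℂ (ℂ ⊗[ℤ] Γ)} {ℓ : ℂ}
  {g : ℕ} {P : PPAV g} {S : HPrime →ₗ[ℂ] HPrime} {U : Set Triple} {s s' : Triple → Fock d}
  {Ω : Matrix (Fin g) (Fin g) ℂ} {c : ChartIdx g → ℂ}

theorem charted_chart (hΩ : IsPeriod P Ω) (hc : c ∈ frames g) : Charted P (chart Ω) c :=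
  ⟨Ω, hΩ, fun u => u, fun i => HolAt.coord i c, by
    filter_upwards [isOpen_frames.mem_nhds hc] with u hu using ⟨hu, rfl⟩⟩

theorem eventually_chart_mem (hU : IsOpenSp P U) (hΩ : IsPeriod P Ω) (hc : c ∈ frames g)
    (h : chart Ω c ∈ U) : ∀ᶠ u in 𝓝 c, u ∈ frames g ∧ chart Ω u ∈ U :=
  (hU Ω hΩ).mem_nhds ⟨hc, h⟩

theorem IsSection.holV (hs : IsSection P U s) (hΩ : IsPeriod P Ω) (hc : c ∈ frames g)
    (h : chart Ω c ∈ U) : HolV (fun u => s (chart Ω u)) c :=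
  mem_secGerms.1 (hs Ω hΩ c hc h)

theorem HolV.spAct {ι : Type} {t : ι → ℂ} {w : (ι → ℂ) → Fock d} (hw : HolV w t) :
    HolV (fun u => spAct ℓ S (w u)) t :=
  HolV.apply (L := fun _ => spActHom d ℓ S) (fun _ => HolV.const _ _) hw

theorem IsSection.exists_spDeriv (hS : IsSpAlg S) (hs : IsSection P U s) (hΩ : IsPeriod P Ω)
    (hc : c ∈ frames g) (h : chart Ω c ∈ U) :
    ∃ w, HolV w c ∧ ∀ᶠ u in 𝓝 c, ∀ γ, CurveAt γ u (spField S u) →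
      HasDerivF (fun ε => s (chart Ω (γ ε))) (w u) :=
  (hs.holV hΩ hc h).exists_deriv fun i => holAt_spField hS (fun i => HolAt.coord i c) i

theorem IsSpDeriv.isSection (hS : IsSpAlg S) (hU : IsOpenSp P U) (hs : IsSection P U s)
    (h : IsSpDeriv ℓ P S U s s') : IsSection P U s' := by
  intro Ω hΩ c hc hcU
  obtain ⟨w, hw, hd⟩ := hs.exists_spDeriv hS hΩ hc hcU
  refine mem_secGerms.2 (((hs.holV hΩ hc hcU).spAct (ℓ := ℓ) (S := S)).sub hw |>.congr ?_)
  filter_upwards [hd, eventually_chart_mem hU hΩ hc hcU] with u h1 h2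
  have h3 := HasDerivV.unique (h1 _ (CurveAt.line u _)).hasDerivV (h Ω hΩ u h2.1 h2.2)
  rw [h3, sub_sub_cancel]

/-- The derivative must be one function of the triple, so a value is chosen at each point;
independence of the presentation is `chart_add_smul_spField`. -/
theorem exists_isSpDeriv (ℓ : ℂ) (hS : IsSpAlg S) (hs : IsSection P U s) :
    ∃ s', IsSpDeriv ℓ P S U s s' := by
  have hD : ∀ a : Triple, ∃ v : Fock d, ∀ Ω, IsPeriod P Ω → ∀ c ∈ frames g, a = chart Ω c →
      a ∈ U → HasDerivV (fun ε => s (chart Ω (c + ε • spField S c))) v := by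
    intro a
    by_cases ha : ∃ Ω, IsPeriod P Ω ∧ ∃ c ∈ frames g, a = chart Ω c ∧ a ∈ U
    · obtain ⟨Ω, hΩ, c, hc, rfl, haU⟩ := ha
      obtain ⟨w, -, hd⟩ := hs.exists_spDeriv hS hΩ hc haU
      refine ⟨w c, fun Ω' _ c' _ e _ => ?_⟩
      have h1 := (hd.self_of_nhds _ (CurveAt.line c _)).hasDerivV
      simpa only [chart_add_smul_spField hS hc e] using h1
    · exact ⟨0, fun Ω hΩ c hc e haU => absurd ⟨Ω, hΩ, c, hc, e, haU⟩ ha⟩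
  choose D hD using hD
  refine ⟨fun a => spAct ℓ S (s a) - D a, fun Ω hΩ c hc hcU => ?_⟩
  rw [sub_sub_cancel]
  exact hD _ Ω hΩ c hc rfl hcU

theorem OutAt.exists_spDeriv (hS : IsSpAlg S) (hΩ : IsPeriod P Ω) (hc : c ∈ frames g)
    {w : (ChartIdx g → ℂ) → Fock d} (h : OutAt H ℓ P (chart Ω) c w) :
    ∃ w', OutAt H ℓ P (chart Ω) c w' ∧ ∀ᶠ u in 𝓝 c, ∀ γ, CurveAt γ u (spField S u) →
      HasDerivF (fun ε => w (γ ε)) (spAct ℓ S (w u) - w' u) := by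
  have hδ : ∀ i, HolAt (fun u : ChartIdx g → ℂ => spField S u i) c := fun i =>
    holAt_spField hS (fun i => HolAt.coord i c) i
  have hx := charted_chart hΩ hc
  -- The induction also carries membership of w, because the Leibniz rule for a • w produces a' • w.
  have key : OutAt H ℓ P (chart Ω) c w ∧
      ∃ w', OutAt H ℓ P (chart Ω) c w' ∧ ∀ᶠ u in 𝓝 c, ∀ γ, CurveAt γ u (spField S u) →
        HasDerivF (fun ε => w (γ ε)) (spAct ℓ S (w u) - w' u) := by
    refine OutAt.induction (Q := fun w => OutAt H ℓ P (chart Ω) c w ∧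
      ∃ w', OutAt H ℓ P (chart Ω) c w' ∧ ∀ᶠ u in 𝓝 c, ∀ γ, CurveAt γ u (spField S u) →
        HasDerivF (fun ε => w (γ ε)) (spAct ℓ S (w u) - w' u)) ?_ ?_ ?_ ?_ ?_ h
    · rintro w₁ w₂ e ⟨h1, w', h2, h3⟩
      refine ⟨h1.congr e, w', h2, ?_⟩
      filter_upwards [h3, e.eventually_nhds] with u h4 h5 γ hγ
      rw [← h5.self_of_nhds]
      exact (h4 γ hγ).congr (hγ.tendsto.eventually h5)
    · intro U f A w hU hcU hf hw
      have hev := eventually_chart_mem hU hΩ hc hcU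
      have hfF : ∀ᶠ u in 𝓝 c, f (chart Ω u) ∈ (chart Ω u).F :=
        hev.mono fun u hu => (hf Ω hΩ u hu.1 hu.2).2
      have hfh := hf.holHAt hx hcU
      obtain ⟨f', hf', hfd⟩ := HolHAt.exists_deriv (f := fun u => f (chart Ω u))
        (hev.mono fun u hu => (hf Ω hΩ u hu.1 hu.2).1) hδ
      obtain ⟨w', hw', hwd⟩ := hw.exists_deriv hδ
      -- With primes for derivatives along the flow, S · (f w) = (S f - f') w + f (S w - w'), and S
      -- f - f' is again a family in F.
      refine ⟨OutAt.of_mem hx hfh hfF A hw,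
        fun u => heis H ℓ A (S (f (chart Ω u)) - f' u) (w u) +
          heis H ℓ A (f (chart Ω u)) (spAct ℓ S (w u) - w' u),
        (OutAt.of_mem hx (((hS.isOpFamily c).apply hfh).sub hf') ?_ A hw).add
          (OutAt.of_mem hx hfh hfF A (hw.spAct.sub hw')), ?_⟩
      · filter_upwards [hfd, hfF.eventually_nhds] with u h1 h2
        have h3 := sub_deriv_mem_F hS (CurveAt.line u (spField S u))
          (h1 _ (CurveAt.line u _)) ((CurveAt.line u (spField S u)).tendsto.eventually h2)
        simpa using h3
      · filter_upwards [hfd, hwd] with u h1 h2 γ hγ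
        have h3 := (h1 γ hγ).heis (ℓ := ℓ) H A (h2 γ hγ)
        rw [hγ.1] at h3
        rw [spAct_heis H hS, heis_sub, map_sub]
        convert h3 using 1
        abel
    · refine ⟨OutAt.zero, _, OutAt.zero, Eventually.of_forall fun u γ _ => ?_⟩
      rw [sub_zero, ← MvPolynomial.C_0, spAct_C]
      exact HasDerivF.const _
    · rintro w₁ w₂ ⟨h1, w₁', h2, h3⟩ ⟨h4, w₂', h5, h6⟩
      refine ⟨h1.add h4, _, h2.add h5, ?_⟩
      filter_upwards [h3, h6] with u h7 h8 γ hγ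
      rw [spAct_add, add_sub_add_comm]
      exact (h7 γ hγ).add (h8 γ hγ)
    · rintro a w ha ⟨h1, w', h2, h3⟩
      obtain ⟨a', ha', had⟩ := ha.exists_deriv hδ
      refine ⟨h1.smul ha, _, (h2.smul ha).sub (h1.smul ha'), ?_⟩
      filter_upwards [h3, had] with u h4 h5 γ hγ
      have h6 := HasDerivF.smul (h5 γ hγ) (h4 γ hγ)
      rw [hγ.1] at h6
      rw [spAct_smul]
      convert h6 using 1
      rw [smul_sub]
      abel
  exact key.2

variable (H ℓ P)

theorem spAlgebraActs : SpAlgebraActs H ℓ P := by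
  intro S hS U hU s hs
  refine ⟨?_, fun s' hs' hout => ⟨hs'.isSection hS hU hs, fun Ω hΩ c hc hcU => ?_⟩⟩
  · obtain ⟨s', hs'⟩ := exists_isSpDeriv ℓ hS hs
    exact ⟨s', hs'.isSection hS hU hs, hs'⟩
  · obtain ⟨w', hw', hd⟩ := OutAt.exists_spDeriv hS hΩ hc (hout.2 Ω hΩ c hc hcU)
    refine OutAt.congr hw' ?_
    filter_upwards [hd, eventually_chart_mem hU hΩ hc hcU] with u h1 h2
    have h3 := HasDerivV.unique (h1 _ (CurveAt.line u _)).hasDerivV (hs' Ω hΩ u h2.1 h2.2)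
    simpa using h3

end Sections

/-! ### The equivariant structure exponentiates the action of the Lie algebra -/

section MoveDeriv

variable {g : ℕ} {S : HPrime →ₗ[ℂ] HPrime} {c : ChartIdx g → ℂ}

theorem moveCoord_one (c : ChartIdx g → ℂ) : moveCoord 1 c = c := by
  have h1 : graphVec (moveCoord 1 c) = graphVec c := by
    funext n
    rw [graphVec_moveCoord isSympPlus_one]
    exact graphLift_bvec c n
  funext i
  rcases i with p | ⟨i, n⟩
  · exact inl_eq_of_graphVec_eq h1 p
  · exact hcoeff_hplus_nat n _

/-- The left side is the derivative at the identity of one half of the φ-coordinate of the moved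
point; the right side is the matching term of `spField`. -/
theorem symp_add_symp_graphLift (hS : IsSpAlg S) (m n : ℕ) :
    symp (S (bvec (-(m + 1 : ℤ)))) (graphVec c n) +
      symp (bvec (-(m + 1 : ℤ))) (graphLift c (S (bvec (-(n + 1 : ℤ))))) =
    -symp (graphVec c m) (S (graphVec c n)) := by
  obtain ⟨φ, hφ, em⟩ : ∃ φ ∈ HPlus, graphVec c m = bvec (-(m + 1 : ℤ)) + φ :=
    ⟨_, hplus_mem _, rfl⟩
  obtain ⟨ψ, hψ, en⟩ : ∃ ψ ∈ HPlus, graphVec c n = bvec (-(n + 1 : ℤ)) + ψ :=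
    ⟨_, hplus_mem _, rfl⟩
  have h1 := symp_chartZ (graphVec_mem c m) (graphLift_mem c (S (bvec (-(n + 1 : ℤ)))))
  have h2 := symp_plus hφ (sub_graphLift_mem c (S (bvec (-(n + 1 : ℤ)))))
  have h3 := symp_plus (hS.map_plus hφ) hψ
  have h4 := hS.skew φ (bvec (-(n + 1 : ℤ)))
  have h5 := hS.skew (graphVec c m) (graphVec c n)
  rw [em, en] at h5
  rw [em] at h1
  rw [em, en]
  simp only [map_add, map_sub, LinearMap.add_apply] at h1 h2 h5 ⊢
  linear_combination h5 + h1 + h2 - h3 - h4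

/-- Sections are evaluated at η(ε)⁻¹ a, hence the sign. No derivative of the inverse curve is
needed: the formula for φ under η⁻¹ involves only η, and for the h_i the adjoint relation moves η⁻¹
across the form. -/
theorem curveAt_moveCoord (hS : IsSpAlg S) {η : ℂ → (HPrime ≃ₗ[ℂ] HPrime)} (h1 : η 0 = 1)
    (hη : ∀ᶠ ε in 𝓝 0, IsSympPlus (η ε)) (h : ∀ f, HasDerivH (fun ε => η ε f) (S f))
    (c : ChartIdx g → ℂ) : CurveAt (fun ε => moveCoord (η ε).symm c) c (-spField S c) := by
  refine ⟨?_, fun i => ?_⟩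
  · beta_reduce
    rw [h1]
    exact moveCoord_one c
  rcases i with p | ⟨i, n⟩
  · induction p using Sym2.inductionOn with
    | hf m n =>
      have key : ∀ m n : ℕ, HasDerivAt (fun ε => symp (η ε (bvec (-(m + 1 : ℤ))))
          (graphLift c (η ε (bvec (-(n + 1 : ℤ))))))
          (-symp (graphVec c m) (S (graphVec c n))) 0 := by
        intro m n
        have := (h (bvec (-(m + 1 : ℤ)))).symp
          ((h (bvec (-(n + 1 : ℤ)))).linearCombination (graphVec c))
        rw [h1] at this
        simp only [LinearEquiv.coe_one, id] at this
        rw [← symp_add_symp_graphLift hS, ← graphLift_bvec c n]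
        exact this
      have := (((key m n).add (key n m)).neg).div_const (2 * ((m : ℂ) + 1) * ((n : ℂ) + 1))
      have e : (-spField S c) (Sum.inl s(m, n)) =
          -(-symp (graphVec c m) (S (graphVec c n)) + -symp (graphVec c n) (S (graphVec c m))) /
            (2 * ((m : ℂ) + 1) * ((n : ℂ) + 1)) := by
        change -(-(symp (graphVec c m) (S (graphVec c n)) + symp (graphVec c n) (S (graphVec c m))) /
          (2 * ((m : ℂ) + 1) * ((n : ℂ) + 1))) = _
        ring
      rw [e]
      exact this
  · have h2 := ((h (bvec (-(n + 1 : ℤ)))).symp (HasDerivH.const (frameVec c i))).neg.div_const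
      ((n : ℂ) + 1)
    refine HasDerivAt.congr_of_eventuallyEq (f := fun ε =>
      -symp (η ε (bvec (-(n + 1 : ℤ)))) (frameVec c i) / ((n : ℂ) + 1)) ?_ ?_
    · have e : (-spField S c) (Sum.inr (i, n)) =
          -(symp (S (bvec (-(n + 1 : ℤ)))) (frameVec c i) + symp (η 0 (bvec (-(n + 1 : ℤ)))) 0) /
            ((n : ℂ) + 1) := by
        change -hcoeff (n + 1 : ℤ) (S (frameVec c i)) = _
        have h3 := hS.skew (bvec (-(n + 1 : ℤ))) (frameVec c i)
        rw [hcoeff_eq_symp, map_zero, add_zero]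
        linear_combination (1 / ((n : ℂ) + 1)) * h3
      rw [e]
      exact h2
    · filter_upwards [hη] with ε hε
      change hcoeff (n + 1 : ℤ) ((η ε).symm (frameVec c i)) = _
      rw [hcoeff_eq_symp, hε.adjoint]

end MoveDeriv

section Exponentiate

variable {Γ : Type*} [AddCommGroup Γ] {d : ℕ} {H : Module.Basis (Fin d) ℂ (ℂ ⊗[ℤ] Γ)} {ℓ : ℂ}
  {g : ℕ} {P : PPAV g} {Ω : Matrix (Fin g) (Fin g) ℂ} {c : ChartIdx g → ℂ}

theorem HasDerivF.comp_neg {w : ℂ → Fock d} {w' : Fock d} (h : HasDerivF w w') :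
    HasDerivF (fun ε => w (-ε)) (-w') := by
  obtain ⟨⟨M, hM⟩, h⟩ := h
  have ht : Tendsto (fun ε : ℂ => -ε) (𝓝 0) (𝓝 0) := by
    simpa using (continuous_neg (G := ℂ)).tendsto 0
  refine ⟨⟨M, ht.eventually hM⟩, fun m => ?_⟩
  have h1 : HasDerivAt (fun ε => MvPolynomial.coeff m (w ε)) (MvPolynomial.coeff m w')
      (-(0 : ℂ)) := by
    rw [neg_zero]
    exact h m
  have h2 := h1.scomp (0 : ℂ) (hasDerivAt_neg (0 : ℂ))
  rw [smul_eq_mul, neg_one_mul] at h2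
  exact h2

theorem CurveAt.comp_neg {ι : Type} {γ : ℂ → ι → ℂ} {u δ : ι → ℂ} (h : CurveAt γ u (-δ)) :
    CurveAt (fun ε => γ (-ε)) u δ := by
  refine ⟨by simpa using h.1, fun i => ?_⟩
  have h1 : HasDerivAt (fun ε => γ ε i) (-δ i) (-(0 : ℂ)) := by
    rw [neg_zero]
    exact h.2 i
  have h2 := h1.scomp (0 : ℂ) (hasDerivAt_neg (0 : ℂ))
  rw [smul_eq_mul, neg_mul_neg, one_mul] at h2
  exact h2

theorem curveAt_withParam (c : ChartIdx g → ℂ) :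
    CurveAt (fun ε => withParam ε c) (withParam 0 c) (withParam 1 0) := by
  refine ⟨rfl, fun i => ?_⟩
  cases i with
  | none => exact hasDerivAt_id 0
  | some i => exact hasDerivAt_const 0 _

theorem holAt_withParam (c : ChartIdx g → ℂ) (i : Option (ChartIdx g)) :
    HolAt (fun u : ChartIdx g → ℂ => withParam 0 u i) c := by
  cases i with
  | none => exact HolAt.const 0 c
  | some i => exact HolAt.coord i c

/-- The family of triples does not depend on ε, so differentiating a generator in ε touches only its
V-valued factor and the result stays in the image. -/
theorem OutAt.exists_paramDeriv (hΩ : IsPeriod P Ω) (hc : c ∈ frames g)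
    {w : (Option (ChartIdx g) → ℂ) → Fock d}
    (h : OutAt H ℓ P (fun u => chart Ω fun i => u (some i)) (withParam 0 c) w) :
    ∃ w', OutAt H ℓ P (chart Ω) c w' ∧
      ∀ᶠ u in 𝓝 c, HasDerivF (fun ε => w (withParam ε u)) (w' u) := by
  have hx := charted_chart hΩ hc
  have hq := holAt_withParam c
  have ht := tendsto_of_holAt (q := fun u : ChartIdx g → ℂ => withParam 0 u) hq
  have hδ : ∀ i, HolAt (fun _ : Option (ChartIdx g) → ℂ => withParam (1 : ℂ) (0 : ChartIdx g → ℂ) i)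
    (withParam 0 c) := fun _ => HolAt.const _ _
  refine (OutAt.induction (Q := fun w => OutAt H ℓ P (chart Ω) c (fun u => w (withParam 0 u)) ∧
    ∃ w', OutAt H ℓ P (chart Ω) c w' ∧
      ∀ᶠ u in 𝓝 c, HasDerivF (fun ε => w (withParam ε u)) (w' u)) ?_ ?_ ?_ ?_ ?_ h).2
  · rintro w₁ w₂ e ⟨h1, w', h2, h3⟩
    refine ⟨h1.congr (ht.eventually e), w', h2, ?_⟩
    filter_upwards [h3, ht.eventually e.eventually_nhds] with u h4 h5
    exact h4.congr ((curveAt_withParam u).tendsto.eventually h5)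
  · intro U f A w hU hcU hf hw
    have hfh := hf.holHAt hx hcU
    have hfF := hf.eventually_mem hU hx hcU
    obtain ⟨w', hw', hwd⟩ := hw.exists_deriv hδ
    refine ⟨OutAt.of_mem hx hfh hfF A (HolV.comp hw hq), _,
      OutAt.of_mem hx hfh hfF A (HolV.comp hw' hq), ?_⟩
    filter_upwards [ht.eventually hwd] with u h1
    have h2 := (HasDerivH.const (f (chart Ω u))).heis (ℓ := ℓ) H A (h1 _ (curveAt_withParam u))
    have h0 : heis H ℓ A 0 (w (withParam 0 u)) = 0 := by
      have := heis_sub (ℓ := ℓ) H A 0 0 (w (withParam 0 u))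
      rwa [sub_self, sub_self] at this
    rw [h0, zero_add] at h2
    exact h2
  · exact ⟨OutAt.zero, _, OutAt.zero, Eventually.of_forall fun u => HasDerivF.const _⟩
  · rintro w₁ w₂ ⟨h1, w₁', h2, h3⟩ ⟨h4, w₂', h5, h6⟩
    refine ⟨h1.add h4, _, h2.add h5, ?_⟩
    filter_upwards [h3, h6] with u h7 h8
    exact h7.add h8
  · rintro a w ha ⟨h1, w', h2, h3⟩
    obtain ⟨a', ha', had⟩ := ha.exists_deriv hδ
    refine ⟨h1.smul (HolAt.comp ha hq), _,
      (h1.smul (HolAt.comp ha' hq)).add (h2.smul (HolAt.comp ha hq)), ?_⟩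
    filter_upwards [h3, ht.eventually had] with u h4 h5
    exact HasDerivF.smul (h5 _ (curveAt_withParam u)) h4

theorem exponentiates_equivariantStructure : (equivariantStructure H ℓ P).Exponentiates := by
  intro S hS D η hD h0 hη h1 hd U hU s s₁ hs hs₁ Ω hΩ c hc hcU s' r hrep hr
  have hG : GroupAt (fun w : Unit → ℂ => η (w ())) fun _ => 0 := hη.groupAt hD h0
  have hcont : Tendsto (fun (ε : ℂ) (_ : Unit) => ε) (𝓝 0) (𝓝 fun _ => 0) :=
    tendsto_pi_nhds.2 fun _ => tendsto_id
  have hsymp : ∀ᶠ ε in 𝓝 0, IsSympPlus (η ε) := hcont.eventually hG.symplectic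
  have hderiv : ∀ f, HasDerivH (fun ε => η ε f) (S f) := by
    intro f
    obtain ⟨N, hN⟩ := (hG.hol f).exists_nat
    exact ⟨⟨N, hcont.eventually hN⟩, hd f⟩
  have hG' : GroupAt (fun u : Option (ChartIdx g) → ℂ => η (u none)) (withParam 0 c) :=
    GroupAt.comp (ρ := fun w : Unit → ℂ => η (w ()))
      (q := fun (u : Option (ChartIdx g) → ℂ) (_ : Unit) => u none) hG fun _ => HolAt.coord _ _
  have hy : Charted P (fun u : Option (ChartIdx g) → ℂ => chart Ω fun i => u (some i))
      (withParam 0 c) := by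
    have hcoord : ∀ i, HolAt (fun u : Option (ChartIdx g) → ℂ => u (some i)) (withParam 0 c) :=
      fun i => HolAt.coord _ _
    refine ⟨Ω, hΩ, fun u i => u (some i), hcoord, ?_⟩
    filter_upwards [(tendsto_of_holAt (q := fun (u : Option (ChartIdx g) → ℂ) i => u (some i))
      hcoord).eventually (isOpen_frames.mem_nhds hc)] with u hu using ⟨hu, rfl⟩
  obtain ⟨-, -, hout⟩ := (represents_stalkMap hG' (hy.move hG'.symm)).1 hrep
  -- Moving by η⁻¹ and then by η returns to the base point, so the discrepancy is a section over the
  -- constant-in-ε family.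
  have hout' : OutAt H ℓ P (fun u => chart Ω fun i => u (some i)) (withParam 0 c) _ :=
    hout.congr_family (Eventually.of_forall fun u => by
      have e : η (u none) * (η (u none)).symm = 1 := mul_inv_cancel _
      rw [move_move, e, move_one])
  obtain ⟨o', ho', hod⟩ := OutAt.exists_paramDeriv hΩ hc hout'
  obtain ⟨w, -, hw⟩ := hs.exists_spDeriv hS hΩ hc hcU
  refine (OutAt.zero.sub ho').congr ?_
  filter_upwards [hod, hw, hr, eventually_chart_mem hU hΩ hc hcU] with c' h2 h3 h4 h5
  have h6 := HasDerivV.unique (h3 _ (CurveAt.line c' _)).hasDerivV (hs₁ Ω hΩ c' h5.1 h5.2)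
  -- The orbit of η⁻¹ has velocity opposite to the vector field; reversing time, differentiating,
  -- and reversing again gives derivative -w.
  have h7 := (h3 _ (curveAt_moveCoord hS h1 hsymp hderiv c').comp_neg).comp_neg
  simp only [neg_neg] at h7
  have h8 : HasDerivF (fun ε => s ((chart Ω c').move (η ε)⁻¹)) (-w c') := by
    refine h7.congr ?_
    filter_upwards [hsymp] with ε hε
    rw [← chart_move hε.symm]
    rfl
  -- Product rule: the operator contributes S(s) and the moving argument contributes -w, together
  -- the value of S · s.
  have h9 := hasDerivF_fockAct (ℓ := ℓ) hS.skew h1 hsymp hderiv h8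
  have h10 : HasDerivF (fun ε => s' (withParam ε c'))
      (spAct ℓ S (s ((chart Ω c').move (η 0)⁻¹)) + -w c' - o' c') := by
    have := h9.add (HasDerivF.smul (hasDerivAt_const (0 : ℂ) (-1 : ℂ)) h2)
    rw [zero_smul, zero_add, neg_one_smul, ← sub_eq_add_neg] at this
    refine this.congr (Eventually.of_forall fun ε => ?_)
    simp only [neg_one_smul, ← sub_eq_add_neg]
    exact sub_sub_cancel _ _
  have h11 := HasDerivV.unique h4 h10.hasDerivV
  rw [h11, h6, h1, inv_one, move_one]
  abel

end Exponentiate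

end

end HeisCoinv

open HeisCoinv

theorem theorem5p2 {Γ : Type*} [AddCommGroup Γ] [Module.Free ℤ Γ] [Module.Finite ℤ Γ]
    (form : LinearMap.BilinForm ℤ Γ) (hsymm : ∀ x y, form x y = form y x)
    (heven : ∀ x, Even (form x x)) (hpos : ∀ x, x ≠ 0 → 0 < form x x)
    {d : ℕ} (H : Module.Basis (Fin d) ℂ (TensorProduct ℤ ℂ Γ))
    (hH : ∀ i j, form.baseChange ℂ (H i) (H j) = if i = j then 1 else 0)
    (ℓ : ℂ) (hℓ : ℓ = 1 ∨ ℓ = 0) {g : ℕ} (P : PPAV g) :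
    SpAlgebraActs H ℓ P ∧
      ∃ E : EquivariantStructure H ℓ P, E.Exponentiates ∧ E.TrivialOnFibres :=
  ⟨spAlgebraActs H ℓ P, equivariantStructure H ℓ P, exponentiates_equivariantStructure,
    trivialOnFibres_equivariantStructure⟩
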